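/- Let $0\le k\le n$. \emph{The quantum Russell space.} A dotted crossingless matching is a crossingless matching of $2n$ points on a line, numbered from left to right, in which exactly $k$ arcs carry one dot each. Let $\widetilde R^q_{n,k}$ be the free $\mathbb Z[q,q^{-1}]$-module on these diagrams, and let $R^q_{n,k}$ be its quotient by the following relations, for points $a<b<c<d$ and diagrams that agree away from the arcs mentioned. Let $x_1,\dots,x_\alpha$ be all undotted arcs $(e_1,e_2)$ with $e_1<a$ and $e_2>d$, numbered from the innermost to the outermost, and let $n_i$ be the number of dotted arcs $(y_1,y_2)$ that lie strictly inside $x_i$ and satisfy $y_1<a$, $d<y_2$. \begin{itemize} \item Type I: $m=m_1+m_2+q^{-1}m_1'+(1-q^{-2})\sum_{i=1}^{\alpha}q^{\,i-n_i}\,m^{(i)}$, where $m$ and $m_1'$ contain the arcs $(a,d),(b,c)$, of which only $(b,c)$ is dotted in $m$ and only $(a,d)$ is dotted in $m_1'$; $m_1$ and $m_2$ contain the arcs $(a,b),(c,d)$, of which only $(a,b)$ is dotted in $m_1$ and only $(c,d)$ is dotted in $m_2$; $m^{(i)}$ contains the undotted arcs $(a,b),(c,d)$, and in it $x_i$ is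 dotted. \item Type II: $m=m'+(1-q^{-2})\sum_{i=1}^{\alpha}q^{\,i-1-n_i}\,m^{(i)}$, where $m$ contains the dotted arcs $(a,b),(c,d)$; $m'$ contains the dotted arcs $(a,d),(b,c)$; $m^{(i)}$ contains the dotted arc $(a,d)$ and the undotted arc $(b,c)$, and in it $x_i$ is dotted. \end{itemize} \emph{The Kauffman--Lins spaces.} Consider diagrams of arcs and circles, with crossings, below a line carrying $2(n+k)$ endpoints; the leftmost $k$ and the rightmost $k$ endpoints are placed in two projectors. Let $\widetilde S^q_{n,k}$ be the $\mathbb Z[q^{1/2},q^{-1/2}]$-module spanned by these diagrams modulo planar isotopy, the local relations that a circle equals $-q-q^{-1}$ and that a crossing whose overstrand runs from the lower left to the upper right equals $q^{1/2}$ times the vertical smoothing $)($ plus $q^{-1/2}$ times the horizontal smoothing (and with $q^{1/2}$, $q^{-1/2}$ exchanged for the other crossing), and the relation that a diagram is zero if it ends in a small arc joining two neighbouring endpoints of the same projector. Let $\varphi_{n,k-1}:\widetilde S^q_{n,k-1}\to\widetilde S^q_{n,k}$ add one point to each projector, on the far left and on the far right, and join the two new points by an outermost arc. Put $S^q_{n,k}=\operatorname{coker}\varphi_{n,k-1}$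 for $k\ge1$ and $S^q_{n,0}=\widetilde S^q_{n,0}$. \emph{The expansion map.} Let $\widetilde\psi_{n,k}:\widetilde R^q_{n,k}\to\widetilde S^q_{n,k}$ be the $\mathbb Z[q,q^{-1}]$-linear map that sends a dotted matching $x$ to $q^{-p/2}$ times the following diagram, where $p$ is the number of pairs of nested dotted arcs of $x$. Keep the undotted arcs, and replace each dotted arc $(i,j)$, $i<j$, by an arc from $i$ to the left projector and an arc from $j$ to the right projector. Here the left endpoints of the dotted arcs, from left to right, are joined to the points of the left projector from right to left, and likewise the right endpoints of the dotted arcs to the points of the right projector. If a dotted arc is nested inside an undotted arc, its left strand passes once under and its right strand passes once over the undotted arc; for two dotted arcs that are not nested, the right strand of the left one passes once over the left strand of the right one; there are no other crossings. \emph{Claim.} The composite $\widetilde R^q_{n,k}\to\widetilde S^q_{n,k}\to S^q_{n,k}$ of $\widetilde\psi_{n,k}$ and the quotient map annihilates all Type I and Type II relations, hence descends to a $\mathbb Z[q,q^{-1}]$-linear map $\psi_{n,k}:R^q_{n,k}\to S^q_{n,k}$; and the induced $\mathbb Z[q^{1/2},q^{-1/2}]$-linear map $$R^q_{n,k}\otimes_{\mathbb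 Z[q,q^{-1}]}\mathbb Z[q^{1/2},q^{-1/2}]\longrightarrow S^q_{n,k}$$ is an isomorphism. -/

import Mathlib

/-! ### Coefficient rings -/

/-- The ring `ℤ[q, q⁻¹]`; the variable of the Laurent polynomial ring is `q`. -/
abbrev QLaurent : Type := LaurentPolynomial ℤ

/-- The ring `ℤ[q^{1/2}, q^{-1/2}]`; the variable of the Laurent polynomial ring is `q^{1/2}`.
It is a type synonym, so that it carries its own algebra structure over `ℤ[q, q⁻¹]`. -/
def HalfLaurent : Type := LaurentPolynomial ℤ

noncomputable instance : CommRing HalfLaurent := inferInstanceAs (CommRing (LaurentPolynomial ℤ))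

/-- `q ^ e` in `ℤ[q, q⁻¹]`. -/
noncomputable def qPow (e : ℤ) : QLaurent := LaurentPolynomial.T e

/-- `(q^{1/2}) ^ e` in `ℤ[q^{1/2}, q^{-1/2}]`. -/
noncomputable def qHalfPow (e : ℤ) : HalfLaurent := (LaurentPolynomial.T e : LaurentPolynomial ℤ)

/-- The ring homomorphism `ℤ[q, q⁻¹] → ℤ[q^{1/2}, q^{-1/2}]` that sends `q` to `(q^{1/2})²`. -/
noncomputable def qInclusion : QLaurent →+* HalfLaurent :=
  AddMonoidAlgebra.mapDomainRingHom ℤ (AddMonoidHom.mulLeft (2 : ℤ))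

theorem qInclusion_qPow (e : ℤ) : qInclusion (qPow e) = qHalfPow (2 * e) := by
  unfold qInclusion qPow qHalfPow LaurentPolynomial.T
  erw [AddMonoidAlgebra.mapDomainRingHom_apply, AddMonoidAlgebra.mapDomain_single]
  rfl

noncomputable instance : Algebra QLaurent HalfLaurent := qInclusion.toAlgebra

/-! ### Matchings and dotted crossingless matchings -/

/-- A perfect matching of `N` points on a line, numbered `0, …, N - 1` from left to right. -/
structure PerfectMatching (N : ℕ) where
  partner : Fin N → Fin N
  partner_partner : ∀ i, partner (partner i) = i
  partner_ne : ∀ i, partner i ≠ i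

/-- A perfect matching no two arcs of which interleave. -/
structure CrossinglessMatching (N : ℕ) extends PerfectMatching N where
  crossingless : ∀ i j, ¬ (i < j ∧ j < partner i ∧ partner i < partner j)

/-- A crossingless matching of `2n` points in which `k` of the arcs carry a dot.  The set `dots`
consists of the left endpoints of the dotted arcs. -/
structure DottedMatching (n k : ℕ) extends CrossinglessMatching (2 * n) where
  dots : Finset (Fin (2 * n))
  lt_partner_of_mem_dots : ∀ i ∈ dots, i < partner i
  card_dots : dots.card = k

/-! ### The quantum Russell space -/

/-- The space spanned over `ℤ[q, q⁻¹]` by dotted crossingless matchings with `k` dots. -/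
abbrev FreeRussell (n k : ℕ) : Type := DottedMatching n k →₀ QLaurent

/-- `m` is the diagram with underlying matching `α` and with dots on the arcs whose left endpoints
form the set `t`. -/
def DottedMatching.IsDiagram {n k : ℕ} (m : DottedMatching n k)
    (α : CrossinglessMatching (2 * n)) (t : Finset (Fin (2 * n))) : Prop :=
  m.toCrossinglessMatching = α ∧ m.dots = t

/-- For points `a < b < c < d`, the matching `α` has the arcs `(a, b)` and `(c, d)`, the matching
`β` has the arcs `(a, d)` and `(b, c)`, and otherwise `α` and `β` are identical. -/
structure ArcMove {n : ℕ} (α β : CrossinglessMatching (2 * n)) (a b c d : Fin (2 * n)) : Prop where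
  lt_ab : a < b
  lt_bc : b < c
  lt_cd : c < d
  left_ab : α.partner a = b
  left_cd : α.partner c = d
  right_ad : β.partner a = d
  right_bc : β.partner b = c
  eq_elsewhere : ∀ j, j ≠ a → j ≠ b → j ≠ c → j ≠ d → α.partner j = β.partner j

/-- The (left endpoints of the) undotted arcs `(x, x')` with `x < a` and `d < x'`, where `s` is the
set of left endpoints of the dotted arcs. -/
def outerUndotted {n : ℕ} (α : CrossinglessMatching (2 * n)) (s : Finset (Fin (2 * n)))
    (a d : Fin (2 * n)) : Finset (Fin (2 * n)) :=
  Finset.univ.filter fun x => x < a ∧ d < α.partner x ∧ x ∉ s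

/-- The index `i` of `x = x_i`, when the outer undotted arcs are numbered `x_1, …, x_α` from the
innermost to the outermost. -/
def outerIndex {n : ℕ} (α : CrossinglessMatching (2 * n)) (s : Finset (Fin (2 * n)))
    (a d x : Fin (2 * n)) : ℕ :=
  ((outerUndotted α s a d).filter fun y => x ≤ y).card

/-- The number of dotted arcs that lie strictly inside the arc of `x` and contain both `a` and `d`
strictly inside. -/
def dottedBetween {n : ℕ} (α : CrossinglessMatching (2 * n)) (s : Finset (Fin (2 * n)))
    (a d x : Fin (2 * n)) : ℕ :=
  (s.filter fun y => x < y ∧ y < a ∧ d < α.partner y ∧ α.partner y < α.partner x).card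

/-- The quantum Type I relations
`m = m₁ + m₂ + q⁻¹ m₁' + (1 - q⁻²) ∑_i q^(i - n_i) m_i`. Here `m` and `m₁'` have arcs `(a, d)`,
`(b, c)`, dotted on `(b, c)` and on `(a, d)` respectively; `m₁` and `m₂` have arcs `(a, b)`,
`(c, d)`, dotted on `(a, b)` and on `(c, d)` respectively; `m_i` has undotted arcs `(a, b)`,
`(c, d)`, and a dot on the outer arc `x_i`. The set `s` records the other dots. -/
noncomputable def typeIRelations (n k : ℕ) : Set (FreeRussell n k) :=
  {r | ∃ (α β : CrossinglessMatching (2 * n)) (a b c d : Fin (2 * n)) (s : Finset (Fin (2 * n)))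
      (m m₁ m₂ m₁' : DottedMatching n k) (mx : Fin (2 * n) → DottedMatching n k),
    ArcMove α β a b c d ∧ a ∉ s ∧ b ∉ s ∧ c ∉ s ∧ d ∉ s ∧
    m.IsDiagram β (insert b s) ∧
    m₁.IsDiagram α (insert a s) ∧
    m₂.IsDiagram α (insert c s) ∧
    m₁'.IsDiagram β (insert a s) ∧
    (∀ x ∈ outerUndotted α s a d, (mx x).IsDiagram α (insert x s)) ∧
    r = Finsupp.single m 1 - (Finsupp.single m₁ 1 + Finsupp.single m₂ 1 +
      qPow (-1) • Finsupp.single m₁' 1 +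
      (1 - qPow (-2)) • ∑ x ∈ outerUndotted α s a d,
        qPow ((outerIndex α s a d x : ℤ) - dottedBetween α s a d x) • Finsupp.single (mx x) 1)}

/-- The quantum Type II relations
`m = m' + (1 - q⁻²) ∑_i q^(i - 1 - n_i) m_i`. Here `m` has arcs `(a, b)`, `(c, d)`, both dotted;
`m'` has arcs `(a, d)`, `(b, c)`, both dotted; `m_i` has arcs `(a, d)`, `(b, c)`, the first dotted
and the second not, and a dot on the outer arc `x_i`. The set `s` records the other dots. -/
noncomputable def typeIIRelations (n k : ℕ) : Set (FreeRussell n k) :=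
  {r | ∃ (α β : CrossinglessMatching (2 * n)) (a b c d : Fin (2 * n)) (s : Finset (Fin (2 * n)))
      (m m' : DottedMatching n k) (mx : Fin (2 * n) → DottedMatching n k),
    ArcMove α β a b c d ∧ a ∉ s ∧ b ∉ s ∧ c ∉ s ∧ d ∉ s ∧
    m.IsDiagram α (insert a (insert c s)) ∧
    m'.IsDiagram β (insert a (insert b s)) ∧
    (∀ x ∈ outerUndotted α s a d, (mx x).IsDiagram β (insert x (insert a s))) ∧
    r = Finsupp.single m 1 - (Finsupp.single m' 1 +
      (1 - qPow (-2)) • ∑ x ∈ outerUndotted α s a d,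
        qPow ((outerIndex α s a d x : ℤ) - 1 - dottedBetween α s a d x) •
          Finsupp.single (mx x) 1)}

/-- The submodule spanned by the quantum Type I and Type II relations. -/
noncomputable def russellRelations (n k : ℕ) : Submodule QLaurent (FreeRussell n k) :=
  Submodule.span QLaurent (typeIRelations n k ∪ typeIIRelations n k)

/-- The quantum Russell space `R^q_{n,k}`. -/
abbrev QuantumRussell (n k : ℕ) : Type := FreeRussell n k ⧸ russellRelations n k

/-! ### Planar diagrams with crossings -/

/-- Diagrams below a horizontal line with `m` endpoints on the line, numbered `0, …, m - 1` from
left to right, in generic position, and so cut into elementary slices, which are listed here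
from the bottom to the top:
* `cup i D` adds to `D` a new minimum, whose two ends become the endpoints `i` and `i + 1`;
* `cap i D` joins the endpoints `i` and `i + 1` of `D` by a maximum;
* `cross o i D` crosses the strands at `i` and `i + 1` of `D`; if `o = true`, the strand that goes
  from `i` at the bottom to `i + 1` at the top (from the lower left to the upper right) is the
  upper strand, and if `o = false` it is the lower one. -/
inductive Diagram : ℕ → Type
  | empty : Diagram 0
  | cup {m : ℕ} (i : ℕ) (hi : i ≤ m) (D : Diagram m) : Diagram (m + 2)
  | cap {m : ℕ} (i : ℕ) (hi : i ≤ m) (D : Diagram (m + 2)) : Diagram m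
  | cross {m : ℕ} (o : Bool) (i : ℕ) (hi : i ≤ m) (D : Diagram (m + 2)) : Diagram (m + 2)

namespace Diagram

/-- Formal linear combinations of diagrams. -/
abbrev Comb (m : ℕ) : Type := Diagram m →₀ HalfLaurent

/-- A diagram as a formal linear combination. -/
noncomputable def of {m : ℕ} (D : Diagram m) : Comb m := Finsupp.single D 1

/-- The Kauffman–Lins relations: expansion of both types of crossings, evaluation of a circle to
`-q - q⁻¹`, and planar isotopy (straightening a zigzag, and exchanging the heights of two
distant extrema); the last four constructors say that all these relations are local, that is, may be
applied to the part of a diagram that lies below any further slices.  Planar isotopies that move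
crossings follow from these, since the two expansions of crossings are related by rotation. -/
inductive Relation : ∀ m : ℕ, Comb m → Prop
  | crossing_over {m : ℕ} (i : ℕ) (hi : i ≤ m) (D : Diagram (m + 2)) :
      Relation (m + 2) (of (cross true i hi D) -
        (qHalfPow 1 • of D + qHalfPow (-1) • of (cup i hi (cap i hi D))))
  | crossing_under {m : ℕ} (i : ℕ) (hi : i ≤ m) (D : Diagram (m + 2)) :
      Relation (m + 2) (of (cross false i hi D) -
        (qHalfPow (-1) • of D + qHalfPow 1 • of (cup i hi (cap i hi D))))
  | circle {m : ℕ} (i : ℕ) (hi : i ≤ m) (D : Diagram m) :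
      Relation m (of (cap i hi (cup i hi D)) - (-qHalfPow 2 - qHalfPow (-2)) • of D)
  | zigzag_left {m : ℕ} (i : ℕ) (hi : i ≤ m) (hi' : i + 1 ≤ m) (D : Diagram m) :
      Relation m (of (cap (i + 1) hi' (cup i hi D)) - of D)
  | zigzag_right {m : ℕ} (i : ℕ) (hi : i ≤ m) (hi' : i + 1 ≤ m) (D : Diagram m) :
      Relation m (of (cap i hi (cup (i + 1) hi' D)) - of D)
  | cup_cup {m : ℕ} (i j : ℕ) (hij : i ≤ j) (hi : i ≤ m) (hi' : i ≤ m + 2) (hj : j ≤ m)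
      (hj' : j + 2 ≤ m + 2) (D : Diagram m) :
      Relation (m + 2 + 2) (of (cup i hi' (cup j hj D)) - of (cup (j + 2) hj' (cup i hi D)))
  | cup_cap {m : ℕ} (i j : ℕ) (hij : i ≤ j) (hi : i ≤ m) (hi' : i ≤ m + 2) (hj : j ≤ m)
      (hj' : j + 2 ≤ m + 2) (D : Diagram (m + 2)) :
      Relation (m + 2) (of (cup i hi (cap j hj D)) - of (cap (j + 2) hj' (cup i hi' D)))
  | cap_cup {m : ℕ} (i j : ℕ) (hij : i ≤ j) (hi : i ≤ m) (hi' : i ≤ m + 2) (hj : j ≤ m)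
      (hj' : j + 2 ≤ m + 2) (D : Diagram (m + 2)) :
      Relation (m + 2) (of (cup j hj (cap i hi D)) - of (cap i hi' (cup (j + 2) hj' D)))
  | cap_cap {m : ℕ} (i j : ℕ) (hij : i ≤ j) (hi : i ≤ m) (hi' : i ≤ m + 2) (hj : j ≤ m)
      (hj' : j + 2 ≤ m + 2) (D : Diagram (m + 2 + 2)) :
      Relation m (of (cap j hj (cap i hi' D)) - of (cap i hi (cap (j + 2) hj' D)))
  | below_cup {m : ℕ} (i : ℕ) (hi : i ≤ m) (x : Comb m) :
      Relation m x → Relation (m + 2) (x.mapDomain (cup i hi))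
  | below_cap {m : ℕ} (i : ℕ) (hi : i ≤ m) (x : Comb (m + 2)) :
      Relation (m + 2) x → Relation m (x.mapDomain (cap i hi))
  | below_cross {m : ℕ} (o : Bool) (i : ℕ) (hi : i ≤ m) (x : Comb (m + 2)) :
      Relation (m + 2) x → Relation (m + 2) (x.mapDomain (cross o i hi))

/-- The position of the topmost slice of a diagram, if that slice is a minimum. -/
def topCup : ∀ {m : ℕ}, Diagram m → Option ℕ
  | _, empty => none
  | _, cup i _ _ => some i
  | _, cap _ _ _ => none
  | _, cross _ _ _ _ => none

/-- The diagram on `2 (n + k)` endpoints ends in a small arc both of whose endpoints, `i` and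
`i + 1`, are among the leftmost `k` or among the rightmost `k` endpoints.  (Every diagram without
crossings that has an arc with both endpoints in one projector is isotopic to such a diagram.) -/
def TurnsBack (n k : ℕ) (D : Diagram (2 * (n + k))) : Prop :=
  ∃ i, D.topCup = some i ∧ (i + 1 < k ∨ 2 * n + k ≤ i)

/-- The diagram obtained from `D` by adding a new leftmost and a new rightmost endpoint and an arc
that connects them and passes below `D`. -/
def enclose : ∀ {m : ℕ}, Diagram m → Diagram (m + 2)
  | _, empty => cup 0 le_rfl empty
  | _, cup i hi D => cup (i + 1) (by omega) (enclose D)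
  | _, cap i hi D => cap (i + 1) (by omega) (enclose D)
  | _, cross o i hi D => cross o (i + 1) (by omega) (enclose D)

end Diagram

/-! ### The Kauffman–Lins spaces -/

/-- All relations in `S̃^q_{n,k}`: the Kauffman–Lins relations, and the vanishing of diagrams that
turn back into a projector. -/
noncomputable def klRelations (n k : ℕ) : Submodule HalfLaurent (Diagram.Comb (2 * (n + k))) :=
  Submodule.span HalfLaurent
    ({x | Diagram.Relation (2 * (n + k)) x} ∪ Diagram.of '' {D | Diagram.TurnsBack n k D})

/-- The Kauffman–Lins space `S̃^q_{n,k}` with two projectors: linear combinations of diagrams with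
`2 (n + k)` endpoints, the leftmost `k` and the rightmost `k` of which lie in projectors. -/
abbrev KLSpace (n k : ℕ) : Type := Diagram.Comb (2 * (n + k)) ⧸ klRelations n k

/-- The class of a diagram in `S̃^q_{n,k}`. -/
noncomputable def klClass (n k : ℕ) (D : Diagram (2 * (n + k))) : KLSpace n k :=
  (klRelations n k).mkQ (Diagram.of D)

namespace Diagram

theorem Relation.enclose {m : ℕ} {x : Comb m} (h : Relation m x) :
    Relation (m + 2) (x.mapDomain Diagram.enclose) := by
  have hmap : ∀ {m m' : ℕ} (f : Diagram m → Diagram m') (x y : Comb m),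
      (x - y).mapDomain f = x.mapDomain f - y.mapDomain f := fun f x y =>
    map_sub (Finsupp.lmapDomain HalfLaurent HalfLaurent f) x y
  have hof : ∀ {m m' : ℕ} (f : Diagram m → Diagram m') (D : Diagram m),
      (of D).mapDomain f = of (f D) := fun f D => Finsupp.mapDomain_single
  induction h with
  | crossing_over i hi D =>
    rw [hmap, Finsupp.mapDomain_add, Finsupp.mapDomain_smul, Finsupp.mapDomain_smul, hof, hof, hof]
    exact Relation.crossing_over (i + 1) _ _
  | crossing_under i hi D =>
    rw [hmap, Finsupp.mapDomain_add, Finsupp.mapDomain_smul, Finsupp.mapDomain_smul, hof, hof, hof]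
    exact Relation.crossing_under (i + 1) _ _
  | circle i hi D =>
    rw [hmap, Finsupp.mapDomain_smul, hof, hof]
    exact Relation.circle (i + 1) _ _
  | zigzag_left i hi hi' D =>
    rw [hmap, hof, hof]
    exact Relation.zigzag_left (i + 1) _ _ _
  | zigzag_right i hi hi' D =>
    rw [hmap, hof, hof]
    exact Relation.zigzag_right (i + 1) _ _ _
  | cup_cup i j hij hi hi' hj hj' D =>
    rw [hmap, hof, hof]
    exact Relation.cup_cup (i + 1) (j + 1) (by omega) _ _ _ _ _
  | cup_cap i j hij hi hi' hj hj' D =>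
    rw [hmap, hof, hof]
    exact Relation.cup_cap (i + 1) (j + 1) (by omega) _ _ _ _ _
  | cap_cup i j hij hi hi' hj hj' D =>
    rw [hmap, hof, hof]
    exact Relation.cap_cup (i + 1) (j + 1) (by omega) _ _ _ _ _
  | cap_cap i j hij hi hi' hj hj' D =>
    rw [hmap, hof, hof]
    exact Relation.cap_cap (i + 1) (j + 1) (by omega) _ _ _ _ _
  | below_cup i hi x _ ih =>
    have := Relation.below_cup (i + 1) (by omega) _ ih
    rw [← Finsupp.mapDomain_comp] at this ⊢
    exact this
  | below_cap i hi x _ ih =>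
    have := Relation.below_cap (i + 1) (by omega) _ ih
    rw [← Finsupp.mapDomain_comp] at this ⊢
    exact this
  | below_cross o i hi x _ ih =>
    have := Relation.below_cross o (i + 1) (by omega) _ ih
    rw [← Finsupp.mapDomain_comp] at this ⊢
    exact this

theorem topCup_enclose {m : ℕ} {D : Diagram m} {i : ℕ} (h : D.topCup = some i) :
    (Diagram.enclose D).topCup = some (i + 1) := by
  cases D <;> simp_all [topCup, Diagram.enclose]

theorem TurnsBack.enclose {n k : ℕ} {D : Diagram (2 * (n + k))} (h : TurnsBack n k D) :
    TurnsBack n (k + 1) (Diagram.enclose D) := by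
  obtain ⟨i, hi, h⟩ := h
  exact ⟨i + 1, topCup_enclose hi, by omega⟩

end Diagram

theorem klRelations_le_comap (n k : ℕ) :
    klRelations n k ≤ (klRelations n (k + 1)).comap
      (Finsupp.lmapDomain HalfLaurent HalfLaurent
        (Diagram.enclose : Diagram (2 * (n + k)) → Diagram (2 * (n + (k + 1))))) := by
  refine Submodule.span_le.2 ?_
  rintro x (hx | ⟨D, hD, rfl⟩)
  · exact Submodule.subset_span (Or.inl hx.enclose)
  · refine Submodule.subset_span (Or.inr ⟨Diagram.enclose D, hD.enclose, ?_⟩)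
    exact (Finsupp.mapDomain_single).symm

/-- The map `φ_{n,k} : S̃^q_{n,k} → S̃^q_{n,k+1}` that adds one point to each projector and
connects the two new points by an outermost arc. -/
noncomputable def klEnclose (n k : ℕ) : KLSpace n k →ₗ[HalfLaurent] KLSpace n (k + 1) :=
  Submodule.mapQ _ _ (Finsupp.lmapDomain HalfLaurent HalfLaurent Diagram.enclose)
    (klRelations_le_comap n k)

/-- The image of `φ_{n,k-1}` in `S̃^q_{n,k}`, and zero for `k = 0`. -/
noncomputable def klEncloseRange (n : ℕ) : ∀ k : ℕ, Submodule HalfLaurent (KLSpace n k)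
  | 0 => ⊥
  | k + 1 => LinearMap.range (klEnclose n k)

/-- The space `S^q_{n,k}`, the cokernel of `φ_{n,k-1}` (and `S̃^q_{n,0}` for `k = 0`). -/
abbrev KLQuotient (n k : ℕ) : Type := KLSpace n k ⧸ klEncloseRange n k

/-! ### The drawing of a matching -/

namespace PerfectMatching

variable {N : ℕ} (M : PerfectMatching (2 * N))

/-- The left endpoints of the arcs. -/
def lefts : Finset (Fin (2 * N)) := Finset.univ.filter fun i => i < M.partner i

/-- The number of arcs `(w', w)` with `w' < u < w < u'`, where `u'` is the partner of `u`. -/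
def overlaps (u : Fin (2 * N)) : ℕ :=
  (Finset.univ.filter fun w => u < w ∧ w < M.partner u ∧ M.partner w < u).card

theorem card_lefts : M.lefts.card = N := by
  have hinj : Function.Injective M.partner :=
    Function.LeftInverse.injective M.partner_partner
  have h1 : M.lefts.image M.partner = M.leftsᶜ := by
    ext i
    simp only [lefts, Finset.mem_image, Finset.mem_filter, Finset.mem_univ, true_and,
      Finset.mem_compl, not_lt]
    constructor
    · rintro ⟨j, hj, rfl⟩
      rw [M.partner_partner]
      exact hj.le
    · intro h
      refine ⟨M.partner i, ?_, M.partner_partner i⟩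
      rw [M.partner_partner]
      exact lt_of_le_of_ne h (M.partner_ne i)
  have h2 := Finset.card_image_of_injective M.lefts hinj
  rw [h1, Finset.card_compl, Fintype.card_fin] at h2
  have h3 := Finset.card_le_univ M.lefts
  rw [Fintype.card_fin] at h3
  omega

/-- The left endpoint number `t`, counted from the left. -/
def leftAt (t : Fin N) : Fin (2 * N) := M.lefts.orderEmbOfFin M.card_lefts t

theorem leftAt_add_overlaps_le (t : Fin N) :
    (M.leftAt t : ℕ) + M.overlaps (M.leftAt t) ≤ 2 * (t : ℕ) := by
  set u := M.leftAt t with hu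
  set L := M.lefts.filter fun i => i < u with hL
  have hLcard : L.card = t := by
    have : L = (Finset.Iio t).map (M.lefts.orderEmbOfFin M.card_lefts).toEmbedding := by
      ext i
      simp only [hL, Finset.mem_filter, Finset.mem_map, Finset.mem_Iio,
        RelEmbedding.coe_toEmbedding]
      constructor
      · rintro ⟨hi, hlt⟩
        have : i ∈ Set.range (M.lefts.orderEmbOfFin M.card_lefts) := by
          rw [Finset.range_orderEmbOfFin]; exact hi
        obtain ⟨r, rfl⟩ := this
        exact ⟨r, (OrderEmbedding.lt_iff_lt _).1 hlt, rfl⟩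
      · rintro ⟨r, hr, rfl⟩
        exact ⟨Finset.orderEmbOfFin_mem _ _ _, (OrderEmbedding.lt_iff_lt _).2 hr⟩
    rw [this, Finset.card_map, Fin.card_Iio]
  have hsub : Finset.Iio u ∪
      (Finset.univ.filter fun w => u < w ∧ w < M.partner u ∧ M.partner w < u) ⊆
      L ∪ L.image M.partner := by
    intro w hw
    simp only [Finset.mem_union, Finset.mem_Iio, Finset.mem_filter, Finset.mem_univ, true_and,
      hL, Finset.mem_image, lefts] at hw ⊢
    rcases hw with hw | ⟨h1, h2, h3⟩
    · rcases lt_or_gt_of_ne (M.partner_ne w) with h | h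
      · right
        exact ⟨M.partner w, ⟨by rw [M.partner_partner]; exact h, h.trans hw⟩, M.partner_partner w⟩
      · left
        exact ⟨h, hw⟩
    · right
      exact ⟨M.partner w, ⟨by rw [M.partner_partner]; exact h3.trans h1, h3⟩, M.partner_partner w⟩
  have hcard := Finset.card_le_card hsub
  rw [Finset.card_union_of_disjoint, Fin.card_Iio] at hcard
  · have h1 := Finset.card_union_le L (L.image M.partner)
    have h2 : (L.image M.partner).card ≤ L.card := Finset.card_image_le
    unfold overlaps
    omega
  · rw [Finset.disjoint_left]
    intro w hw hw'
    simp only [Finset.mem_Iio, Finset.mem_filter, Finset.mem_univ, true_and] at hw hw'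
    exact absurd hw (not_lt.2 hw'.1.le)

end PerfectMatching

/-- Adds to `D` an arc from the new endpoint `u` to the new endpoint `u + c + 1`, which passes over
the `c` strands that end in between, and crosses nothing else. -/
def Diagram.addOverArc {m : ℕ} (u : ℕ) : ∀ (c : ℕ), u + c ≤ m → Diagram m → Diagram (m + 2)
  | 0, h, D => Diagram.cup u h D
  | c + 1, h, D => Diagram.cross true (u + c + 1) h
      (Diagram.addOverArc u c (le_trans (Nat.le_succ _) h) D)

/-- The diagram formed by the first `t` arcs of `M`, in the order of their left endpoints, each
passing over the earlier ones. When an arc `(u, u')` is added, all the endpoints to the left of `u`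
are already present, and those present to the right of `u` and left of `u'` belong to the arcs
`(w', w)` with `w' < u < w < u'`. -/
def PerfectMatching.drawFirst {N : ℕ} (M : PerfectMatching (2 * N)) :
    ∀ t : ℕ, t ≤ N → Diagram (2 * t)
  | 0, _ => Diagram.empty
  | t + 1, h => Diagram.addOverArc (m := 2 * t) (M.leftAt ⟨t, h⟩) (M.overlaps (M.leftAt ⟨t, h⟩))
      (M.leftAt_add_overlaps_le ⟨t, h⟩) (M.drawFirst t (Nat.le_of_succ_le h))

/-- The diagram of a perfect matching in which interleaved arcs `(w', w)`, `(u, u')` with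
`w' < u < w < u'` cross exactly once, `(u, u')` passing above `(w', w)`, and other pairs of arcs
are disjoint. -/
def PerfectMatching.draw {N : ℕ} (M : PerfectMatching (2 * N)) : Diagram (2 * N) :=
  M.drawFirst N le_rfl

/-! ### The expansion map -/

namespace DottedMatching

variable {n k : ℕ} (x : DottedMatching n k)

/-- The right endpoints of the dotted arcs. -/
def rightDots : Finset (Fin (2 * n)) := x.dots.image x.partner

theorem card_rightDots : x.rightDots.card = k := by
  rw [rightDots, Finset.card_image_of_injective _
    (Function.LeftInverse.injective x.partner_partner), x.card_dots]

/-- The matching that replaces each dotted arc by an arc from its left endpoint to the left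
projector and an arc from its right endpoint to the right projector.  The three summands
are the points in the left projector, the original points and the points in the right projector.
The left endpoints of the dotted arcs, from left to right, are connected to the points of the left
projector from right to left, and likewise for the right endpoints and the right projector, so
that no two of the arcs to the same projector interleave. -/
def expandPartner : Fin k ⊕ (Fin (2 * n) ⊕ Fin k) → Fin k ⊕ (Fin (2 * n) ⊕ Fin k)
  | .inl p => .inr (.inl (x.dots.orderIsoOfFin x.card_dots p.rev))
  | .inr (.inl j) =>
    if h : j ∈ x.dots then .inl ((x.dots.orderIsoOfFin x.card_dots).symm ⟨j, h⟩).rev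
    else if h : j ∈ x.rightDots then
      .inr (.inr ((x.rightDots.orderIsoOfFin x.card_rightDots).symm ⟨j, h⟩).rev)
    else .inr (.inl (x.partner j))
  | .inr (.inr p) => .inr (.inl (x.rightDots.orderIsoOfFin x.card_rightDots p.rev))

theorem notMem_dots_of_mem_rightDots {j : Fin (2 * n)} (h : j ∈ x.rightDots) : j ∉ x.dots := by
  intro h'
  obtain ⟨i, hi, rfl⟩ := Finset.mem_image.1 h
  have h1 := x.lt_partner_of_mem_dots _ h'
  have h2 := x.lt_partner_of_mem_dots _ hi
  rw [x.partner_partner] at h1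
  exact absurd h1 (not_lt.2 h2.le)

theorem partner_mem_rightDots {j : Fin (2 * n)} : x.partner j ∈ x.rightDots ↔ j ∈ x.dots := by
  rw [rightDots, Finset.mem_image]
  constructor
  · rintro ⟨i, hi, h⟩
    rwa [← x.partner_partner j, ← h, x.partner_partner]
  · intro h
    exact ⟨j, h, rfl⟩

theorem partner_mem_dots {j : Fin (2 * n)} : x.partner j ∈ x.dots ↔ j ∈ x.rightDots := by
  rw [← partner_mem_rightDots, x.partner_partner]

theorem expandPartner_expandPartner (p : Fin k ⊕ (Fin (2 * n) ⊕ Fin k)) :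
    x.expandPartner (x.expandPartner p) = p := by
  rcases p with p | j | p
  · simp [expandPartner, -Finset.coe_orderIsoOfFin_apply]
  · by_cases h : j ∈ x.dots
    · simp [expandPartner, h]
    · by_cases h' : j ∈ x.rightDots
      · simp [expandPartner, h, h']
      · simp [expandPartner, h, h', partner_mem_dots, partner_mem_rightDots, x.partner_partner]
  · have h := (x.rightDots.orderIsoOfFin x.card_rightDots p.rev).2
    have h' := x.notMem_dots_of_mem_rightDots h
    simp [expandPartner, h', -Finset.coe_orderIsoOfFin_apply]

theorem expandPartner_ne (p : Fin k ⊕ (Fin (2 * n) ⊕ Fin k)) : x.expandPartner p ≠ p := by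
  rcases p with p | j | p
  · simp [expandPartner]
  · by_cases h : j ∈ x.dots
    · simp [expandPartner, h]
    · by_cases h' : j ∈ x.rightDots
      · simp [expandPartner, h, h']
      · simp [expandPartner, h, h', x.partner_ne]
  · simp [expandPartner]

/-- The positions on the line of the points in the left projector, of the original points, and of
the points in the right projector, in this order from left to right. -/
def position (n k : ℕ) : Fin k ⊕ (Fin (2 * n) ⊕ Fin k) ≃ Fin (2 * (n + k)) :=
  ((Equiv.sumCongr (Equiv.refl _) finSumFinEquiv).trans finSumFinEquiv).trans
    (finCongr (by omega))

/-- The matching on `2 (n + k)` points that results from the expansion of the dotted arcs. -/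
def expand : PerfectMatching (2 * (n + k)) where
  partner i := position n k (x.expandPartner ((position n k).symm i))
  partner_partner i := by simp [expandPartner_expandPartner]
  partner_ne i h := x.expandPartner_ne ((position n k).symm i) (by
    rw [Equiv.eq_symm_apply]; exact h)

/-- The number of pairs of nested dotted arcs. -/
def nestedPairs : ℕ :=
  ((x.dots ×ˢ x.dots).filter fun p => p.1 < p.2 ∧ x.partner p.2 < x.partner p.1).card

end DottedMatching

/-- The expansion map `ψ̃_{n,k} : R̃^q_{n,k} → S̃^q_{n,k}`.  In the drawing of the expanded matching,
an arc passes over the arcs with smaller left endpoint that it interleaves with: the arc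
to the left projector from a dotted arc inside an undotted arc passes under the latter, the arc to
the right projector passes over it, and for dotted arcs that are not nested, the arc to the right
projector from the left one passes over the arc to the left projector from the right one; no
other pairs of arcs cross. -/
noncomputable def expansionMap (n k : ℕ) : FreeRussell n k →ₗ[QLaurent] KLSpace n k :=
  Finsupp.linearCombination QLaurent fun x : DottedMatching n k =>
    qHalfPow (-(x.nestedPairs : ℤ)) • klClass n k x.expand.draw

/-!
# The quantum Russell space and the Kauffman–Lins space with two projectors

The isomorphism is detected by coordinates. The Kauffman bracket acts on tensor powers of the
two-dimensional representation of quantum `sl₂`; a diagram with `2(n + k)` endpoints becomes a function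
`Skein.ev` of words of `2(n + k)` letters `true`, `false`, and this function only depends on the class of
the diagram (`Skein.evComb_relation`). With the letter `true` at all points of the projectors, the
functions of diagrams that turn back into a projector vanish, and so do those of diagrams with an
outermost arc between the two projectors. Hence there is a linear map `Skein.evQuot` from `S^q_{n,k}` to
functions of words of length `2n`.

The images of the expansions of dotted matchings under this map have a simple form
(`Skein.evQuot_expansionMap_single`): up to a unit that is the same for all dotted matchings, they are
obtained by adding one arc after the other, from the outside to the inside (`Skein.arcsSt`). An
undotted arc adds an invariant vector. A dotted arc asks for the letter `false` at both ends, with a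
correction term in which a lowering operator of the quantum group acts on all tensor factors to the left
of the arc. The lowering operator at a gap of a system of arcs puts a dot on one of the undotted
arcs around the gap, with a power of `q` that counts the arcs in between
(`Skein.lowerOp_arcsSt`). With this rule, the Type I and Type II relations become identities about four
neighbouring points (`Skein.typeI_local`, `Skein.typeII_local`), so that `evQuot` annihilates the images
of all relations (`Skein.russellRelations_le_ker`).

A dotted matching is called standard if its dotted arcs are nested in each other and none of them lies
inside an undotted arc. Standard matchings span both sides:

* In `S^q_{n,k}`, crossings and maxima can be eliminated (`Skein.cupSpan_eq_top`). A diagram that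
  consists of minima only and is not zero has no arc from a projector to a projector, and therefore is
  the expansion of a standard dotted matching (`Skein.span_standard_eq_top`).
* In `R^q_{n,k}`, the Type I relation moves a dot out of the undotted arc immediately around it and
  decreases the total depth of the dots. When no dot is left inside an undotted arc, the Type II
  relation has no correction terms and nests two dotted arcs that lie side by side
  (`Skein.span_mkQ_standard`).

The coordinates of standard matchings form a triangular system with units on the diagonal, with
respect to the sum of the left ends of the undotted arcs, because these left ends determine a standard
matching (`Skein.linearIndependent_standard`). Consequently `evQuot` is injective
(`Skein.evQuot_injective`). This implies that the relations hold in `S^q_{n,k}` itself; and the induced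
map is an isomorphism, since it sends a generating family of the one side, whose image in coordinates is
linearly independent, to a generating family of the other.
-/

namespace Skein

/-! ### Half-integral powers of `q` -/

theorem qHalfPow_add (a b : ℤ) : qHalfPow (a + b) = qHalfPow a * qHalfPow b :=
  LaurentPolynomial.T_add a b

theorem qHalfPow_zero : qHalfPow 0 = 1 := LaurentPolynomial.T_zero

theorem qHalfPow_mul_neg (a : ℤ) : qHalfPow a * qHalfPow (-a) = 1 := by
  rw [← qHalfPow_add, add_neg_cancel, qHalfPow_zero]

theorem isUnit_qHalfPow (a : ℤ) : IsUnit (qHalfPow a) :=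
  IsUnit.of_mul_eq_one _ (qHalfPow_mul_neg a)

/-- The element `q^{1/2}`. -/
noncomputable def hq : HalfLaurent := qHalfPow 1

/-- The element `q^{-1/2}`. -/
noncomputable def hqi : HalfLaurent := qHalfPow (-1)

theorem hq_mul_hqi : hq * hqi = 1 := qHalfPow_mul_neg 1

theorem qHalfPow_two : qHalfPow 2 = hq ^ 2 := by
  rw [show (2 : ℤ) = 1 + 1 from rfl, qHalfPow_add, sq]; rfl

theorem qHalfPow_neg_two : qHalfPow (-2) = hqi ^ 2 := by
  rw [show (-2 : ℤ) = -1 + -1 from rfl, qHalfPow_add, sq]; rfl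

/-! ### Tensor evaluation of diagrams -/

/-- The matrix entries of a minimum, with respect to the basis `true`, `false` of the
two-dimensional representation at each end. They are normalized so that the entry at
`true`, `false`, which belongs to an arc with `true` at its left end, is `1`. -/
noncomputable def cupW : Bool → Bool → HalfLaurent
  | true, false => 1
  | false, true => -hq ^ 2
  | _, _ => 0

/-- Tensor coordinates of linear combinations of diagrams: functions on the words of letters
`true` and `false`. -/
abbrev Coord : Type := List Bool → HalfLaurent

/-- The action of a minimum at position `i` on tensor coordinates. -/
noncomputable def cupOp (i : ℕ) : Coord →ₗ[HalfLaurent] Coord where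
  toFun v l := cupW (l.getD i false) (l.getD (i + 1) false) * v (l.take i ++ l.drop (i + 2))
  map_add' v w := by ext l; simp [mul_add]
  map_smul' r v := by ext l; simp [mul_left_comm]

/-- The action of a maximum at position `i` on tensor coordinates. -/
noncomputable def capOp (i : ℕ) : Coord →ₗ[HalfLaurent] Coord where
  toFun v l := -hqi ^ 2 * v (l.take i ++ true :: false :: l.drop i) +
    v (l.take i ++ false :: true :: l.drop i)
  map_add' v w := by ext l; simp only [Pi.add_apply]; ring
  map_smul' r v := by ext l; simp only [Pi.smul_apply, smul_eq_mul, RingHom.id_apply]; ring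

/-- The action of a crossing at position `i` on tensor coordinates, as prescribed by the expansion of
the crossing into its two smoothings. -/
noncomputable def crossOp (o : Bool) (i : ℕ) : Coord →ₗ[HalfLaurent] Coord :=
  if o then hq • LinearMap.id + hqi • (cupOp i ∘ₗ capOp i)
  else hqi • LinearMap.id + hq • (cupOp i ∘ₗ capOp i)

theorem cupOp_append {i : ℕ} {l₁ : List Bool} (h : l₁.length = i) (v : Coord) (x y : Bool)
    (l₂ : List Bool) : cupOp i v (l₁ ++ x :: y :: l₂) = cupW x y * v (l₁ ++ l₂) := by
  subst h
  simp [cupOp, List.drop_append, List.drop_of_length_le]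

theorem capOp_append {i : ℕ} {l₁ : List Bool} (h : l₁.length = i) (v : Coord)
    (l₂ : List Bool) : capOp i v (l₁ ++ l₂) =
      -hqi ^ 2 * v (l₁ ++ true :: false :: l₂) + v (l₁ ++ false :: true :: l₂) := by
  subst h
  simp [capOp]

/-- The vector in a tensor power of the two-dimensional representation defined by a diagram. On
words whose length is not the number of endpoints, its value has no meaning. -/
noncomputable def ev : ∀ {m : ℕ}, Diagram m → Coord
  | _, .empty => fun _ => 1
  | _, .cup i _ D => cupOp i (ev D)
  | _, .cap i _ D => capOp i (ev D)
  | _, .cross o i _ D => crossOp o i (ev D)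

/-- The linear extension of `ev` to formal combinations of diagrams. -/
noncomputable def evComb (m : ℕ) : Diagram.Comb m →ₗ[HalfLaurent] Coord :=
  Finsupp.linearCombination HalfLaurent ev

theorem evComb_of {m : ℕ} (D : Diagram m) : evComb m (Diagram.of D) = ev D := by
  simp [evComb, Diagram.of]

theorem evComb_mapDomain {m m' : ℕ} (f : Diagram m → Diagram m')
    (F : Coord →ₗ[HalfLaurent] Coord) (h : ∀ D, ev (f D) = F (ev D)) (x : Diagram.Comb m) :
    evComb m' (x.mapDomain f) = F (evComb m x) := by
  have : (evComb m') ∘ₗ Finsupp.lmapDomain HalfLaurent HalfLaurent f = F ∘ₗ evComb m := by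
    refine Finsupp.lhom_ext' fun D => LinearMap.ext_ring ?_
    simp [evComb, h]
  exact LinearMap.congr_fun this x

theorem exists_append_of_le {l : List Bool} {i : ℕ} (h : i ≤ l.length) :
    ∃ l₁ l₂, l = l₁ ++ l₂ ∧ l₁.length = i :=
  ⟨l.take i, l.drop i, (List.take_append_drop i l).symm, by simp [h]⟩

theorem exists_append_two {l : List Bool} {i : ℕ} (h : i + 2 ≤ l.length) :
    ∃ l₁ x y l₂, l = l₁ ++ x :: y :: l₂ ∧ l₁.length = i := by
  obtain ⟨l₁, l₂, rfl, h1⟩ := exists_append_of_le (l := l) (i := i) (by omega)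
  match l₂, h with
  | x :: y :: l₂, _ => exact ⟨l₁, x, y, l₂, rfl, h1⟩
  | [], h => simp at h; omega
  | [_], h => simp at h; omega

/-- The tensor evaluation is invariant under all Kauffman–Lins relations. -/
theorem evComb_relation {m : ℕ} {x : Diagram.Comb m} (h : Diagram.Relation m x) :
    ∀ l : List Bool, l.length = m → evComb m x l = 0 := by
  have ht := hq_mul_hqi
  induction h with
  | crossing_over i hi D =>
    intro l _
    simp [evComb_of, ev, crossOp, hq, hqi]
  | crossing_under i hi D =>
    intro l _
    simp [evComb_of, ev, crossOp, hq, hqi]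
  | circle i hi D =>
    intro l hl
    obtain ⟨l₁, l₂, rfl, h1⟩ := exists_append_of_le (l := l) (i := i) (by omega)
    simp only [map_sub, map_smul, evComb_of, ev, Pi.sub_apply, Pi.smul_apply, smul_eq_mul,
      capOp_append h1, cupOp_append h1, cupW, qHalfPow_two, qHalfPow_neg_two]
    ring
  | zigzag_left i hi hi' D =>
    intro l hl
    obtain ⟨l₁, l₂, rfl, h1⟩ := exists_append_of_le (l := l) (i := i + 1) (by omega)
    obtain ⟨l₁, x, rfl⟩ := List.eq_nil_or_concat' l₁ |>.resolve_left (by rintro rfl; simp at h1)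
    have h2 : l₁.length = i := by simpa using h1
    simp only [map_sub, evComb_of, ev, Pi.sub_apply, capOp_append h1]
    simp only [List.append_assoc, List.singleton_append, cupOp_append h2]
    cases x <;> simp only [cupW] <;> grind
  | zigzag_right i hi hi' D =>
    intro l hl
    obtain ⟨l₁, l₂, rfl, h1⟩ := exists_append_of_le (l := l) (i := i) (by omega)
    match l₂ with
    | [] => simp at hl; omega
    | x :: l₂ =>
    simp only [map_sub, evComb_of, ev, Pi.sub_apply, capOp_append h1]
    have h2 : ∀ z : Bool, (l₁ ++ [z]).length = i + 1 := by simp [h1]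
    have e : ∀ z w : Bool, l₁ ++ z :: w :: x :: l₂ = (l₁ ++ [z]) ++ w :: x :: l₂ := by simp
    rw [e, e, cupOp_append (h2 _), cupOp_append (h2 _)]
    cases x <;> simp only [cupW, List.append_assoc, List.singleton_append] <;> grind
  | @cup_cup m i j hij hi hi' hj hj' D =>
    intro l hl
    obtain ⟨l₁, x, y, l₂, rfl, h1⟩ := exists_append_two (l := l) (i := i) (by omega)
    obtain ⟨l₂, z, w, l₃, rfl, h2⟩ := exists_append_two (l := l₂) (i := j - i) (by
      simp at hl; omega)
    simp only [map_sub, evComb_of, ev, Pi.sub_apply, cupOp_append h1]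
    rw [← List.append_assoc, cupOp_append (by simp; omega),
      show l₁ ++ x :: y :: (l₂ ++ z :: w :: l₃) = (l₁ ++ x :: y :: l₂) ++ z :: w :: l₃ by simp,
      cupOp_append (by simp; omega), show l₁ ++ x :: y :: l₂ ++ l₃ = l₁ ++ x :: y :: (l₂ ++ l₃) by
      simp, cupOp_append h1, List.append_assoc, List.append_assoc]
    ring
  | cup_cap i j hij hi hi' hj hj' D =>
    intro l hl
    obtain ⟨l₁, x, y, l₂, rfl, h1⟩ := exists_append_two (l := l) (i := i) (by omega)
    obtain ⟨l₂, l₃, rfl, h2⟩ := exists_append_of_le (l := l₂) (i := j - i) (by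
      simp at hl; omega)
    simp only [map_sub, evComb_of, ev, Pi.sub_apply, cupOp_append h1]
    rw [← List.append_assoc, capOp_append (by simp; omega),
      show l₁ ++ x :: y :: (l₂ ++ l₃) = (l₁ ++ x :: y :: l₂) ++ l₃ by simp,
      capOp_append (by simp; omega)]
    simp only [List.append_assoc, List.cons_append, cupOp_append h1]
    ring
  | cap_cup i j hij hi hi' hj hj' D =>
    intro l hl
    obtain ⟨l₁, l₂, rfl, h1⟩ := exists_append_of_le (l := l) (i := i) (by omega)
    obtain ⟨l₂, z, w, l₃, rfl, h2⟩ := exists_append_two (l := l₂) (i := j - i) (by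
      simp at hl; omega)
    simp only [map_sub, evComb_of, ev, Pi.sub_apply, capOp_append h1]
    rw [← List.append_assoc l₁, cupOp_append (by simp; omega)]
    simp only [List.append_assoc, capOp_append h1]
    have e : ∀ s t : Bool, l₁ ++ s :: t :: (l₂ ++ z :: w :: l₃) =
      (l₁ ++ s :: t :: l₂) ++ z :: w :: l₃ := by simp
    rw [e, e, cupOp_append (by simp; omega), cupOp_append (by simp; omega)]
    simp only [List.append_assoc, List.cons_append]
    ring
  | cap_cap i j hij hi hi' hj hj' D =>
    intro l hl
    obtain ⟨l₁, l₂, rfl, h1⟩ := exists_append_of_le (l := l) (i := i) (by omega)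
    obtain ⟨l₂, l₃, rfl, h2⟩ := exists_append_of_le (l := l₂) (i := j - i) (by
      simp at hl; omega)
    simp only [map_sub, evComb_of, ev, Pi.sub_apply, capOp_append h1]
    rw [← List.append_assoc l₁, capOp_append (by simp; omega)]
    simp only [List.append_assoc, capOp_append h1]
    have e : ∀ s t : Bool, l₁ ++ s :: t :: (l₂ ++ l₃) = (l₁ ++ s :: t :: l₂) ++ l₃ := by simp
    rw [e, e, capOp_append (by simp; omega), capOp_append (by simp; omega)]
    simp only [List.append_assoc, List.cons_append]
    ring
  | below_cup i hi x _ ih =>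
    intro l hl
    obtain ⟨l₁, x, y, l₂, rfl, h1⟩ := exists_append_two (l := l) (i := i) (by omega)
    rw [evComb_mapDomain _ (cupOp i) (fun _ => rfl), cupOp_append h1, ih, mul_zero]
    simp at hl ⊢; omega
  | below_cap i hi x _ ih =>
    intro l hl
    obtain ⟨l₁, l₂, rfl, h1⟩ := exists_append_of_le (l := l) (i := i) (by omega)
    rw [evComb_mapDomain _ (capOp i) (fun _ => rfl), capOp_append h1, ih, ih, mul_zero, zero_add]
    all_goals simp at hl ⊢; omega
  | below_cross o i hi x _ ih =>
    intro l hl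
    rw [evComb_mapDomain _ (crossOp o i) (fun _ => rfl)]
    have h0 : cupOp i (capOp i (evComb _ x)) l = 0 := by
      obtain ⟨l₁, x, y, l₂, rfl, h1⟩ := exists_append_two (l := l) (i := i) (by omega)
      rw [cupOp_append h1, capOp_append h1, ih, ih, mul_zero, add_zero, mul_zero]
      all_goals simp at hl ⊢; omega
    unfold crossOp
    split_ifs <;> simp [h0, ih l hl]

/-! ### Coordinates on the quotients `S^q_{n,k}` -/

/-- An outermost arc contributes the factor determined by the letters at its two ends. -/
theorem ev_enclose {m : ℕ} (D : Diagram m) :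
    ∀ (x y : Bool) (l : List Bool), l.length = m →
      ev (Diagram.enclose D) (x :: (l ++ [y])) = cupW x y * ev D l := by
  induction D with
  | empty =>
    intro x y l hl
    obtain rfl := List.length_eq_zero_iff.1 hl
    exact cupOp_append (i := 0) (l₁ := []) rfl _ x y []
  | cup i hi D ih =>
    intro x y l hl
    obtain ⟨l₁, a, b, l₂, rfl, h1⟩ := exists_append_two (l := l) (i := i) (by omega)
    have e : x :: (l₁ ++ a :: b :: l₂ ++ [y]) = (x :: l₁) ++ a :: b :: (l₂ ++ [y]) := by simp
    have := ih x y (l₁ ++ l₂) (by simp at hl ⊢; omega)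
    simp only [Diagram.enclose, ev]
    rw [e, cupOp_append (by simp [h1]), cupOp_append h1, ← mul_left_comm, ← this]
    simp
  | cap i hi D ih =>
    intro x y l hl
    obtain ⟨l₁, l₂, rfl, h1⟩ := exists_append_of_le (l := l) (i := i) (by omega)
    have e : x :: (l₁ ++ l₂ ++ [y]) = (x :: l₁) ++ (l₂ ++ [y]) := by simp
    have h := fun a b => ih x y (l₁ ++ a :: b :: l₂) (by simp at hl ⊢; omega)
    simp only [Diagram.enclose, ev]
    rw [e, capOp_append (by simp [h1]), capOp_append h1]
    have h' : ∀ a b, ev (Diagram.enclose D) (x :: l₁ ++ a :: b :: (l₂ ++ [y])) =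
      cupW x y * ev D (l₁ ++ a :: b :: l₂) := fun a b => by rw [← h]; simp
    rw [h', h']
    ring
  | cross o i hi D ih =>
    intro x y l hl
    obtain ⟨l₁, a, b, l₂, rfl, h1⟩ := exists_append_two (l := l) (i := i) (by omega)
    have e : x :: (l₁ ++ a :: b :: l₂ ++ [y]) = (x :: l₁) ++ a :: b :: (l₂ ++ [y]) := by simp
    have h := fun a b => ih x y (l₁ ++ a :: b :: l₂) (by simp at hl ⊢; omega)
    have h' : ∀ a b, ev (Diagram.enclose D) (x :: l₁ ++ a :: b :: (l₂ ++ [y])) =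
      cupW x y * ev D (l₁ ++ a :: b :: l₂) := fun a b => by rw [← h]; simp
    simp only [Diagram.enclose, ev, crossOp]
    split_ifs <;>
    · simp only [LinearMap.add_apply, LinearMap.smul_apply, LinearMap.id_apply, Pi.add_apply,
        Pi.smul_apply, smul_eq_mul, LinearMap.comp_apply]
      rw [e, cupOp_append (by simp [h1]), cupOp_append h1, capOp_append (by simp [h1]),
        capOp_append h1, h', h', h']
      ring

/-- The word `l` with `k` letters `true` added on both sides. -/
def padWord (k : ℕ) (l : List Bool) : List Bool :=
  List.replicate k true ++ l ++ List.replicate k true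

/-- The coordinates of a combination of diagrams in which all points in the projectors carry the
letter `true`, as a function of the word carried by the other `2n` points. They are put to zero on
words of any other length. -/
noncomputable def evPad (n k : ℕ) : Diagram.Comb (2 * (n + k)) →ₗ[HalfLaurent] Coord where
  toFun x l := if l.length = 2 * n then evComb _ x (padWord k l) else 0
  map_add' x y := by ext l; by_cases h : l.length = 2 * n <;> simp [h]
  map_smul' r x := by ext l; by_cases h : l.length = 2 * n <;> simp [h]

theorem evPad_of {n k : ℕ} (D : Diagram (2 * (n + k))) {l : List Bool} (hl : l.length = 2 * n) :
    evPad n k (Diagram.of D) l = ev D (padWord k l) := by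
  simp [evPad, hl, evComb_of]

/-- The letter `true` at both ends of a minimum gives zero, and therefore diagrams that turn back into
a projector have coordinates zero. -/
theorem evPad_klRelations {n k : ℕ} : klRelations n k ≤ LinearMap.ker (evPad n k) := by
  refine Submodule.span_le.2 ?_
  rintro x (hx | ⟨D, ⟨i, hi, hik⟩, rfl⟩) <;> refine LinearMap.mem_ker.2 (funext fun l => ?_) <;>
    by_cases hl : l.length = 2 * n
  · simpa [evPad, hl] using evComb_relation hx (padWord k l) (by simp [padWord, hl]; omega)
  · simp [evPad, hl]
  · rw [evPad_of _ hl]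
    have hlen : (padWord k l).length = 2 * (n + k) := by simp [padWord, hl]; omega
    generalize hm : 2 * (n + k) = m at D hlen
    cases D with
    | empty => simp [Diagram.topCup] at hi
    | cap => simp [Diagram.topCup] at hi
    | cross => simp [Diagram.topCup] at hi
    | cup j hj D =>
      obtain rfl : j = i := by simpa [Diagram.topCup] using hi
      have h0 : ∀ r, (r < k ∨ 2 * n + k ≤ r) → r < 2 * (n + k) →
          (padWord k l).getD r false = true := by
        intro r hr hr'
        unfold padWord
        rcases hr with hr | hr
        · simp [List.getD_eq_getElem?_getD, List.getElem?_append, hr]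
        · simp [List.getD_eq_getElem?_getD, List.getElem?_append, hl]
          rw [if_neg (by omega), if_neg (by omega), List.getElem?_replicate, if_pos (by omega)]
          rfl
      simp only [ev, cupOp, LinearMap.coe_mk, AddHom.coe_mk]
      rw [h0 j (by omega) (by omega), h0 (j + 1) (by omega) (by omega)]
      simp [cupW]
  · simp [evPad, hl]

/-- The coordinates `evPad` on the Kauffman–Lins space. -/
noncomputable def evKL (n k : ℕ) : KLSpace n k →ₗ[HalfLaurent] Coord :=
  (klRelations n k).liftQ (evPad n k) evPad_klRelations

/-- The letter `true` at both ends of an outermost arc gives zero, too. -/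
theorem klEncloseRange_le {n k : ℕ} : klEncloseRange n k ≤ LinearMap.ker (evKL n k) := by
  cases k with
  | zero => exact bot_le
  | succ k =>
    rintro _ ⟨x, rfl⟩
    obtain ⟨x, rfl⟩ := Submodule.mkQ_surjective _ x
    rw [LinearMap.mem_ker]
    have : (evKL n (k + 1) ∘ₗ klEnclose n k) ∘ₗ (klRelations n k).mkQ = 0 := by
      refine Finsupp.lhom_ext' fun D => LinearMap.ext_ring ?_
      simp only [klEnclose, evKL, LinearMap.comp_apply, Finsupp.lsingle_apply, Submodule.mkQ_apply,
        Submodule.mapQ_apply, Submodule.liftQ_apply, LinearMap.zero_apply, Finsupp.lmapDomain_apply,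
        Finsupp.mapDomain_single]
      funext l
      by_cases hl : l.length = 2 * n
      · have h1 := evPad_of (k := k + 1) (Diagram.enclose D) hl
        rw [Diagram.of] at h1
        refine h1.trans ?_
        have := ev_enclose D true true (padWord k l) (by simp [padWord, hl]; omega)
        rw [show padWord (k + 1) l = true :: (padWord k l ++ [true]) by
          unfold padWord; rw [List.replicate_succ]
          nth_rewrite 2 [← List.replicate_succ]
          rw [List.replicate_succ']; simp]
        simpa [cupW] using this
      · simp [evPad, hl]
    exact LinearMap.congr_fun this x

/-- The coordinates `evPad` on the quotient `S^q_{n,k}`. -/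
noncomputable def evQuot (n k : ℕ) : KLQuotient n k →ₗ[HalfLaurent] Coord :=
  (klEncloseRange n k).liftQ (evKL n k) klEncloseRange_le

theorem evQuot_klClass {n k : ℕ} (D : Diagram (2 * (n + k))) {l : List Bool}
    (hl : l.length = 2 * n) :
    evQuot n k ((klEncloseRange n k).mkQ (klClass n k D)) l = ev D (padWord k l) :=
  evPad_of D hl

end Skein


namespace Skein

/-! ### Tensor coordinates of the drawing of a matching -/

/-- Functions of a sign `true` or `false` at each of the points `0, 1, 2, …`. In contrast to
`Coord`, where the letters are counted by position, adding an arc does not renumber the other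
points. -/
abbrev St : Type := (ℕ → Bool) → HalfLaurent

/-- The effect of adding an arc from `u` to `m` that crosses nothing. -/
noncomputable def cupSt (u m : ℕ) (v : St) : St := fun ω => cupW (ω u) (ω m) * v ω

/-- The effect of moving the right end `m` of an arc to the right, across (and above) the
strand that ends at `p`.  Signs keep the names of their strands. -/
noncomputable def crossSt (m p : ℕ) (h : St) : St := fun ω =>
  match ω p, ω m with
  | true, false => hqi * h ω +
      (hq - hqi ^ 3) * h (Function.update (Function.update ω m true) p false)
  | false, true => hqi * h ω
  | _, _ => hq * h ω

/-- The effect of adding an arc from `u` to `m` that passes above the strands ending at the points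
of the list `ps`, in this order. -/
noncomputable def arcSt (u m : ℕ) (ps : List ℕ) (v : St) : St :=
  ps.foldl (fun h p => crossSt m p h) (cupSt u m v)

theorem arcSt_nil (u m : ℕ) (v : St) : arcSt u m [] v = cupSt u m v := rfl

theorem arcSt_concat (u m p : ℕ) (ps : List ℕ) (v : St) :
    arcSt u m (ps ++ [p]) v = crossSt m p (arcSt u m ps v) := by
  simp [arcSt]

/-- The matrix entries of a crossing. -/
theorem crossOp_true_append {i : ℕ} {l₁ : List Bool} (h : l₁.length = i) (v : Coord) (x y : Bool)
    (l₂ : List Bool) : crossOp true i v (l₁ ++ x :: y :: l₂) =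
      match x, y with
      | true, false => hqi * v (l₁ ++ false :: true :: l₂) +
          (hq - hqi ^ 3) * v (l₁ ++ true :: false :: l₂)
      | false, true => hqi * v (l₁ ++ true :: false :: l₂)
      | a, b => hq * v (l₁ ++ a :: b :: l₂) := by
  have ht := hq_mul_hqi
  simp only [crossOp, if_true, LinearMap.add_apply, LinearMap.smul_apply, LinearMap.id_apply,
    LinearMap.comp_apply, Pi.add_apply, Pi.smul_apply, smul_eq_mul, cupOp_append h,
    capOp_append h]
  cases x <;> cases y <;> simp only [cupW] <;> grind

/-- Adding an arc from `u` to `u'` above the strands that end at `ms`, in tensor coordinates: `L₁`,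
`ms` and `L₃` are the names of the endpoints of `D` to the left of `u`, between the two ends, and to
the right of `u'`. -/
theorem ev_addOverArc {m : ℕ} (D : Diagram m) (u u' : ℕ) (L₁ : List ℕ) (hL₁ : L₁.length = u)
    (V : St) (ms : List ℕ) : ∀ (L₃ : List ℕ) (c : ℕ) (hc : u + c ≤ m), ms.length = c →
      (L₁ ++ u :: (ms ++ u' :: L₃)).Nodup →
      (∀ ω, V ω = ev D ((L₁ ++ (ms ++ L₃)).map ω)) →
      ∀ ω, ev (Diagram.addOverArc u c hc D) ((L₁ ++ u :: (ms ++ u' :: L₃)).map ω) =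
        arcSt u u' ms V ω := by
  induction ms using List.reverseRecOn with
  | nil =>
    rintro L₃ c hc rfl _ hV ω
    have := cupOp_append (l₁ := L₁.map ω) (i := u) (by simpa using hL₁) (ev D) (ω u) (ω u')
      (L₃.map ω)
    simp only [List.nil_append, List.map_append, List.map_cons] at this ⊢
    refine this.trans ?_
    rw [arcSt_nil, cupSt, hV]
    simp
  | append_singleton ms p ih =>
    intro L₃ c hc hlen hnd hV ω
    obtain ⟨c, rfl⟩ : ∃ c', c = c' + 1 := ⟨ms.length, by simpa using hlen.symm⟩
    have hlen' : ms.length = c := by simpa using hlen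
    have hnd' : (L₁ ++ u :: (ms ++ u' :: p :: L₃)).Nodup := by
      refine (List.Perm.nodup_iff ?_).1 hnd
      refine List.Perm.append_left _ (List.Perm.cons _ ?_)
      rw [List.append_assoc]
      refine List.Perm.append_left _ ?_
      exact List.Perm.swap _ _ _
    have key := ih (p :: L₃) c (by omega) hlen' hnd' (fun ω => by rw [hV]; simp)
    rw [arcSt_concat]
    have hm : (L₁ ++ u :: (ms ++ [p] ++ u' :: L₃)).map ω =
        (L₁ ++ u :: ms).map ω ++ ω p :: ω u' :: L₃.map ω := by simp
    have hk : ∀ ω : ℕ → Bool, (L₁ ++ u :: (ms ++ u' :: p :: L₃)).map ω =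
        (L₁ ++ u :: ms).map ω ++ ω u' :: ω p :: L₃.map ω := fun ω => by simp
    rw [hm]
    have hl : ((L₁ ++ u :: ms).map ω).length = u + c + 1 := by simp [hL₁, hlen']; omega
    simp only [Diagram.addOverArc, ev]
    rw [crossOp_true_append hl]
    have k1 := key ω
    rw [hk] at k1
    unfold crossSt
    rcases h1 : ω p <;> rcases h2 : ω u' <;> simp only [h1, h2] at k1 ⊢ <;> rw [← k1]
    congr 2
    have k2 := key (Function.update (Function.update ω u' true) p false)
    rw [← k2, hk]
    have hpu : u' ≠ p := by
      rintro rfl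
      simp [List.nodup_append] at hnd
    have hne : ∀ r ∈ L₁ ++ u :: ms, r ≠ p ∧ r ≠ u' := by
      intro r hr
      rw [show L₁ ++ u :: (ms ++ u' :: p :: L₃) = (L₁ ++ u :: ms) ++ u' :: p :: L₃ by simp,
        List.nodup_append] at hnd'
      exact ⟨hnd'.2.2 r hr p (by simp), hnd'.2.2 r hr u' (by simp)⟩
    have hne' : ∀ r ∈ L₃, r ≠ p ∧ r ≠ u' := by
      intro r hr
      rw [show L₁ ++ u :: (ms ++ u' :: p :: L₃) = (L₁ ++ u :: ms ++ [u', p]) ++ L₃ by simp,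
        List.nodup_append] at hnd'
      exact ⟨(hnd'.2.2 p (by simp) r hr).symm, (hnd'.2.2 u' (by simp) r hr).symm⟩
    congr 1
    simp only [Function.update_self, Function.update_of_ne hpu]
    congr 1
    · refine List.map_congr_left fun r hr => ?_
      rw [Function.update_of_ne (hne r hr).1, Function.update_of_ne (hne r hr).2]
    · congr 2
      refine List.map_congr_left fun r hr => ?_
      rw [Function.update_of_ne (hne' r hr).1, Function.update_of_ne (hne' r hr).2]

variable {N : ℕ} (M : PerfectMatching (2 * N))

/-- The partner function of a matching on natural numbers; numbers that are not points of the matching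
are their own partners. -/
def natPartner (r : ℕ) : ℕ := if h : r < 2 * N then M.partner ⟨r, h⟩ else r

theorem natPartner_val (i : Fin (2 * N)) : natPartner M i = M.partner i := by
  simp [natPartner]

theorem natPartner_lt {r : ℕ} (h : r < 2 * N) : natPartner M r < 2 * N := by
  simp [natPartner, h]

theorem natPartner_natPartner (r : ℕ) : natPartner M (natPartner M r) = r := by
  by_cases h : r < 2 * N
  · simp [natPartner, h, M.partner_partner]
  · simp [natPartner, h]

theorem natPartner_ne {r : ℕ} (h : r < 2 * N) : natPartner M r ≠ r := by
  simp only [natPartner, h, dif_pos]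
  intro h'
  exact M.partner_ne ⟨r, h⟩ (Fin.ext h')

/-- The right endpoints `w` of the arcs `(w', w)` with `w' < P < w < P'`, where `P'` is the
partner of `P`. -/
def crossedBy (P : ℕ) : List ℕ :=
  (List.range' (P + 1) (natPartner M P - P - 1)).filter fun r => natPartner M r < P

/-- The coordinates of the part of the drawing of a matching that consists of the arcs whose left
endpoints are smaller than the given number. -/
noncomputable def drawSt : ℕ → St
  | 0 => fun _ => 1
  | P + 1 => if P < natPartner M P then arcSt P (natPartner M P) (crossedBy M P) (drawSt P)
      else drawSt P

/-- The endpoints of the arcs whose left endpoints are smaller than `P`, in increasing order. -/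
def activeList (P : ℕ) : List ℕ :=
  (List.range (2 * N)).filter fun r => r < P ∨ natPartner M r < P

/-- The endpoints, to the right of the partner of `P`, of arcs whose left endpoints are smaller
than `P`. -/
def activeRight (P : ℕ) : List ℕ :=
  (List.range' (natPartner M P + 1) (2 * N - natPartner M P - 1)).filter
    fun r => natPartner M r < P

theorem range_split {P Q : ℕ} (h : P < Q) (hQ : Q < 2 * N) :
    List.range (2 * N) = List.range P ++ P :: (List.range' (P + 1) (Q - P - 1) ++
      Q :: List.range' (Q + 1) (2 * N - Q - 1)) := by
  have h1 : Q :: List.range' (Q + 1) (2 * N - Q - 1) = List.range' Q (2 * N - Q) := by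
    obtain ⟨d, hd⟩ : ∃ d, 2 * N - Q = d + 1 := ⟨2 * N - Q - 1, by omega⟩
    rw [hd, Nat.add_sub_cancel, List.range'_succ]
  have h2 : List.range' (P + 1) (Q - P - 1) ++ List.range' Q (2 * N - Q) =
      List.range' (P + 1) (2 * N - P - 1) := by
    have := @List.range'_append_1 (P + 1) (Q - P - 1) (2 * N - Q)
    rw [show P + 1 + (Q - P - 1) = Q by omega] at this
    rw [this]; congr 1; omega
  have h3 : P :: List.range' (P + 1) (2 * N - P - 1) = List.range' P (2 * N - P) := by
    obtain ⟨d, hd⟩ : ∃ d, 2 * N - P = d + 1 := ⟨2 * N - P - 1, by omega⟩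
    rw [hd, Nat.add_sub_cancel, List.range'_succ]
  rw [h1, h2, h3, List.range_eq_range', List.range_eq_range']
  have := @List.range'_append_1 0 P (2 * N - P)
  rw [zero_add] at this
  rw [this]; congr 1; omega

theorem activeList_of_left {P : ℕ} (hP : P < 2 * N) (h : P < natPartner M P) :
    activeList M P = List.range P ++ (crossedBy M P ++ activeRight M P) := by
  have hQ := natPartner_lt M hP
  rw [activeList, range_split h hQ]
  simp only [List.filter_append, List.filter_cons]
  rw [if_neg (by simpa using h.le), if_neg (by
    simp only [natPartner_natPartner, lt_irrefl, or_false, decide_eq_true_eq, not_lt]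
    exact h.le)]
  congr 1
  · exact List.filter_eq_self.2 fun r hr => by simp at hr; simp [hr]
  · unfold crossedBy activeRight
    congr 1
    all_goals
      refine List.filter_congr fun r hr => ?_
      simp only [List.mem_range'_1] at hr
      rw [decide_eq_decide]; omega

theorem activeList_succ_of_left {P : ℕ} (hP : P < 2 * N) (h : P < natPartner M P) :
    activeList M (P + 1) =
      List.range P ++ P :: (crossedBy M P ++ natPartner M P :: activeRight M P) := by
  have hQ := natPartner_lt M hP
  have hne : ∀ r, r ≠ natPartner M P → natPartner M r ≠ P := by
    rintro r hr rfl
    exact hr (natPartner_natPartner M r).symm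
  rw [activeList, range_split h hQ]
  simp only [List.filter_append, List.filter_cons]
  rw [if_pos (by simp), if_pos (by simp [natPartner_natPartner])]
  congr 1
  · exact List.filter_eq_self.2 fun r hr => by simp at hr; simp; omega
  · unfold crossedBy activeRight
    congr 2
    · refine List.filter_congr fun r hr => ?_
      simp only [List.mem_range'_1] at hr
      have := hne r (by omega)
      rw [decide_eq_decide]; omega
    · congr 1
      refine List.filter_congr fun r hr => ?_
      simp only [List.mem_range'_1] at hr
      have := hne r (by omega)
      rw [decide_eq_decide]; omega

theorem activeList_succ_of_not_left {P : ℕ} (h : ¬ P < natPartner M P) :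
    activeList M (P + 1) = activeList M P := by
  refine List.filter_congr fun r hr => ?_
  simp only [List.mem_range] at hr
  have h1 := natPartner_ne M hr
  by_cases hrP : r = P
  · subst hrP
    rw [decide_eq_decide]; omega
  · by_cases h2 : natPartner M r = P
    · have := natPartner_natPartner M r
      rw [h2] at this
      rw [decide_eq_decide]; omega
    · rw [decide_eq_decide]; omega

theorem activeList_nodup (P : ℕ) : (activeList M P).Nodup := List.nodup_range.filter _

theorem length_crossedBy (i : Fin (2 * N)) : (crossedBy M i).length = M.overlaps i := by
  rw [crossedBy, ← List.toFinset_card_of_nodup (List.Nodup.filter _ List.nodup_range'), PerfectMatching.overlaps,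
    ← Finset.card_map Fin.valEmbedding]
  congr 1
  ext r
  simp only [List.mem_toFinset, List.mem_filter, List.mem_range'_1, decide_eq_true_eq,
    Finset.mem_map, Finset.mem_filter, Finset.mem_univ, true_and, Fin.valEmbedding_apply]
  rw [natPartner_val]
  constructor
  · rintro ⟨h1, h2⟩
    have h3 := (M.partner i).2
    refine ⟨⟨r, by omega⟩, ⟨?_, ?_, ?_⟩, rfl⟩
    · exact Fin.lt_def.2 (by simp; omega)
    · exact Fin.lt_def.2 (by simp; omega)
    · rw [Fin.lt_def, ← natPartner_val]; exact h2
  · rintro ⟨w, ⟨h1, h2, h3⟩, rfl⟩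
    rw [natPartner_val]
    simp only [Fin.lt_def] at h1 h2 h3
    omega

theorem leftAt_card {i : Fin (2 * N)} (hi : i < M.partner i) (t : Fin N)
    (ht : (t : ℕ) = (M.lefts.filter fun j => j < i).card) : M.leftAt t = i := by
  have hi' : i ∈ Set.range (M.lefts.orderEmbOfFin M.card_lefts) := by
    rw [Finset.range_orderEmbOfFin]; simpa [PerfectMatching.lefts] using hi
  obtain ⟨r, rfl⟩ := hi'
  have : M.lefts.filter (fun j => j < M.lefts.orderEmbOfFin M.card_lefts r) =
      (Finset.Iio r).map (M.lefts.orderEmbOfFin M.card_lefts).toEmbedding := by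
    ext i
    simp only [Finset.mem_filter, Finset.mem_map, Finset.mem_Iio, RelEmbedding.coe_toEmbedding]
    constructor
    · rintro ⟨hi, hlt⟩
      have : i ∈ Set.range (M.lefts.orderEmbOfFin M.card_lefts) := by
        rw [Finset.range_orderEmbOfFin]; exact hi
      obtain ⟨s, rfl⟩ := this
      exact ⟨s, (OrderEmbedding.lt_iff_lt _).1 hlt, rfl⟩
    · rintro ⟨s, hs, rfl⟩
      exact ⟨Finset.orderEmbOfFin_mem _ _ _, (OrderEmbedding.lt_iff_lt _).2 hs⟩
  rw [this, Finset.card_map, Fin.card_Iio] at ht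
  rw [PerfectMatching.leftAt, Fin.ext ht]

/-- The number of left endpoints smaller than `P`. -/
def leftCount (P : ℕ) : ℕ := (M.lefts.filter fun j : Fin (2 * N) => (j : ℕ) < P).card

theorem leftCount_succ_of_left {P : ℕ} (hP : P < 2 * N) (h : P < natPartner M P) :
    leftCount M (P + 1) = leftCount M P + 1 := by
  have hmem : (⟨P, hP⟩ : Fin (2 * N)) ∈ M.lefts := by
    simp only [PerfectMatching.lefts, Finset.mem_filter, Finset.mem_univ, true_and]
    rw [Fin.lt_def, ← natPartner_val]; exact h
  rw [leftCount, leftCount, ← Finset.card_insert_of_notMem (a := (⟨P, hP⟩ : Fin (2 * N)))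
    (by simp)]
  congr 1
  ext j
  simp only [Finset.mem_filter, Finset.mem_insert, Fin.ext_iff]
  constructor
  · rintro ⟨h1, h2⟩
    by_cases h3 : (j : ℕ) = P
    · exact Or.inl h3
    · exact Or.inr ⟨h1, by omega⟩
  · rintro (h1 | ⟨h1, h2⟩)
    · exact ⟨by rw [show j = ⟨P, hP⟩ from Fin.ext h1]; exact hmem, by omega⟩
    · exact ⟨h1, by omega⟩

theorem leftCount_succ_of_not_left {P : ℕ} (h : ¬ P < natPartner M P) :
    leftCount M (P + 1) = leftCount M P := by
  rw [leftCount, leftCount]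
  congr 1
  refine Finset.filter_congr fun j hj => ?_
  simp only [PerfectMatching.lefts, Finset.mem_filter, Finset.mem_univ, true_and] at hj
  rw [Fin.lt_def, ← natPartner_val] at hj
  have : (j : ℕ) ≠ P := by rintro rfl; exact h hj
  omega

theorem leftCount_two_mul : leftCount M (2 * N) = N := by
  rw [leftCount, Finset.filter_true_of_mem fun j _ => j.2, M.card_lefts]

/-- Induction over the construction of the drawing of a matching, one arc after the other. -/
theorem drawFirst_induction (p : ∀ (_ t : ℕ), Diagram (2 * t) → Prop)
    (h0 : p 0 0 Diagram.empty)
    (hleft : ∀ (P t : ℕ) (D : Diagram (2 * t)), P < 2 * N → P < natPartner M P →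
      ∀ h : P + (crossedBy M P).length ≤ 2 * t, p P t D →
        p (P + 1) (t + 1) (Diagram.addOverArc P (crossedBy M P).length h D))
    (hright : ∀ (P t : ℕ) (D : Diagram (2 * t)), P < 2 * N → ¬ P < natPartner M P → p P t D →
      p (P + 1) t D) : p (2 * N) N M.draw := by
  have : ∀ P ≤ 2 * N, ∀ (t : ℕ) (ht : t ≤ N), t = leftCount M P → p P t (M.drawFirst t ht) := by
    intro P
    induction P with
    | zero =>
      intro _ t ht h
      obtain rfl : t = 0 := by simpa [leftCount] using h
      exact h0
    | succ P ih =>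
      intro hP t ht h
      by_cases hl : P < natPartner M P
      · rw [leftCount_succ_of_left M (by omega) hl] at h
        subst h
        have hle : M.leftAt ⟨leftCount M P, ht⟩ = ⟨P, hP⟩ := by
          refine leftAt_card M ?_ _ rfl
          rw [Fin.lt_def, ← natPartner_val]; exact hl
        have := hleft P _ _ hP hl (by
          have := M.leftAt_add_overlaps_le ⟨leftCount M P, ht⟩
          rw [hle] at this
          rwa [show (crossedBy M P).length = _ from length_crossedBy M ⟨P, hP⟩])
          (ih (by omega) _ (by omega) rfl)
        convert this using 1
        simp only [PerfectMatching.drawFirst]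
        congr 1
        · rw [hle]
        · rw [hle, ← length_crossedBy]
      · rw [leftCount_succ_of_not_left M hl] at h
        exact hright P t _ hP hl (ih (by omega) t ht h)
  exact this _ le_rfl N le_rfl (leftCount_two_mul M).symm

/-- The tensor coordinates of the drawing of a matching. -/
theorem ev_draw (ω : ℕ → Bool) :
    ev M.draw ((List.range (2 * N)).map ω) = drawSt M (2 * N) ω := by
  have := drawFirst_induction M
    (fun P t D => ∀ ω, ev D ((activeList M P).map ω) = drawSt M P ω)
    (fun ω => by simp [drawSt, ev])
    (fun P t D hP hl h ih ω => by
      rw [activeList_succ_of_left M hP hl, drawSt, if_pos hl]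
      refine ev_addOverArc D P (natPartner M P) (List.range P) (by simp) _ _ _ _ h rfl ?_ ?_ ω
      · rw [← activeList_succ_of_left M hP hl]
        exact activeList_nodup M _
      · intro ω
        rw [← ih, activeList_of_left M hP hl])
    (fun P t D hP hl ih ω => by
      rw [activeList_succ_of_not_left M hl, drawSt, if_neg hl, ih])
  rw [← this, activeList, List.filter_eq_self.2]
  simp +contextual

end Skein


namespace Skein

/-! ### The lowering operators on tensor coordinates -/

/-- `q^{-1}` for `true` and `q` for `false`. -/
noncomputable def kWt (b : Bool) : HalfLaurent := if b then hqi ^ 2 else hq ^ 2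

/-- The product of the weights `kWt` over a list of points. -/
noncomputable def kProd (L : List ℕ) (ω : ℕ → Bool) : HalfLaurent := (L.map fun r => kWt (ω r)).prod

/-- The operator `∑_p 1 ⊗ ⋯ ⊗ F_p ⊗ K⁻¹ ⊗ ⋯ ⊗ K⁻¹` on the tensor factors at the points of `L`:
its value at `ω` is the sum over the points `p` of `L` with sign `false`, of the value at the signs in
which `p` gets the sign `true`, weighted by the points of `L` that follow `p`. -/
noncomputable def lowerOp : List ℕ → St → St
  | [], _ => fun _ => 0
  | p :: L, v => fun ω =>
      (if ω p then 0 else kProd L ω * v (Function.update ω p true)) + lowerOp L v ω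

/-- The value of `v` does not depend on the sign at `p`. -/
def IndepAt (v : St) (p : ℕ) : Prop := ∀ ω b, v (Function.update ω p b) = v ω

theorem kProd_nil (ω : ℕ → Bool) : kProd [] ω = 1 := rfl

theorem kProd_cons (p : ℕ) (L : List ℕ) (ω : ℕ → Bool) :
    kProd (p :: L) ω = kWt (ω p) * kProd L ω := by simp [kProd]

theorem kProd_append (L L' : List ℕ) (ω : ℕ → Bool) :
    kProd (L ++ L') ω = kProd L ω * kProd L' ω := by simp [kProd]

theorem kProd_indep {L : List ℕ} {p : ℕ} (h : p ∉ L) : IndepAt (kProd L) p := by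
  intro ω b
  unfold kProd
  congr 1
  refine List.map_congr_left fun r hr => ?_
  rw [Function.update_of_ne (by rintro rfl; exact h hr)]

theorem lowerOp_append (L L' : List ℕ) (v : St) (ω : ℕ → Bool) :
    lowerOp (L ++ L') v ω = kProd L' ω * lowerOp L v ω + lowerOp L' v ω := by
  induction L with
  | nil => simp [lowerOp]
  | cons p L ih =>
    simp only [List.cons_append, lowerOp, ih, kProd_append]
    split_ifs <;> ring

theorem lowerOp_pair (i j : ℕ) (v : St) (ω : ℕ → Bool) : lowerOp [i, j] v ω =
    (if ω i then 0 else kWt (ω j) * v (Function.update ω i true)) +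
      (if ω j then 0 else v (Function.update ω j true)) := by
  simp [lowerOp, kProd]

/-- Values of lowering operators only involve the values of the functions at the signs in which one
sign `false` has been raised. -/
theorem lowerOp_congr_of_false {L : List ℕ} {v w : St} {ω ω' : ℕ → Bool} {a : HalfLaurent}
    (hω : ∀ p ∈ L, ω' p = ω p)
    (h : ∀ p ∈ L, ω p = false →
      w (Function.update ω' p true) = a * v (Function.update ω p true)) :
    lowerOp L w ω' = a * lowerOp L v ω := by
  induction L with
  | nil => simp [lowerOp]
  | cons p L ih =>
    simp only [lowerOp]
    rw [ih (fun r hr => hω r (by simp [hr])) (fun r hr => h r (by simp [hr])), hω p (by simp)]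
    have : kProd L ω' = kProd L ω := by
      unfold kProd; congr 1
      exact List.map_congr_left fun r hr => by rw [hω r (by simp [hr])]
    rw [this]
    rcases hp : ω p
    · rw [h p (by simp) hp]; simp; ring
    · simp

theorem lowerOp_congr {L : List ℕ} {v w : St} {ω ω' : ℕ → Bool} {a : HalfLaurent}
    (hω : ∀ p ∈ L, ω' p = ω p)
    (h : ∀ p ∈ L, w (Function.update ω' p true) = a * v (Function.update ω p true)) :
    lowerOp L w ω' = a * lowerOp L v ω :=
  lowerOp_congr_of_false hω fun p hp _ => h p hp

theorem lowerOp_mul {L : List ℕ} {h v : St} (hh : ∀ p ∈ L, IndepAt h p) (ω : ℕ → Bool) :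
    lowerOp L (fun ω => h ω * v ω) ω = h ω * lowerOp L v ω :=
  lowerOp_congr (fun _ _ => rfl) fun p hp => by rw [hh p hp]

theorem lowerOp_update {L : List ℕ} {v : St} {p : ℕ} (hp : p ∉ L) (b : Bool) (ω : ℕ → Bool) :
    lowerOp L v (Function.update ω p b) = lowerOp L (fun ω => v (Function.update ω p b)) ω := by
  rw [← one_mul (lowerOp L (fun ω => v (Function.update ω p b)) ω)]
  refine lowerOp_congr (fun r hr => ?_) fun r hr => ?_
  · rw [Function.update_of_ne (by rintro rfl; exact hp hr)]
  · rw [Function.update_comm (by rintro rfl; exact hp hr), one_mul]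

theorem lowerOp_add (L : List ℕ) (v w : St) (ω : ℕ → Bool) :
    lowerOp L (fun ω => v ω + w ω) ω = lowerOp L v ω + lowerOp L w ω := by
  induction L with
  | nil => simp [lowerOp]
  | cons p L ih => simp only [lowerOp, ih]; split_ifs <;> ring

theorem lowerOp_smul (L : List ℕ) (a : HalfLaurent) (v : St) (ω : ℕ → Bool) :
    lowerOp L (fun ω => a * v ω) ω = a * lowerOp L v ω :=
  lowerOp_mul (h := fun _ => a) (fun _ _ _ _ => rfl) ω

theorem lowerOp_zero (L : List ℕ) (ω : ℕ → Bool) : lowerOp L (fun _ => 0) ω = 0 := by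
  have := lowerOp_smul L 0 (fun _ => 0) ω
  simpa using this

theorem lowerOp_sum {ι : Type*} (L : List ℕ) (s : Finset ι) (v : ι → St) (ω : ℕ → Bool) :
    lowerOp L (fun ω => ∑ i ∈ s, v i ω) ω = ∑ i ∈ s, lowerOp L (v i) ω := by
  classical
  induction s using Finset.induction_on with
  | empty => simpa using lowerOp_zero L ω
  | insert i s hi ih => simp only [Finset.sum_insert hi]; rw [lowerOp_add, ih]

theorem lowerOp_indep {L : List ℕ} {v : St} {p : ℕ} (hv : IndepAt v p) (hp : p ∉ L) :
    IndepAt (lowerOp L v) p := by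
  intro ω b
  rw [lowerOp_update hp]
  congr 1
  funext ω
  exact hv ω b

theorem lowerOp_comm_of_disjoint {L L' : List ℕ} (h : ∀ p ∈ L, p ∉ L') (v : St) (ω : ℕ → Bool) :
    lowerOp L (lowerOp L' v) ω = lowerOp L' (lowerOp L v) ω := by
  induction L generalizing ω with
  | nil => exact (lowerOp_zero L' ω).symm
  | cons p L ih =>
    have h' : ∀ r ∈ L, r ∉ L' := fun r hr => h r (by simp [hr])
    have hp := h p (by simp)
    have e : lowerOp (p :: L) v = fun ω => (if ω p then 0 else 1) *
      (kProd L ω * (fun ω => v (Function.update ω p true)) ω) + lowerOp L v ω := by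
      funext ω; simp only [lowerOp]; split_ifs <;> simp
    rw [e, lowerOp_add, ← ih h', lowerOp_mul (h := fun ω => if ω p then 0 else 1),
      lowerOp_mul, ← lowerOp_update hp]
    · simp only [lowerOp]; split_ifs <;> simp
    · exact fun r hr => kProd_indep fun hr' => h' r hr' hr
    · intro r hr ω b
      simp only
      rw [Function.update_of_ne (by rintro rfl; exact hp hr)]

/-- Lowering operators on an initial segment commute with those on the whole list. -/
theorem lowerOp_comm_append {L L' : List ℕ} (h : ∀ p ∈ L, p ∉ L') (v : St) (ω : ℕ → Bool) :
    lowerOp L (lowerOp (L ++ L') v) ω = lowerOp (L ++ L') (lowerOp L v) ω := by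
  have e : lowerOp (L ++ L') v = fun ω => kProd L' ω * lowerOp L v ω + lowerOp L' v ω :=
    funext fun ω => lowerOp_append L L' v ω
  rw [e, lowerOp_add, lowerOp_mul fun p hp => kProd_indep (h p hp), lowerOp_comm_of_disjoint h,
    lowerOp_append]

/-! ### Arcs and strands -/

/-- The constant `q^{-1} - q`. -/
noncomputable def cDot : HalfLaurent := hqi ^ 2 - hq ^ 2

/-- The effect of adding a dotted arc from `i` to `j`, when `L` is the list of the points to the
left of `i`. In the coordinates of expanded diagrams, a dotted arc stands for its two strands to the
projectors, which carry the sign `true` at the other end: `j` must have the sign `false`, and if `i`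
does not have it, too, then the crossings of the strand from `i` with the strands to the left of `i`
compensate for this by lowering one of their signs. -/
noncomputable def dotSt (L : List ℕ) (i j : ℕ) (v : St) : St := fun ω =>
  if ω j then 0 else if ω i then cDot * lowerOp L v ω else v ω

theorem cupSt_indep {i j p : ℕ} {v : St} (hv : IndepAt v p) (hi : p ≠ i) (hj : p ≠ j) :
    IndepAt (cupSt i j v) p := by
  intro ω b
  simp only [cupSt, hv ω b, Function.update_of_ne hi.symm, Function.update_of_ne hj.symm]

theorem dotSt_indep {L : List ℕ} {i j p : ℕ} {v : St} (hv : IndepAt v p) (hi : p ≠ i) (hj : p ≠ j)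
    (hL : p ∉ L) : IndepAt (dotSt L i j v) p := by
  intro ω b
  simp only [dotSt, hv ω b, Function.update_of_ne hi.symm, Function.update_of_ne hj.symm,
    lowerOp_indep hv hL ω b]

/-- The ends of an undotted arc that lies outside of `L` play no role for the lowering operator. -/
theorem lowerOp_cupSt_of_notMem {L : List ℕ} {i j : ℕ} (hi : i ∉ L) (hj : j ∉ L) (v : St)
    (ω : ℕ → Bool) : lowerOp L (cupSt i j v) ω = cupSt i j (lowerOp L v) ω := by
  refine lowerOp_mul (h := fun ω => cupW (ω i) (ω j)) (fun p hp ω b => ?_) ω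
  simp only
  rw [Function.update_of_ne (by rintro rfl; exact hi hp),
    Function.update_of_ne (by rintro rfl; exact hj hp)]

/-- An undotted arc both ends of which belong to the list, next to each other, contributes nothing to
the lowering operator, since it represents an invariant vector. -/
theorem lowerOp_cupSt {L L' : List ℕ} {i j : ℕ} (hij : i ≠ j) (hi : i ∉ L ++ L') (hj : j ∉ L ++ L')
    {v : St} (hvi : IndepAt v i) (hvj : IndepAt v j) (ω : ℕ → Bool) :
    lowerOp (L ++ i :: j :: L') (cupSt i j v) ω = cupSt i j (lowerOp (L ++ L') v) ω := by
  simp only [List.mem_append, not_or] at hi hj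
  rw [show L ++ i :: j :: L' = (L ++ [i, j]) ++ L' by simp, lowerOp_append, lowerOp_append,
    lowerOp_cupSt_of_notMem hi.1 hj.1, lowerOp_cupSt_of_notMem hi.2 hj.2, lowerOp_pair]
  simp only [cupSt, lowerOp_append, kProd_cons, kProd_nil]
  have ht := hq_mul_hqi
  have h1 : v (Function.update ω i true) = v ω := hvi _ _
  have h2 : v (Function.update ω j true) = v ω := hvj _ _
  rw [h1, h2]
  simp only [Function.update_self, Function.update_of_ne hij, Function.update_of_ne hij.symm]
  rcases ω i <;> rcases ω j <;> simp [cupW, kWt] <;> grind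

/-- A lowering operator between the ends of an undotted arc produces a dot on this arc. -/
theorem lowerOp_cupSt_inside {L : List ℕ} {i j : ℕ} (hij : i ≠ j) (hi : i ∉ L) (hj : j ∉ L)
    {v : St} (hvi : IndepAt v i) (ω : ℕ → Bool) :
    lowerOp (L ++ [i]) (cupSt i j v) ω =
      dotSt L i j v ω + hq ^ 2 * cupSt i j (lowerOp L v) ω := by
  rw [lowerOp_append, lowerOp_cupSt_of_notMem hi hj]
  simp only [cupSt, lowerOp, kProd_cons, kProd_nil, dotSt, cDot]
  have ht := hq_mul_hqi
  have h1 : v (Function.update ω i true) = v ω := hvi _ _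
  rw [h1]
  simp only [Function.update_self, Function.update_of_ne hij.symm]
  rcases ω i <;> rcases ω j <;> simp [cupW, kWt]
  grind

theorem lowerOp_dotSt_of_notMem {L L₀ : List ℕ} {i j : ℕ} (hi : i ∉ L) (hj : j ∉ L) (v : St)
    (ω : ℕ → Bool) (hcomm : lowerOp L (lowerOp L₀ v) ω = lowerOp L₀ (lowerOp L v) ω) :
    lowerOp L (dotSt L₀ i j v) ω = dotSt L₀ i j (lowerOp L v) ω := by
  have key : ∀ w : St, lowerOp L (fun ω' => if ω' j then 0 else if ω' i then cDot * lowerOp L₀ v ω'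
      else v ω') ω = if ω j then 0 else if ω i then cDot * lowerOp L (lowerOp L₀ v) ω
      else lowerOp L v ω := by
    intro w
    split_ifs with h1 h2
    · have := lowerOp_congr (L := L) (v := fun _ => 0) (w := fun ω' => if ω' j then 0 else
        if ω' i then cDot * lowerOp L₀ v ω' else v ω') (ω := ω) (ω' := ω) (a := 0)
        (fun _ _ => rfl) (fun p hp => by
          have e : p ≠ j := by rintro rfl; exact hj hp
          simp [Function.update_of_ne e.symm, h1])
      simpa using this
    · refine lowerOp_congr (fun _ _ => rfl) fun p hp => ?_
      have e : p ≠ j := by rintro rfl; exact hj hp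
      have e' : p ≠ i := by rintro rfl; exact hi hp
      simp [Function.update_of_ne e.symm, Function.update_of_ne e'.symm, h1, h2]
    · rw [← one_mul (lowerOp L v ω)]
      refine lowerOp_congr (fun _ _ => rfl) fun p hp => ?_
      have e : p ≠ j := by rintro rfl; exact hj hp
      have e' : p ≠ i := by rintro rfl; exact hi hp
      simp [Function.update_of_ne e.symm, Function.update_of_ne e'.symm, h1, h2]
  unfold dotSt
  rw [key v, hcomm]

/-- Lowering operators commute with adding a dotted arc with neighbouring ends. -/
theorem lowerOp_dotSt {L L' : List ℕ} {i j : ℕ} (hij : i ≠ j) (hi : i ∉ L ++ L') (hj : j ∉ L ++ L')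
    (hd : ∀ p ∈ L, p ∉ L') {v : St} (hvi : IndepAt v i) (ω : ℕ → Bool) :
    lowerOp (L ++ i :: j :: L') (dotSt L i j v) ω = dotSt L i j (lowerOp (L ++ L') v) ω := by
  simp only [List.mem_append, not_or] at hi hj
  rw [show L ++ i :: j :: L' = (L ++ [i, j]) ++ L' by simp, lowerOp_append, lowerOp_append,
    lowerOp_dotSt_of_notMem hi.1 hj.1 _ _ rfl, lowerOp_dotSt_of_notMem hi.2 hj.2 _ _
      (lowerOp_comm_of_disjoint hd v ω).symm, lowerOp_pair]
  have h1 : ∀ b, lowerOp L v (Function.update ω i b) = lowerOp L v ω :=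
    fun b => lowerOp_indep hvi hi.1 ω b
  have ht := hq_mul_hqi
  have hc := lowerOp_comm_of_disjoint hd v ω
  simp only [dotSt, h1, Function.update_self, Function.update_of_ne hij,
    Function.update_of_ne hij.symm, lowerOp_comm_append hd, lowerOp_append, kProd_cons, kProd_nil,
    cDot]
  rcases ω i <;> rcases ω j <;> simp [kWt] <;> grind

/-- Lowering operators between the ends of a dotted arc commute with adding this arc up to a factor
`q^{-1}`. -/
theorem lowerOp_dotSt_inside {L : List ℕ} {i j : ℕ} (hij : i ≠ j) (hi : i ∉ L) (hj : j ∉ L)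
    {v : St} (hvi : IndepAt v i) (ω : ℕ → Bool) :
    lowerOp (L ++ [i]) (dotSt L i j v) ω = hqi ^ 2 * dotSt L i j (lowerOp L v) ω := by
  rw [lowerOp_append, lowerOp_dotSt_of_notMem hi hj _ _ rfl]
  have h1 : ∀ b, lowerOp L v (Function.update ω i b) = lowerOp L v ω :=
    fun b => lowerOp_indep hvi hi ω b
  have ht := hq_mul_hqi
  simp only [lowerOp, dotSt, h1, Function.update_self, Function.update_of_ne hij.symm, kProd_cons,
    kProd_nil, cDot]
  rcases ω i <;> rcases ω j <;> simp [kWt]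
  grind

end Skein


namespace Skein

/-! ### Coordinates of a system of arcs, built up from the outside -/

/-- The points of the set `A` to the left of `g`, in increasing order. -/
def below (A : Finset ℕ) (g : ℕ) : List ℕ := (List.range g).filter fun p => p ∈ A

/-- The endpoints of the arcs `(i, f i)`, for `i` in a list. -/
def pts (f : ℕ → ℕ) (ls : List ℕ) : Finset ℕ := ls.toFinset ∪ (ls.map f).toFinset

/-- The effect of adding the arc `(i, f i)`, which is dotted if `i ∈ s`, to a system of arcs
with the set `A` of endpoints. -/
noncomputable def arcStep (f : ℕ → ℕ) (s A : Finset ℕ) (i : ℕ) (v : St) : St :=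
  if i ∈ s then dotSt (below A i) i (f i) v else cupSt i (f i) v

/-- The coordinates of the system of the arcs `(i, f i)`, for `i` in a list; the dotted arcs
are those with `i ∈ s`. The arcs are added one after the other, beginning at the end of the list. -/
noncomputable def arcsSt (f : ℕ → ℕ) (s : Finset ℕ) : List ℕ → St
  | [] => fun _ => 1
  | i :: ls => arcStep f s (pts f ls) i (arcsSt f s ls)

/-- The point `p` lies outside of the arc `(i, f i)`. -/
def OffArc (f : ℕ → ℕ) (i p : ℕ) : Prop := p < i ∨ f i < p

/-- Each arc of the list has no endpoints of later arcs inside of it. As the arcs of a list are added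
beginning at the end of the list, each new arc then joins neighbouring points. -/
def InnerFirst (f : ℕ → ℕ) (ls : List ℕ) : Prop :=
  (∀ i ∈ ls, i < f i) ∧ ls.Pairwise fun i j => OffArc f i j ∧ OffArc f i (f j)

theorem mem_below {A : Finset ℕ} {g p : ℕ} : p ∈ below A g ↔ p < g ∧ p ∈ A := by
  simp [below]

theorem mem_pts {f : ℕ → ℕ} {ls : List ℕ} {p : ℕ} : p ∈ pts f ls ↔ ∃ i ∈ ls, p = i ∨ p = f i := by
  simp only [pts, Finset.mem_union, List.mem_toFinset, List.mem_map]
  constructor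
  · rintro (h | ⟨i, h, rfl⟩)
    · exact ⟨p, h, Or.inl rfl⟩
    · exact ⟨i, h, Or.inr rfl⟩
  · rintro ⟨i, h, rfl | rfl⟩
    · exact Or.inl h
    · exact Or.inr ⟨i, h, rfl⟩

theorem pts_cons (f : ℕ → ℕ) (i : ℕ) (ls : List ℕ) :
    pts f (i :: ls) = insert i (insert (f i) (pts f ls)) := by
  ext p; simp [mem_pts, or_assoc]

theorem pts_perm {f : ℕ → ℕ} {ls ls' : List ℕ} (h : ls.Perm ls') : pts f ls = pts f ls' := by
  ext p; simp [mem_pts, h.mem_iff]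

theorem pts_congr {f f' : ℕ → ℕ} {ls : List ℕ} (h : ∀ i ∈ ls, f i = f' i) :
    pts f ls = pts f' ls := by
  ext p; simp only [mem_pts]
  exact exists_congr fun i => and_congr_right fun hi => by rw [h i hi]

theorem innerFirst_cons {f : ℕ → ℕ} {i : ℕ} {ls : List ℕ} :
    InnerFirst f (i :: ls) ↔ i < f i ∧ (∀ p ∈ pts f ls, OffArc f i p) ∧ InnerFirst f ls := by
  simp only [InnerFirst, List.mem_cons, forall_eq_or_imp, List.pairwise_cons, mem_pts]
  constructor
  · rintro ⟨⟨h1, h2⟩, h3, h4⟩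
    refine ⟨h1, ?_, h2, h4⟩
    rintro p ⟨j, hj, rfl | rfl⟩
    exacts [(h3 _ hj).1, (h3 _ hj).2]
  · rintro ⟨h1, h2, h3, h4⟩
    exact ⟨⟨h1, h3⟩, fun j hj => ⟨h2 _ ⟨j, hj, Or.inl rfl⟩, h2 _ ⟨j, hj, Or.inr rfl⟩⟩, h4⟩

theorem InnerFirst.sublist {f : ℕ → ℕ} {ls ls' : List ℕ} (h : InnerFirst f ls)
    (hs : ls'.Sublist ls) : InnerFirst f ls' :=
  ⟨fun i hi => h.1 i (hs.subset hi), h.2.sublist hs⟩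

theorem InnerFirst.nodup {f : ℕ → ℕ} {ls : List ℕ} (h : InnerFirst f ls) : ls.Nodup := by
  induction ls with
  | nil => exact List.nodup_nil
  | cons i ls ih =>
    rw [innerFirst_cons] at h
    refine List.nodup_cons.2 ⟨fun hi => ?_, ih h.2.2⟩
    have := h.2.1 i (mem_pts.2 ⟨i, hi, Or.inl rfl⟩)
    unfold OffArc at this; omega

theorem arcStep_congr {f f' : ℕ → ℕ} {s s' A : Finset ℕ} {i : ℕ} (hf : f i = f' i)
    (hs : i ∈ s ↔ i ∈ s') (v : St) : arcStep f s A i v = arcStep f' s' A i v := by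
  simp only [arcStep, hs, hf]

theorem arcsSt_congr {f f' : ℕ → ℕ} {s s' : Finset ℕ} {ls : List ℕ}
    (h : ∀ i ∈ ls, f i = f' i ∧ (i ∈ s ↔ i ∈ s')) : arcsSt f s ls = arcsSt f' s' ls := by
  induction ls with
  | nil => rfl
  | cons i ls ih =>
    simp only [arcsSt]
    rw [ih fun j hj => h j (by simp [hj]), arcStep_congr (h i (by simp)).1 (h i (by simp)).2,
      pts_congr fun j hj => (h j (by simp [hj])).1]

theorem arcsSt_indep {f : ℕ → ℕ} {s : Finset ℕ} {ls : List ℕ} {p : ℕ} (h : p ∉ pts f ls) :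
    IndepAt (arcsSt f s ls) p := by
  induction ls with
  | nil => exact fun _ _ => rfl
  | cons i ls ih =>
    rw [pts_cons] at h
    simp only [Finset.mem_insert, not_or] at h
    simp only [arcsSt, arcStep]
    split_ifs
    · exact dotSt_indep (ih h.2.2) h.1 h.2.1 fun hp => h.2.2 (mem_below.1 hp).2
    · exact cupSt_indep (ih h.2.2) h.1 h.2.1

theorem arcStep_linear {ι : Type*} (f : ℕ → ℕ) (s A : Finset ℕ) (i : ℕ) (t : Finset ι)
    (a : ι → HalfLaurent) (v : ι → St) (ω : ℕ → Bool) :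
    arcStep f s A i (fun ω => ∑ x ∈ t, a x * v x ω) ω = ∑ x ∈ t, a x * arcStep f s A i (v x) ω := by
  unfold arcStep
  split_ifs with h
  · simp only [dotSt]
    rw [lowerOp_sum]
    simp only [lowerOp_smul, Finset.mul_sum]
    split_ifs <;> simp [mul_left_comm]
  · simp only [cupSt, Finset.mul_sum, mul_left_comm]

theorem arcStep_add (f : ℕ → ℕ) (s A : Finset ℕ) (i : ℕ) (v w : St) (ω : ℕ → Bool) :
    arcStep f s A i (fun ω => v ω + w ω) ω = arcStep f s A i v ω + arcStep f s A i w ω := by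
  have := arcStep_linear f s A i Finset.univ (fun _ : Bool => 1) (fun b => if b then v else w) ω
  simpa using this

theorem arcStep_smul (f : ℕ → ℕ) (s A : Finset ℕ) (i : ℕ) (a : HalfLaurent) (v : St)
    (ω : ℕ → Bool) : arcStep f s A i (fun ω => a * v ω) ω = a * arcStep f s A i v ω := by
  have := arcStep_linear f s A i Finset.univ (fun _ : Unit => a) (fun _ => v) ω
  simpa using this

theorem below_congr {A B : Finset ℕ} {g : ℕ} (h : ∀ p < g, p ∈ A ↔ p ∈ B) :
    below A g = below B g :=
  List.filter_congr fun p hp => by rw [decide_eq_decide]; exact h p (by simpa using hp)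

theorem below_split {A : Finset ℕ} {i g : ℕ} (h : i ≤ g) :
    below A g = below A i ++ (List.range' i (g - i)).filter (fun p => p ∈ A) := by
  unfold below
  rw [← List.filter_append, List.range_eq_range', List.range_eq_range']
  congr 1
  have := @List.range'_append_1 0 i (g - i)
  rw [zero_add] at this
  rw [this]; congr 1; omega

/-- The points of `A` in the interval from `j + 1` to `g - 1`, in increasing order. -/
def between (A : Finset ℕ) (j g : ℕ) : List ℕ :=
  (List.range' (j + 1) (g - (j + 1))).filter fun p => p ∈ A

theorem mem_between {A : Finset ℕ} {j g p : ℕ} :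
    p ∈ between A j g ↔ (j < p ∧ p < g) ∧ p ∈ A := by
  simp [between]; omega

theorem mem_insert_insert_iff {A : Finset ℕ} {i j p : ℕ} (hi : p ≠ i) (hj : p ≠ j) :
    p ∈ insert i (insert j A) ↔ p ∈ A := by simp [hi, hj]

section

variable {A : Finset ℕ} {i j g : ℕ} (hij : i < j) (hA : ∀ p ∈ A, p < i ∨ j < p)

include hij hA

theorem below_of_lt (hg : j < g) : below A g = below A i ++ between A j g := by
  rw [below_split (show j + 1 ≤ g from hg), below_split (show i ≤ j + 1 by omega)]
  rw [(List.filter_eq_nil_iff (l := List.range' i (j + 1 - i))).2, List.append_nil]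
  · rfl
  · intro p hp
    have := hA p
    simp at hp ⊢
    intro h; have := this h; omega

theorem below_insert_of_lt (hg : j < g) :
    below (insert i (insert j A)) g = below A i ++ i :: j :: between A j g := by
  rw [below_split (show j + 1 ≤ g from hg), below_split (show j ≤ j + 1 by omega),
    below_split (show i + 1 ≤ j from hij), below_split (show i ≤ i + 1 by omega)]
  rw [below_congr (B := A) (g := i) (fun p hp => mem_insert_insert_iff (by omega) (by omega))]
  rw [(List.filter_eq_nil_iff (l := List.range' (i + 1) (j - (i + 1)))).2, List.append_nil]
  · simp only [Nat.add_sub_cancel_left, List.range'_one, List.append_assoc]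
    congr 1
    rw [List.filter_cons_of_pos (by simp), List.filter_cons_of_pos (by simp)]
    simp only [List.filter_nil, List.cons_append, List.nil_append]
    congr 2
    refine List.filter_congr fun p hp => ?_
    rw [decide_eq_decide]
    simp only [List.mem_range'_1] at hp
    exact mem_insert_insert_iff (by omega) (by omega)
  · intro p hp
    have := hA p
    simp at hp ⊢
    refine ⟨by omega, by omega, fun h => ?_⟩; have := this h; omega

theorem below_inside (hi : i < g) (hj : g ≤ j) : below A g = below A i := by
  rw [below_split hi.le, (List.filter_eq_nil_iff (l := List.range' i (g - i))).2, List.append_nil]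
  intro p hp
  have := hA p
  simp at hp ⊢
  intro h; have := this h; omega

theorem below_insert_inside (hi : i < g) (hj : g ≤ j) :
    below (insert i (insert j A)) g = below A i ++ [i] := by
  rw [below_split (show i + 1 ≤ g from hi), below_split (show i ≤ i + 1 by omega)]
  rw [below_congr (B := A) (g := i) (fun p hp => mem_insert_insert_iff (by omega) (by omega))]
  rw [(List.filter_eq_nil_iff (l := List.range' (i + 1) (g - (i + 1)))).2, List.append_nil]
  · simp
  · intro p hp
    have := hA p
    simp at hp ⊢
    refine ⟨by omega, by omega, fun h => ?_⟩; have := this h; omega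

theorem below_insert_of_le (hg : g ≤ i) : below (insert i (insert j A)) g = below A g :=
  below_congr fun p hp => mem_insert_insert_iff (by omega) (by omega)

end

theorem arcStep_comm_of_lt {f : ℕ → ℕ} {s A : Finset ℕ} {i j : ℕ} (hi : i < f i) (hj : j < f j)
    (hij : f i < j) (hA : ∀ p ∈ A, OffArc f i p ∧ OffArc f j p) {v : St}
    (hv : ∀ p ∉ A, IndepAt v p) (ω : ℕ → Bool) :
    arcStep f s (insert j (insert (f j) A)) i (arcStep f s A j v) ω =
      arcStep f s (insert i (insert (f i) A)) j (arcStep f s A i v) ω := by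
  have hA' : ∀ p ∈ A, p < i ∨ f i < p := fun p hp => (hA p hp).1
  have hnA : ∀ p, i ≤ p → p ≤ f i → p ∉ A := fun p h1 h2 hp => by have := hA' p hp; omega
  have hnA' : ∀ p, j ≤ p → p ≤ f j → p ∉ A := fun p h1 h2 hp => by
    have := (hA p hp).2; unfold OffArc at this; omega
  have hvi := hv i (hnA _ le_rfl hi.le)
  have hvj := hv (f i) (hnA _ hi.le le_rfl)
  unfold arcStep
  rw [below_congr (A := insert j (insert (f j) A)) (B := A) (g := i)
    (fun p hp => mem_insert_insert_iff (by omega) (by omega)), below_insert_of_lt hi hA' hij, below_of_lt hi hA' hij]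
  set L := below A i with hL
  set L' := between A (f i) j with hL'
  have hLi : ∀ p ∈ L, p < i := fun p hp => (mem_below.1 hp).1
  have hLi' : ∀ p ∈ L', f i < p ∧ p < j := fun p hp => (mem_between.1 hp).1
  have n1 : i ∉ L ++ L' := fun h => by
    rcases List.mem_append.1 h with h | h
    · have := hLi _ h; omega
    · have := hLi' _ h; omega
  have n2 : f i ∉ L ++ L' := fun h => by
    rcases List.mem_append.1 h with h | h
    · have := hLi _ h; omega
    · have := hLi' _ h; omega
  have n3 : j ∉ L := fun h => by have := hLi _ h; omega
  have n4 : f j ∉ L := fun h => by have := hLi _ h; omega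
  have hd : ∀ p ∈ L, p ∉ L' := fun p hp hp' => by
    have := hLi p hp; have := hLi' p hp'; omega
  by_cases h1 : i ∈ s <;> by_cases h2 : j ∈ s <;> simp only [h1, h2, if_true, if_false]
  · have e1 := lowerOp_dotSt_of_notMem n3 n4 v ω (lowerOp_comm_append (L' := L') hd v ω)
    have e2 := lowerOp_dotSt hi.ne n1 n2 hd hvi ω
    have e3 := lowerOp_comm_append (L' := L') hd v ω
    simp only [dotSt] at e1 e2 ⊢
    rw [e1, e2, e3]
    split_ifs <;> ring
  · have e1 := lowerOp_cupSt_of_notMem n3 n4 v ω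
    simp only [dotSt]
    rw [e1]
    simp only [cupSt, dotSt]
    split_ifs <;> ring
  · have e1 := lowerOp_cupSt hi.ne n1 n2 hvi hvj ω
    simp only [dotSt]
    rw [e1]
    simp only [cupSt, dotSt]
    split_ifs <;> ring
  · simp only [cupSt]; ring

/-- Two arcs, neither of which contains endpoints of other arcs, may be added in either order. For
two dotted arcs, this holds because the lowering operators at two gaps commute. -/
theorem arcStep_comm {f : ℕ → ℕ} {s A : Finset ℕ} {i j : ℕ} (hi : i < f i) (hj : j < f j)
    (hiA : ∀ p ∈ insert j (insert (f j) A), OffArc f i p)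
    (hjA : ∀ p ∈ insert i (insert (f i) A), OffArc f j p) {v : St}
    (hv : ∀ p ∉ A, IndepAt v p) :
    arcStep f s (insert j (insert (f j) A)) i (arcStep f s A j v) =
      arcStep f s (insert i (insert (f i) A)) j (arcStep f s A i v) := by
  funext ω
  have h1 := hiA j (by simp)
  have h2 := hiA (f j) (by simp)
  have h3 := hjA i (by simp)
  have h4 := hjA (f i) (by simp)
  have hA : ∀ p ∈ A, OffArc f i p ∧ OffArc f j p := fun p hp =>
    ⟨hiA p (by simp [hp]), hjA p (by simp [hp])⟩
  simp only [OffArc] at h1 h2 h3 h4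
  by_cases h : f i < j
  · exact arcStep_comm_of_lt hi hj h hA hv ω
  · exact (arcStep_comm_of_lt hj hi (by omega) (fun p hp => (hA p hp).symm) hv ω).symm

theorem arcsSt_move_front {f : ℕ → ℕ} {s : Finset ℕ} {i : ℕ} {P Q : List ℕ}
    (h : InnerFirst f (P ++ i :: Q)) (h' : InnerFirst f (i :: (P ++ Q))) :
    arcsSt f s (P ++ i :: Q) = arcsSt f s (i :: (P ++ Q)) := by
  induction P with
  | nil => rfl
  | cons p P ih =>
    simp only [List.cons_append] at h h' ⊢
    have e := ih (h.sublist (List.sublist_cons_self _ _))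
      (h'.sublist ((List.sublist_cons_self _ _).cons_cons _))
    rw [innerFirst_cons] at h h'
    have h2 := innerFirst_cons.1 h'.2.2
    have hp : pts f (P ++ i :: Q) = insert i (insert (f i) (pts f (P ++ Q))) := by
      rw [← pts_cons]; exact pts_perm List.perm_middle
    simp only [arcsSt]
    rw [e, hp, pts_cons]
    simp only [arcsSt]
    refine arcStep_comm h.1 h'.1 (fun r hr => h.2.1 r ?_) (fun r hr => h'.2.1 r ?_)
      fun r hr => arcsSt_indep hr
    · rwa [hp]
    · rwa [pts_cons]

/-- The coordinates of a system of arcs do not depend on the order in which they are added. -/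
theorem arcsSt_perm {f : ℕ → ℕ} {s : Finset ℕ} {ls ls' : List ℕ} (hp : ls.Perm ls')
    (h : InnerFirst f ls) (h' : InnerFirst f ls') : arcsSt f s ls = arcsSt f s ls' := by
  induction ls generalizing ls' with
  | nil => rw [List.nil_perm.1 hp]
  | cons i ls ih =>
    obtain ⟨P, Q, rfl⟩ := List.append_of_mem (hp.subset (by simp : i ∈ i :: ls))
    have hp' : ls.Perm (P ++ Q) := (List.perm_cons i).1 (hp.trans List.perm_middle)
    rw [innerFirst_cons] at h
    have hPQ : InnerFirst f (P ++ Q) := h'.sublist ((List.sublist_cons_self _ _).append_left _)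
    rw [arcsSt_move_front h' (innerFirst_cons.2 ⟨h.1, by rw [← pts_perm hp']; exact h.2.1, hPQ⟩)]
    simp only [arcsSt]
    rw [ih hp' h.2.2 hPQ, pts_perm hp']

/-- The left endpoints, larger than `x`, of the arcs that contain the gap to the left of `g` and
that are dotted or not, as `b` prescribes. -/
def coverCount (f : ℕ → ℕ) (s : Finset ℕ) (ls : List ℕ) (g x : ℕ) (b : Bool) : ℕ :=
  (ls.filter fun y => x < y ∧ y < g ∧ g ≤ f y ∧ decide (y ∈ s) = b).length

theorem coverCount_cons (f : ℕ → ℕ) (s : Finset ℕ) (i : ℕ) (ls : List ℕ) (g x : ℕ) (b : Bool) :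
    coverCount f s (i :: ls) g x b = coverCount f s ls g x b +
      if x < i ∧ i < g ∧ g ≤ f i ∧ decide (i ∈ s) = b then 1 else 0 := by
  unfold coverCount
  rw [List.filter_cons]
  by_cases h : x < i ∧ i < g ∧ g ≤ f i ∧ decide (i ∈ s) = b
  · rw [if_pos (by simpa using h), if_pos h, List.length_cons]
  · rw [if_neg (by simpa using h), if_neg h, add_zero]

/-- The exponent of `q` at the outer arc `x` in the quantum relations, up to a constant: it is
`i - 1 - n_i`, if `x` is the `i`-th of the undotted arcs around the gap. -/
def coverExp (f : ℕ → ℕ) (s : Finset ℕ) (ls : List ℕ) (g x : ℕ) : ℤ :=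
  coverCount f s ls g x false - coverCount f s ls g x true

/-- The undotted arcs that contain the gap to the left of `g`. -/
def covers (f : ℕ → ℕ) (s : Finset ℕ) (ls : List ℕ) (g : ℕ) : Finset ℕ :=
  ls.toFinset.filter fun x => x ∉ s ∧ x < g ∧ g ≤ f x

theorem arcsSt_insert_cons {f : ℕ → ℕ} {s : Finset ℕ} {i x : ℕ} (h : x ≠ i) (ls : List ℕ) :
    arcsSt f (insert x s) (i :: ls) =
      arcStep f s (pts f ls) i (arcsSt f (insert x s) ls) := by
  simp only [arcsSt]
  rw [arcStep_congr rfl]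
  simp [h.symm]

/-- The lowering operator at a gap turns a system of arcs into the weighted sum of all systems in
which one more of the arcs around this gap is dotted. This is where the correction terms of the quantum
relations come from. -/
theorem lowerOp_arcsSt {f : ℕ → ℕ} {s : Finset ℕ} {ls : List ℕ} (h : InnerFirst f ls) (g : ℕ)
    (ω : ℕ → Bool) : lowerOp (below (pts f ls) g) (arcsSt f s ls) ω =
      ∑ x ∈ covers f s ls g,
        qHalfPow (2 * coverExp f s ls g x) * arcsSt f (insert x s) ls ω := by
  induction ls generalizing ω with
  | nil => simp [pts, below, covers, lowerOp]
  | cons i ls ih =>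
    have hnd := h.nodup
    rw [innerFirst_cons] at h
    obtain ⟨hi, hA, hls⟩ := h
    have hils : i ∉ ls := (List.nodup_cons.1 hnd).1
    have hnA : ∀ p, i ≤ p → p ≤ f i → p ∉ pts f ls := fun p h1 h2 hp => by
      have := hA p hp; unfold OffArc at this; omega
    have hni := hnA i le_rfl hi.le
    have hnj := hnA (f i) hi.le le_rfl
    have hvi := arcsSt_indep (s := s) hni
    have hvj := arcsSt_indep (s := s) hnj
    have hIH : lowerOp (below (pts f ls) g) (arcsSt f s ls) = fun ω => ∑ x ∈ covers f s ls g,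
        qHalfPow (2 * coverExp f s ls g x) * arcsSt f (insert x s) ls ω := funext (ih hls)
    have hne : ∀ x ∈ covers f s ls g, x ≠ i := by
      rintro x hx rfl
      simp [covers, hils] at hx
    have hlin : arcStep f s (pts f ls) i (lowerOp (below (pts f ls) g) (arcsSt f s ls)) ω =
        ∑ x ∈ covers f s ls g, qHalfPow (2 * coverExp f s ls g x) *
          arcsSt f (insert x s) (i :: ls) ω := by
      rw [hIH, arcStep_linear]
      exact Finset.sum_congr rfl fun x hx => by rw [arcsSt_insert_cons (hne x hx)]
    rw [pts_cons]
    by_cases hcov : i < g ∧ g ≤ f i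
    -- the new arc contains the gap: if it is dotted, the weights are multiplied by `q^{-1}`, and if it
    -- is undotted, they are multiplied by `q`, and there is the new term with a dot on this arc
    · have hlt : ∀ x ∈ covers f s ls g, x < i := by
        intro x hx
        simp only [covers, Finset.mem_filter, List.mem_toFinset] at hx
        have := hA x (mem_pts.2 ⟨x, hx.1, Or.inl rfl⟩)
        unfold OffArc at this; omega
      rw [below_insert_inside hi hA hcov.1 hcov.2]
      rw [below_inside hi hA hcov.1 hcov.2] at hlin
      by_cases his : i ∈ s
      · have hcs : covers f s (i :: ls) g = covers f s ls g := by
          unfold covers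
          rw [List.toFinset_cons, Finset.filter_insert, if_neg (by simp [his])]
        have e : arcsSt f s (i :: ls) = dotSt (below (pts f ls) i) i (f i) (arcsSt f s ls) := by
          simp [arcsSt, arcStep, his]
        rw [e, lowerOp_dotSt_inside hi.ne (fun h => hni (mem_below.1 h).2)
          (fun h => hnj (mem_below.1 h).2) hvi, hcs]
        rw [arcStep, if_pos his] at hlin
        rw [hlin, Finset.mul_sum]
        refine Finset.sum_congr rfl fun x hx => ?_
        have : coverExp f s (i :: ls) g x = coverExp f s ls g x + -1 := by
          have := hlt x hx
          simp [coverExp, coverCount_cons, his, hcov, this]; ring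
        rw [this, mul_add, qHalfPow_add, ← qHalfPow_neg_two]
        ring_nf
      · have hcs : covers f s (i :: ls) g = insert i (covers f s ls g) := by
          unfold covers
          rw [List.toFinset_cons, Finset.filter_insert, if_pos ⟨his, hcov.1, hcov.2⟩]
        have hi' : i ∉ covers f s ls g := fun h => hne i h rfl
        have e : arcsSt f s (i :: ls) = cupSt i (f i) (arcsSt f s ls) := by
          simp [arcsSt, arcStep, his]
        rw [e, lowerOp_cupSt_inside hi.ne (fun h => hni (mem_below.1 h).2)
          (fun h => hnj (mem_below.1 h).2) hvi, hcs, Finset.sum_insert hi']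
        rw [arcStep, if_neg his] at hlin
        rw [hlin, Finset.mul_sum]
        congr 1
        · have h0 : ∀ b, coverCount f s (i :: ls) g i b = 0 := by
            intro b
            rw [coverCount_cons, if_neg (by omega), add_zero, coverCount, List.length_eq_zero_iff,
              List.filter_eq_nil_iff]
            intro y hy
            have := hA y (mem_pts.2 ⟨y, hy, Or.inl rfl⟩)
            unfold OffArc at this
            simp; omega
          have e1 : arcsSt f (insert i s) ls = arcsSt f s ls := arcsSt_congr fun j hj =>
            ⟨rfl, by simp only [Finset.mem_insert]; exact ⟨fun h => h.resolve_left
              (by rintro rfl; exact hils hj), Or.inr⟩⟩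
          rw [coverExp, h0, h0]
          simp [arcsSt, arcStep, e1, qHalfPow_zero]
        · refine Finset.sum_congr rfl fun x hx => ?_
          have : coverExp f s (i :: ls) g x = coverExp f s ls g x + 1 := by
            have := hlt x hx
            simp [coverExp, coverCount_cons, his, hcov, this]; ring
          rw [this, mul_add, qHalfPow_add, mul_one, qHalfPow_two]
          ring_nf
    -- otherwise, the lowering operator commutes with adding the arc
    · have hcs : covers f s (i :: ls) g = covers f s ls g := by
        unfold covers
        rw [List.toFinset_cons, Finset.filter_insert, if_neg (by tauto)]
      have hce : ∀ x, coverExp f s (i :: ls) g x = coverExp f s ls g x := by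
        intro x
        simp only [coverExp, coverCount_cons]
        rw [if_neg (by tauto), if_neg (by tauto), add_zero, add_zero]
      simp only [hcs, hce]
      rw [← hlin]
      rcases Nat.lt_or_ge i g with hig | hig
      · have hg : f i < g := by omega
        have hL : ∀ r, i ≤ r → r ≤ f i → r ∉ below (pts f ls) i ++ between (pts f ls) (f i) g := by
          intro r h1 h2 hr
          rcases List.mem_append.1 hr with hr | hr
          · exact hnA r h1 h2 (mem_below.1 hr).2
          · exact hnA r h1 h2 (mem_between.1 hr).2
        rw [below_insert_of_lt hi hA hg, below_of_lt hi hA hg]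
        simp only [arcsSt, arcStep]
        split_ifs
        · exact lowerOp_dotSt hi.ne (hL _ le_rfl hi.le) (hL _ hi.le le_rfl) (fun p hp hp' => by
            have := (mem_below.1 hp).1; have := (mem_between.1 hp').1; omega) hvi ω
        · exact lowerOp_cupSt hi.ne (hL _ le_rfl hi.le) (hL _ hi.le le_rfl) hvi hvj ω
      · rw [below_insert_of_le hi hA hig]
        have h1 : i ∉ below (pts f ls) g := fun h => hni (mem_below.1 h).2
        have h2 : f i ∉ below (pts f ls) g := fun h => hnj (mem_below.1 h).2
        simp only [arcsSt, arcStep]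
        split_ifs
        · refine lowerOp_dotSt_of_notMem h1 h2 _ _ ?_
          rw [below_split hig]
          refine lowerOp_comm_append (fun p hp hp' => ?_) _ _
          have := (mem_below.1 hp).1
          simp at hp'; omega
        · exact lowerOp_cupSt_of_notMem h1 h2 _ _

end Skein


namespace Skein

/-! ### The quantum relations in coordinates -/

/-- The Type I relation for four neighbouring points, in coordinates: the correction terms are
represented by the lowering operator at the gap to the left of `a`. -/
theorem typeI_local {L : List ℕ} {a b c d : ℕ} (hab : a < b) (hbc : b < c) (hcd : c < d)
    (hL : ∀ p ∈ L, p < a) {v : St} (ha : IndepAt v a) (ω : ℕ → Bool) :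
    dotSt (L ++ [a]) b c (cupSt a d v) ω =
      dotSt L a b (cupSt c d v) ω + cupSt a b (dotSt L c d v) ω +
        hqi ^ 2 * cupSt b c (dotSt L a d v) ω +
        (1 - hqi ^ 4) * (hq ^ 2 * cupSt a b (cupSt c d (lowerOp L v)) ω) := by
  have hn : ∀ p, a ≤ p → p ∉ L := fun p h hp => by have := hL p hp; omega
  have e1 := lowerOp_cupSt_inside (L := L) (show a ≠ d by omega) (hn _ le_rfl)
    (hn d (by omega)) ha ω
  have e2 := lowerOp_cupSt_of_notMem (hn c (by omega)) (hn d (by omega)) v ω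
  have ht := hq_mul_hqi
  simp only [dotSt] at e1 ⊢
  rw [e1, e2]
  simp only [cupSt, dotSt, cDot]
  generalize lowerOp L v ω = E
  generalize v ω = V
  rcases ω a <;> rcases ω b <;> rcases ω c <;> rcases ω d <;> simp [cupW] <;> grind

/-- The Type II relation for four neighbouring points, in coordinates: the correction terms are
represented by the lowering operator at the gap to the left of `a`. -/
theorem typeII_local {L : List ℕ} {a b c d : ℕ} (hab : a < b) (hbc : b < c) (hcd : c < d)
    (hL : ∀ p ∈ L, p < a) {v : St} (ha : IndepAt v a) (ω : ℕ → Bool) :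
    dotSt L a b (dotSt L c d v) ω =
      dotSt (L ++ [a]) b c (dotSt L a d v) ω +
        (1 - hqi ^ 4) * cupSt b c (dotSt L a d (lowerOp L v)) ω := by
  have hn : ∀ p, a ≤ p → p ∉ L := fun p h hp => by have := hL p hp; omega
  have e1 := lowerOp_dotSt_inside (L := L) (show a ≠ d by omega) (hn _ le_rfl)
    (hn d (by omega)) ha ω
  have e2 := lowerOp_dotSt_of_notMem (L₀ := L) (hn c (by omega)) (hn d (by omega)) v ω rfl
  have ht := hq_mul_hqi
  simp only [dotSt] at e1 e2 ⊢
  rw [e1, e2]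
  simp only [cupSt, dotSt, cDot]
  generalize lowerOp L (lowerOp L v) ω = E'
  generalize lowerOp L v ω = E
  generalize v ω = V
  rcases ω a <;> rcases ω b <;> rcases ω c <;> rcases ω d <;> simp [cupW] <;> grind

/-- The data of a surgery: the partner functions `f` and `g` of two matchings that differ by the arcs
`(a, b)`, `(c, d)` and `(a, d)`, `(b, c)`, the left endpoints `I` of the other arcs between `a` and
`d`, and the left endpoints `O` of the remaining arcs. -/
structure ListMove (f g : ℕ → ℕ) (a b c d : ℕ) (I O : List ℕ) : Prop where
  lt_ab : a < b
  lt_bc : b < c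
  lt_cd : c < d
  f_a : f a = b
  f_c : f c = d
  g_a : g a = d
  g_b : g b = c
  eq_inner : ∀ i ∈ I, f i = g i
  eq_outer : ∀ i ∈ O, f i = g i
  inner_f : InnerFirst f (I ++ a :: c :: O)
  inner_g : InnerFirst g (I ++ b :: a :: O)

namespace ListMove

variable {f g : ℕ → ℕ} {a b c d : ℕ} {I O : List ℕ}

theorem tail {i : ℕ} (h : ListMove f g a b c d (i :: I) O) : ListMove f g a b c d I O :=
  { h with
    eq_inner := fun j hj => h.eq_inner j (by simp [hj])
    inner_f := h.inner_f.sublist (by simp)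
    inner_g := h.inner_g.sublist (by simp) }

theorem pts_eq (h : ListMove f g a b c d I O) :
    pts f (I ++ a :: c :: O) = pts g (I ++ b :: a :: O) := by
  have h1 := h.eq_inner
  have h2 := h.eq_outer
  have e1 := h.f_a
  have e2 := h.f_c
  have e3 := h.g_a
  have e4 := h.g_b
  ext p
  simp only [mem_pts, List.mem_append, List.mem_cons]
  constructor
  · rintro ⟨i, (hi | rfl | rfl | hi), hp⟩
    · exact ⟨i, Or.inl hi, by rwa [← h1 i hi]⟩
    · rcases hp with rfl | rfl
      exacts [⟨p, by simp, by simp⟩, ⟨b, by simp, by simp [e1]⟩]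
    · rcases hp with rfl | rfl
      exacts [⟨b, by simp, by simp [e4]⟩, ⟨a, by simp, by simp [e2, e3]⟩]
    · exact ⟨i, by simp [hi], by rwa [← h2 i hi]⟩
  · rintro ⟨i, (hi | rfl | rfl | hi), hp⟩
    · exact ⟨i, Or.inl hi, by rwa [h1 i hi]⟩
    · rcases hp with rfl | rfl
      exacts [⟨a, by simp, by simp [e1]⟩, ⟨c, by simp, by simp [e4]⟩]
    · rcases hp with rfl | rfl
      exacts [⟨p, by simp, by simp⟩, ⟨c, by simp, by simp [e2, e3]⟩]
    · exact ⟨i, by simp [hi], by rwa [h2 i hi]⟩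

theorem notMem_outer (h : ListMove f g a b c d I O) (p : ℕ) (h1 : a ≤ p) (h2 : p ≤ d) :
    p ∉ pts f O := by
  have hi := h.inner_g.sublist (ls' := a :: O)
    ((List.sublist_cons_self _ _).trans (List.sublist_append_right _ _))
  have := (innerFirst_cons.1 hi).2.1 p
  rw [← pts_congr h.eq_outer] at this
  intro hp
  have := this hp
  rw [OffArc, h.g_a] at this
  omega

theorem below_outer (h : ListMove f g a b c d I O) (p : ℕ) (h1 : a ≤ p) (h2 : p ≤ d) :
    below (pts f O) p = below (pts f O) a := by
  rw [below_split h1, List.filter_eq_nil_iff.2, List.append_nil]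
  intro r hr
  simp only [List.mem_range'_1] at hr
  simpa using h.notMem_outer r (by omega) (by omega)

theorem lt_of_mem_inner (h : ListMove f g a b c d I O) {i : ℕ} (hi : i ∈ I) :
    i ≠ a ∧ i ≠ b ∧ i ≠ c ∧ i ∉ O := by
  have h1 := List.nodup_append.1 h.inner_f.nodup
  have h2 := List.nodup_append.1 h.inner_g.nodup
  refine ⟨h1.2.2 i hi a (by simp), h2.2.2 i hi b (by simp), h1.2.2 i hi c (by simp), fun hO => ?_⟩
  exact h1.2.2 i hi i (by simp [hO]) rfl

/-- The Type I relation in coordinates. The arcs inside of the four points are added last, and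
adding them is linear, so that they may be disregarded. -/
theorem typeI (h : ListMove f g a b c d I O) {s : Finset ℕ} (ha : a ∉ s) (hb : b ∉ s) (hc : c ∉ s)
    (ω : ℕ → Bool) :
    arcsSt g (insert b s) (I ++ b :: a :: O) ω =
      arcsSt f (insert a s) (I ++ a :: c :: O) ω + arcsSt f (insert c s) (I ++ a :: c :: O) ω +
        hqi ^ 2 * arcsSt g (insert a s) (I ++ b :: a :: O) ω +
        (1 - hqi ^ 4) * ∑ x ∈ covers f s O a, qHalfPow (2 * (coverExp f s O a x + 1)) *
          arcsSt f (insert x s) (I ++ a :: c :: O) ω := by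
  induction I generalizing ω with
  | nil =>
    have hO : ∀ y ∈ O, y < a ∨ d < y := fun y hy => by
      by_contra hlt
      exact h.notMem_outer y (by omega) (by omega) (mem_pts.2 ⟨y, hy, Or.inl rfl⟩)
    have l1 := h.lt_ab
    have l2 := h.lt_bc
    have l3 := h.lt_cd
    have hOs : ∀ y ∈ O, y ≠ a ∧ y ≠ b ∧ y ≠ c := fun y hy => by have := hO y hy; omega
    have key := typeI_local h.lt_ab h.lt_bc h.lt_cd (L := below (pts f O) a)
      (fun p hp => (mem_below.1 hp).1) (v := arcsSt f s O)
      (arcsSt_indep (h.notMem_outer a le_rfl (by omega))) ω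
    have hinO : InnerFirst f O := h.inner_f.sublist (by simp)
    have hG : lowerOp (below (pts f O) a) (arcsSt f s O) = fun ω => ∑ x ∈ covers f s O a,
        qHalfPow (2 * coverExp f s O a x) * arcsSt f (insert x s) O ω :=
      funext (lowerOp_arcsSt hinO a)
    have eO : ∀ {t} {u} (_ : t = f ∨ t = g) (_ : u = a ∨ u = b ∨ u = c),
        arcsSt t (insert u s) O = arcsSt f s O := by
      intro t u ht hu
      refine arcsSt_congr fun y hy => ⟨?_, ?_⟩
      · rcases ht with rfl | rfl
        exacts [rfl, (h.eq_outer y hy).symm]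
      · have := hOs y hy
        simp only [Finset.mem_insert]
        exact ⟨fun h => h.resolve_left (by rcases hu with rfl | rfl | rfl <;> tauto), Or.inr⟩
    have eP : pts g O = pts f O := pts_congr fun y hy => (h.eq_outer y hy).symm
    have hbel : below (insert a (insert d (pts f O))) b = below (pts f O) a ++ [a] :=
      below_insert_inside (A := pts f O) (by omega) (fun p hp => by
        by_contra hlt
        exact h.notMem_outer p (by omega) (by omega) hp) (by omega) (by omega)
    have hbela : below (insert c (insert d (pts f O))) a = below (pts f O) a :=
      below_congr fun p hp => mem_insert_insert_iff (by omega) (by omega)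
    have hbelc := h.below_outer c (by omega) (by omega)
    have t1 : arcsSt g (insert b s) (b :: a :: O) =
        dotSt (below (pts f O) a ++ [a]) b c (cupSt a d (arcsSt f s O)) := by
      simp [arcsSt, arcStep, h.g_a, h.g_b, pts_cons, eP, hbel, eO, l1.ne, ha]
    have t2 : arcsSt f (insert a s) (a :: c :: O) =
        dotSt (below (pts f O) a) a b (cupSt c d (arcsSt f s O)) := by
      simp [arcsSt, arcStep, h.f_a, h.f_c, pts_cons, eO, hc, hbela, (l1.trans l2).ne']
    have t3 : arcsSt f (insert c s) (a :: c :: O) =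
        cupSt a b (dotSt (below (pts f O) a) c d (arcsSt f s O)) := by
      simp [arcsSt, arcStep, h.f_a, h.f_c, eO, hbelc, (l1.trans l2).ne, ha]
    have t4 : arcsSt g (insert a s) (b :: a :: O) =
        cupSt b c (dotSt (below (pts f O) a) a d (arcsSt f s O)) := by
      simp [arcsSt, arcStep, h.g_a, h.g_b, eP, eO, l1.ne', hb]
    have t5 : ∀ x ∈ covers f s O a, arcsSt f (insert x s) (a :: c :: O) =
        cupSt a b (cupSt c d (arcsSt f (insert x s) O)) := by
      intro x hx
      have hx' := hOs x (by simp [covers] at hx; exact hx.1)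
      simp [arcsSt, arcStep, h.f_a, h.f_c, ha, hc, hx'.1.symm, hx'.2.2.symm]
    simp only [List.nil_append]
    rw [t1, t2, t3, t4, key, hG]
    congr 2
    simp only [cupSt, Finset.mul_sum]
    refine Finset.sum_congr rfl fun x hx => ?_
    rw [t5 x hx, mul_add, qHalfPow_add, mul_one, qHalfPow_two]
    simp only [cupSt]
    ring
  | cons i I ih =>
    have hI := h.tail
    obtain ⟨n1, n2, n3, n4⟩ := h.lt_of_mem_inner (i := i) (by simp)
    have hfg := h.eq_inner i (by simp)
    have hstep : ∀ t u, (t = f ∨ t = g) → u ≠ i → ∀ ls, pts t ls = pts f (I ++ a :: c :: O) →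
        arcsSt t (insert u s) (i :: ls) = arcStep f s (pts f (I ++ a :: c :: O)) i
          (arcsSt t (insert u s) ls) := by
      intro t u ht hu ls hls
      rw [arcsSt_insert_cons hu, hls]
      refine arcStep_congr ?_ Iff.rfl _
      rcases ht with rfl | rfl
      exacts [rfl, hfg.symm]
    simp only [List.cons_append]
    rw [hstep g b (by simp) n2.symm _ hI.pts_eq.symm, hstep f a (by simp) n1.symm _ rfl,
      hstep f c (by simp) n3.symm _ rfl, hstep g a (by simp) n1.symm _ hI.pts_eq.symm,
      funext (ih hI), arcStep_add, arcStep_add, arcStep_add, arcStep_smul, arcStep_smul,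
      arcStep_linear]
    congr 2
    refine Finset.sum_congr rfl fun x hx => ?_
    rw [hstep f x (by simp) (by rintro rfl; simp [covers] at hx; exact n4 hx.1) _ rfl]

/-- The Type II relation in coordinates, which reduces to four neighbouring points like the Type I
relation. -/
theorem typeII (h : ListMove f g a b c d I O) {s : Finset ℕ} (hb : b ∉ s) (ω : ℕ → Bool) :
    arcsSt f (insert a (insert c s)) (I ++ a :: c :: O) ω =
      arcsSt g (insert a (insert b s)) (I ++ b :: a :: O) ω +
        (1 - hqi ^ 4) * ∑ x ∈ covers f s O a, qHalfPow (2 * coverExp f s O a x) *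
          arcsSt g (insert x (insert a s)) (I ++ b :: a :: O) ω := by
  induction I generalizing ω with
  | nil =>
    have hO : ∀ y ∈ O, y < a ∨ d < y := fun y hy => by
      by_contra hlt
      exact h.notMem_outer y (by omega) (by omega) (mem_pts.2 ⟨y, hy, Or.inl rfl⟩)
    have l1 := h.lt_ab
    have l2 := h.lt_bc
    have l3 := h.lt_cd
    have hOs : ∀ y ∈ O, y ≠ a ∧ y ≠ b ∧ y ≠ c := fun y hy => by have := hO y hy; omega
    have key := typeII_local h.lt_ab h.lt_bc h.lt_cd (L := below (pts f O) a)
      (fun p hp => (mem_below.1 hp).1) (v := arcsSt f s O)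
      (arcsSt_indep (h.notMem_outer a le_rfl (by omega))) ω
    have hinO : InnerFirst f O := h.inner_f.sublist (by simp)
    have hG : lowerOp (below (pts f O) a) (arcsSt f s O) = fun ω => ∑ x ∈ covers f s O a,
        qHalfPow (2 * coverExp f s O a x) * arcsSt f (insert x s) O ω :=
      funext (lowerOp_arcsSt hinO a)
    have eO : ∀ {t} {S S' : Finset ℕ} (_ : t = f ∨ t = g)
        (_ : ∀ y, y ≠ a ∧ y ≠ b ∧ y ≠ c → (y ∈ S ↔ y ∈ S')),
        arcsSt t S O = arcsSt f S' O := by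
      intro t S S' ht hu
      refine arcsSt_congr fun y hy => ⟨?_, hu y (hOs y hy)⟩
      rcases ht with rfl | rfl
      exacts [rfl, (h.eq_outer y hy).symm]
    have eP : pts g O = pts f O := pts_congr fun y hy => (h.eq_outer y hy).symm
    have hbel : below (insert a (insert d (pts f O))) b = below (pts f O) a ++ [a] :=
      below_insert_inside (A := pts f O) (by omega) (fun p hp => by
        by_contra hlt
        exact h.notMem_outer p (by omega) (by omega) hp) (by omega) (by omega)
    have hbela : below (insert c (insert d (pts f O))) a = below (pts f O) a :=
      below_congr fun p hp => mem_insert_insert_iff (by omega) (by omega)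
    have hbelc := h.below_outer c (by omega) (by omega)
    have t1 : arcsSt f (insert a (insert c s)) (a :: c :: O) =
        dotSt (below (pts f O) a) a b (dotSt (below (pts f O) a) c d (arcsSt f s O)) := by
      have := eO (t := f) (S := insert a (insert c s)) (S' := s) (Or.inl rfl)
        (fun y hy => by simp [hy])
      simp [arcsSt, arcStep, h.f_a, h.f_c, pts_cons, this, hbela, hbelc]
    have t2 : arcsSt g (insert a (insert b s)) (b :: a :: O) =
        dotSt (below (pts f O) a ++ [a]) b c (dotSt (below (pts f O) a) a d (arcsSt f s O)) := by
      have := eO (t := g) (S := insert a (insert b s)) (S' := s) (Or.inr rfl)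
        (fun y hy => by simp [hy])
      simp [arcsSt, arcStep, h.g_a, h.g_b, pts_cons, eP, hbel, this]
    have t3 : ∀ x ∈ covers f s O a, arcsSt g (insert x (insert a s)) (b :: a :: O) =
        cupSt b c (dotSt (below (pts f O) a) a d (arcsSt f (insert x s) O)) := by
      intro x hx
      have hx' := hOs x (by simp [covers] at hx; exact hx.1)
      have := eO (t := g) (S := insert x (insert a s)) (S' := insert x s) (Or.inr rfl)
        (fun y hy => by simp [hy])
      simp [arcsSt, arcStep, h.g_a, h.g_b, eP, this, hb, l1.ne', hx'.2.1.symm]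
    have hD : ∀ ω, dotSt (below (pts f O) a) a d (fun ω => ∑ x ∈ covers f s O a,
        qHalfPow (2 * coverExp f s O a x) * arcsSt f (insert x s) O ω) ω =
        ∑ x ∈ covers f s O a, qHalfPow (2 * coverExp f s O a x) *
          dotSt (below (pts f O) a) a d (arcsSt f (insert x s) O) ω := by
      intro ω
      have := arcStep_linear (fun _ => d) {a} (pts f O) a (covers f s O a)
        (fun x => qHalfPow (2 * coverExp f s O a x)) (fun x => arcsSt f (insert x s) O) ω
      simpa [arcStep] using this
    simp only [List.nil_append]
    rw [t1, t2, key, hG]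
    congr 2
    simp only [cupSt, hD, Finset.mul_sum]
    refine Finset.sum_congr rfl fun x hx => ?_
    rw [t3 x hx]
    simp only [cupSt]
    ring
  | cons i I ih =>
    have hI := h.tail
    obtain ⟨n1, n2, n3, n4⟩ := h.lt_of_mem_inner (i := i) (by simp)
    have hfg := h.eq_inner i (by simp)
    have hstep : ∀ t S, (t = f ∨ t = g) → (i ∈ S ↔ i ∈ s) → ∀ ls,
        pts t ls = pts f (I ++ a :: c :: O) →
        arcsSt t S (i :: ls) = arcStep f s (pts f (I ++ a :: c :: O)) i (arcsSt t S ls) := by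
      intro t S ht hS ls hls
      simp only [arcsSt]
      rw [hls]
      refine arcStep_congr ?_ hS _
      rcases ht with rfl | rfl
      exacts [rfl, hfg.symm]
    simp only [List.cons_append]
    rw [hstep f _ (by simp) (by simp [n1, n3]) _ rfl,
      hstep g _ (by simp) (by simp [n1, n2]) _ hI.pts_eq.symm,
      funext (ih hI), arcStep_add, arcStep_smul, arcStep_linear]
    congr 2
    refine Finset.sum_congr rfl fun x hx => ?_
    rw [hstep g _ (by simp) _ _ hI.pts_eq.symm]
    have : i ≠ x := by rintro rfl; simp [covers] at hx; exact n4 hx.1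
    simp [n1, this]

end ListMove

end Skein


namespace Skein

/-! ### Lowering operators and arcs with crossings -/

theorem crossSt_eq (m p : ℕ) (w : St) (ω : ℕ → Bool) : crossSt m p w ω =
    (if ω p = ω m then hq else hqi) * w ω + (if ω p = true ∧ ω m = false then hq - hqi ^ 3 else 0) *
      w (Function.update (Function.update ω m true) p false) := by
  unfold crossSt
  rcases ω p <;> rcases ω m <;> simp

theorem lowerOp_crossSt_of_notMem {L : List ℕ} {m p : ℕ} (hm : m ∉ L) (hp : p ∉ L) (w : St)
    (ω : ℕ → Bool) : lowerOp L (crossSt m p w) ω = crossSt m p (lowerOp L w) ω := by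
  have e : crossSt m p w = fun ω => (fun ω => (if ω p = ω m then hq else hqi)) ω * w ω +
      (fun ω => (if ω p = true ∧ ω m = false then hq - hqi ^ 3 else 0)) ω *
      (fun ω => w (Function.update (Function.update ω m true) p false)) ω :=
    funext (crossSt_eq m p w)
  have hn : ∀ r ∈ L, ∀ (ω : ℕ → Bool) b,
      Function.update ω r b p = ω p ∧ Function.update ω r b m = ω m := by
    intro r hr ω b
    exact ⟨Function.update_of_ne (by rintro rfl; exact hp hr) _ _,
      Function.update_of_ne (by rintro rfl; exact hm hr) _ _⟩
  rw [e, lowerOp_add, lowerOp_mul, lowerOp_mul, crossSt_eq, lowerOp_update hp, lowerOp_update hm]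
  · intro r hr ω b; simp only [(hn r hr ω b).1, (hn r hr ω b).2]
  · intro r hr ω b; simp only [(hn r hr ω b).1, (hn r hr ω b).2]

/-- Lowering operators commute with crossings. -/
theorem lowerOp_crossSt {L L' : List ℕ} {m p : ℕ} (hmp : m ≠ p) (hm : m ∉ L ++ L')
    (hp : p ∉ L ++ L') (w : St) (ω : ℕ → Bool) :
    lowerOp (L ++ p :: m :: L') (crossSt m p w) ω =
      crossSt m p (lowerOp (L ++ m :: p :: L') w) ω := by
  simp only [List.mem_append, not_or] at hm hp
  have hk : kProd L' (Function.update (Function.update ω m true) p false) = kProd L' ω := by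
    rw [kProd_indep hp.2, kProd_indep hm.2]
  rw [show L ++ p :: m :: L' = (L ++ [p, m]) ++ L' by simp,
    show L ++ m :: p :: L' = (L ++ [m, p]) ++ L' by simp, lowerOp_append, lowerOp_append,
    lowerOp_crossSt_of_notMem hm.1 hp.1, lowerOp_crossSt_of_notMem hm.2 hp.2, lowerOp_pair]
  have ht := hq_mul_hqi
  have u1 : Function.update (Function.update (Function.update ω m true) p false) p true =
      Function.update (Function.update ω m true) p true := by simp
  have u2 : Function.update (Function.update ω m true) p true =
      Function.update (Function.update ω p true) m true := Function.update_comm hmp _ _ _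
  have u3 : Function.update (Function.update (Function.update ω p true) m true) p false =
      Function.update (Function.update ω m true) p false := by
    rw [Function.update_comm hmp.symm]; simp
  simp only [crossSt_eq, lowerOp_append, lowerOp_pair, hk, kProd_cons, kProd_nil,
    Function.update_self, Function.update_of_ne hmp, Function.update_of_ne hmp.symm]
  rcases hωp : ω p <;> rcases hωm : ω m
  · simp [kWt, u2]
    have u4 : Function.update (Function.update ω m true) p false = Function.update ω m true := by
      rw [Function.update_eq_self_iff]; simp [Function.update_of_ne hmp.symm, hωp]
    grind
  · simp [kWt]; grind
  · have u5 : Function.update ω p true = ω := by rw [Function.update_eq_self_iff, hωp]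
    have u6 := u2
    rw [u5] at u6
    simp [kWt, u6]; grind
  · simp [kWt]; grind

/-- Lowering operators commute with adding an arc that passes above other strands. -/
theorem arcSt_lowerOp {A B ms : List ℕ} {u m : ℕ} (hnd : (A ++ u :: (ms ++ m :: B)).Nodup) {v : St}
    (hu : IndepAt v u) (hm : IndepAt v m) :
    arcSt u m ms (lowerOp (A ++ (ms ++ B)) v) = lowerOp (A ++ u :: (ms ++ m :: B)) (arcSt u m ms v) := by
  induction ms using List.reverseRecOn generalizing B with
  | nil =>
    funext ω
    have h1 : u ≠ m := by rintro rfl; simp [List.nodup_append] at hnd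
    have hnd' := (List.perm_middle.nodup_iff.1 hnd)
    have hnd2 := (List.nodup_cons.1 hnd').2
    have hnd3 := (List.perm_middle.nodup_iff.1 hnd2)
    simp only [List.nodup_cons, List.nil_append] at hnd' hnd3
    rw [arcSt_nil, arcSt_nil, List.nil_append, List.nil_append, lowerOp_cupSt h1 _ hnd3.1 hu hm]
    intro h
    exact hnd'.1 (by simp only [List.mem_append, List.mem_cons] at h ⊢; tauto)
  | append_singleton ms p ih =>
    have e1 : A ++ (ms ++ [p] ++ B) = A ++ (ms ++ (p :: B)) := by simp
    have e2 : A ++ u :: (ms ++ [p] ++ m :: B) = (A ++ u :: ms) ++ p :: m :: B := by simp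
    have e3 : A ++ u :: (ms ++ m :: p :: B) = (A ++ u :: ms) ++ m :: p :: B := by simp
    rw [e2] at hnd
    have hperm : ((A ++ u :: ms) ++ p :: m :: B).Perm ((A ++ u :: ms) ++ m :: p :: B) :=
      List.Perm.append_left _ (List.Perm.swap _ _ _)
    have h1 := List.perm_middle.nodup_iff.1 hnd
    have h2 := List.perm_middle.nodup_iff.1 (hperm.nodup_iff.1 hnd)
    rw [List.nodup_cons] at h1 h2
    rw [e1, e2, arcSt_concat, arcSt_concat, ih (by rw [e3]; exact hperm.nodup_iff.1 hnd), e3]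
    funext ω
    refine (lowerOp_crossSt ?_ ?_ ?_ _ ω).symm
    · rintro rfl; exact h1.1 (by simp)
    · exact fun h => h2.1 (by simp only [List.mem_append, List.mem_cons] at h ⊢; tauto)
    · exact fun h => h1.1 (by simp only [List.mem_append, List.mem_cons] at h ⊢; tauto)

theorem crossSt_mul {m p : ℕ} {h v : St} (hm : IndepAt h m) (hp : IndepAt h p) :
    crossSt m p (fun ω => h ω * v ω) = fun ω => h ω * crossSt m p v ω := by
  funext ω
  have : h (Function.update (Function.update ω m true) p false) = h ω := by rw [hp, hm]
  rw [crossSt_eq, crossSt_eq, this]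
  ring

theorem arcSt_mul {u m : ℕ} {ms : List ℕ} {h v : St} (hm : IndepAt h m)
    (hms : ∀ p ∈ ms, IndepAt h p) :
    arcSt u m ms (fun ω => h ω * v ω) = fun ω => h ω * arcSt u m ms v ω := by
  induction ms using List.reverseRecOn with
  | nil => funext ω; simp only [arcSt_nil, cupSt]; ring
  | append_singleton ms p ih =>
    rw [arcSt_concat, arcSt_concat, ih fun r hr => hms r (by simp [hr]),
      crossSt_mul hm (hms p (by simp))]

theorem crossSt_add (m p : ℕ) (v w : St) :
    crossSt m p (fun ω => v ω + w ω) = fun ω => crossSt m p v ω + crossSt m p w ω := by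
  funext ω; simp only [crossSt_eq]; ring

theorem arcSt_add (u m : ℕ) (ms : List ℕ) (v w : St) :
    arcSt u m ms (fun ω => v ω + w ω) = fun ω => arcSt u m ms v ω + arcSt u m ms w ω := by
  induction ms using List.reverseRecOn with
  | nil => funext ω; simp only [arcSt_nil, cupSt]; ring
  | append_singleton ms p ih => rw [arcSt_concat, arcSt_concat, arcSt_concat, ih, crossSt_add]

theorem crossSt_indep {m p r : ℕ} {v : St} (hv : IndepAt v r) (hm : r ≠ m) (hp : r ≠ p) :
    IndepAt (crossSt m p v) r := by
  intro ω b
  rw [crossSt_eq, crossSt_eq, Function.update_of_ne hm.symm, Function.update_of_ne hp.symm,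
    Function.update_comm hm, Function.update_comm hp, hv, hv]

theorem arcSt_indep {u m r : ℕ} {ms : List ℕ} {v : St} (hv : IndepAt v r) (hu : r ≠ u)
    (hm : r ≠ m) (hms : r ∉ ms) : IndepAt (arcSt u m ms v) r := by
  induction ms using List.reverseRecOn with
  | nil => exact cupSt_indep hv hu hm
  | append_singleton ms p ih =>
    simp only [List.mem_append, List.mem_singleton, not_or] at hms
    rw [arcSt_concat]
    exact crossSt_indep (ih hms.1) hm hms.2

/-- `q^{1/2}` for `true` and `q^{-1/2}` for `false`. -/
noncomputable def hWt (b : Bool) : HalfLaurent := if b then hq else hqi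

/-- If the right end of an arc carries the sign `true`, then all strands below the arc keep
their signs. -/
theorem arcSt_of_right_true {u m : ℕ} {ms : List ℕ} (hm : m ∉ ms) (v : St) {ω : ℕ → Bool}
    (hω : ω m = true) :
    arcSt u m ms v ω =
      if ω u then 0 else -hq ^ 2 * (ms.map fun r => hWt (ω r)).prod * v ω := by
  induction ms using List.reverseRecOn with
  | nil => rw [arcSt_nil, cupSt, hω]; rcases ω u <;> simp [cupW]
  | append_singleton ms p ih =>
    simp only [List.mem_append, List.mem_singleton, not_or] at hm
    rw [arcSt_concat, crossSt_eq, ih hm.1, hω]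
    simp only [List.map_append, List.map_cons, List.map_nil, List.prod_append, List.prod_singleton]
    rcases ω u <;> rcases ω p <;> simp [hWt] <;> ring

/-! ### The drawing of an expanded diagram, without the projectors -/

/-- A family of non-crossing arcs `(i, f i)` with left endpoints `i ∈ T` and all endpoints smaller
than `B`. -/
structure ArcSystem (f : ℕ → ℕ) (B : ℕ) (T : Finset ℕ) : Prop where
  invol : ∀ r, f (f r) = r
  lt : ∀ i ∈ T, i < f i
  lt_bound : ∀ i ∈ T, f i < B
  noncrossing : ∀ i ∈ T, ∀ j ∈ T, ¬ (i < j ∧ j < f i ∧ f i < f j)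

/-- The points of `s` between the ends of the arc of `P`. -/
def dotsIn (f : ℕ → ℕ) (s : Finset ℕ) (P : ℕ) : List ℕ :=
  (List.range' (P + 1) (f P - P - 1)).filter fun r => r ∈ s

/-- The points to the right of `P` at which strands end when the strand from `P` to the right
projector is added. -/
def rightOf (f : ℕ → ℕ) (B : ℕ) (U s : Finset ℕ) (P : ℕ) : Finset ℕ :=
  (Finset.Ioo P B).filter fun r => r ∈ s ∨ (f r ∈ U ∧ f r < P)

/-- The coordinates of a partial drawing of an expanded diagram whose undotted arcs start at the
points of `U`, and whose dotted arcs start at the points of `s`, with sign `true` at all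
points of the projectors: all strands to the left projector have been drawn, and those other strands
whose left ends are smaller than the given number. -/
noncomputable def stage (f : ℕ → ℕ) (B : ℕ) (U s : Finset ℕ) : ℕ → St
  | 0 => fun ω => if ∀ l ∈ s, ω l = false then 1 else 0
  | P + 1 =>
    if P ∈ U then arcSt P (f P) (dotsIn f s P) (stage f B U s P)
    else if f P ∈ s then fun ω =>
      (if ω P then 0 else -hq ^ 2 * ∏ r ∈ rightOf f B U s P, hWt (ω r)) * stage f B U s P ω
    else stage f B U s P

/-- The point `p` is the end of a strand of the partial drawing. -/
def StageActive (f : ℕ → ℕ) (U s : Finset ℕ) (P p : ℕ) : Prop :=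
  p ∈ s ∨ (p ∈ U ∧ p < P) ∨ (f p ∈ U ∧ f p < P) ∨ (f p ∈ s ∧ p < P)

instance (f : ℕ → ℕ) (U s : Finset ℕ) (P p : ℕ) : Decidable (StageActive f U s P p) := by
  unfold StageActive; infer_instance

variable {f : ℕ → ℕ} {B : ℕ}

theorem prod_hWt_indep {R : Finset ℕ} {p : ℕ} (hp : p ∉ R) (g : Bool → HalfLaurent) :
    IndepAt (fun ω => ∏ r ∈ R, g (ω r)) p := fun ω b =>
  Finset.prod_congr rfl fun r hr => by rw [Function.update_of_ne (by rintro rfl; exact hp hr)]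

theorem stage_indep {U s : Finset ℕ} (hf : ∀ r, f (f r) = r) {P p : ℕ}
    (h : ¬ StageActive f U s P p) : IndepAt (stage f B U s P) p := by
  induction P with
  | zero =>
    intro ω b
    have : ∀ l ∈ s, Function.update ω p b l = ω l := fun l hl =>
      Function.update_of_ne (by rintro rfl; exact h (Or.inl hl)) _ _
    simp only [stage]
    congr 1
    exact propext (forall₂_congr fun l hl => by rw [this l hl])
  | succ P ih =>
    have h' : ¬ StageActive f U s P p := fun h'' => h (by
      unfold StageActive at h'' ⊢
      rcases h'' with h'' | h'' | h'' | h''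
      · exact Or.inl h''
      · exact Or.inr (Or.inl ⟨h''.1, by omega⟩)
      · exact Or.inr (Or.inr (Or.inl ⟨h''.1, by omega⟩))
      · exact Or.inr (Or.inr (Or.inr ⟨h''.1, by omega⟩)))
    unfold StageActive at h
    simp only [not_or, not_and] at h
    simp only [stage]
    split_ifs with h1 h2
    · refine arcSt_indep (ih h') ?_ ?_ ?_
      · rintro rfl; exact h.2.1 h1 (by omega)
      · rintro rfl; rw [hf] at h; exact h.2.2.1 h1 (by omega)
      · intro hp; simp [dotsIn, h.1] at hp
    · have hpP : p ≠ P := by rintro rfl; exact h.2.2.2 h2 (by omega)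
      intro ω b
      have := prod_hWt_indep (R := rightOf f B U s P) (p := p) (by
        simp only [rightOf, Finset.mem_filter, not_and, not_or, not_lt]
        exact fun _ => ⟨h.1, fun h3 => by have := h.2.2.1 h3; omega⟩) hWt ω b
      simp only at this
      simp only [this, ih h' ω b, Function.update_of_ne hpP.symm]
    · exact ih h'

end Skein


namespace Skein

variable {f : ℕ → ℕ} {B : ℕ}

theorem ArcSystem.mono {T T' : Finset ℕ} (h : ArcSystem f B T) (hT : T' ⊆ T) : ArcSystem f B T' :=
  ⟨h.invol, fun i hi => h.lt i (hT hi), fun i hi => h.lt_bound i (hT hi),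
    fun i hi j hj => h.noncrossing i (hT hi) j (hT hj)⟩

/-- The points to the left of `l` at which strands of the partial drawing end. -/
def stageList (f : ℕ → ℕ) (U s : Finset ℕ) (l P : ℕ) : List ℕ :=
  (List.range l).filter fun r => StageActive f U s P r

theorem mem_stageList {U s : Finset ℕ} {l P r : ℕ} :
    r ∈ stageList f U s l P ↔ r < l ∧ StageActive f U s P r := by
  simp [stageList]

/-- The right ends, to the right of `l`, of the undotted arcs of the partial drawing. -/
def coverEnds (f : ℕ → ℕ) (B : ℕ) (U : Finset ℕ) (l P : ℕ) : Finset ℕ :=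
  (Finset.Ioo l B).filter fun r => f r ∈ U ∧ f r < P

/-- The weight of the crossings of the strand from `l` to the left projector in the partial drawing. -/
noncomputable def strandWt (f : ℕ → ℕ) (B : ℕ) (U s : Finset ℕ) (l P : ℕ) : St := fun ω =>
  hqi ^ (s.filter fun a => f a < P).card * ∏ r ∈ coverEnds f B U l P, hWt (!ω r)

theorem strandWt_indep {U s : Finset ℕ} {l P r : ℕ} (hr : r ∉ coverEnds f B U l P) :
    IndepAt (strandWt f B U s l P) r := by
  intro ω b
  unfold strandWt
  have := prod_hWt_indep hr (fun b => hWt (!b)) ω b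
  simp only at this
  rw [this]

theorem filter_range_split {l P : ℕ} (p : ℕ → Bool) (h : P < l) :
    (List.range l).filter p = (List.range P).filter p ++
      ((List.range' P 1).filter p ++ (List.range' (P + 1) (l - P - 1)).filter p) := by
  rw [← List.filter_append, ← List.filter_append, List.range_eq_range', List.range_eq_range']
  congr 1
  have h1 := @List.range'_append_1 P 1 (l - P - 1)
  have h2 := @List.range'_append_1 0 P (1 + (l - P - 1))
  rw [zero_add] at h2
  rw [h1, h2]; congr 1; omega

theorem filter_range'_split {a n m : ℕ} (p : ℕ → Bool) (h : m < n) :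
    (List.range' a n).filter p = (List.range' a m).filter p ++
      ((List.range' (a + m) 1).filter p ++ (List.range' (a + m + 1) (n - m - 1)).filter p) := by
  rw [← List.filter_append, ← List.filter_append]
  congr 1
  have h1 := @List.range'_append_1 (a + m) 1 (n - m - 1)
  have h2 := @List.range'_append_1 a m (1 + (n - m - 1))
  rw [h1, h2]; congr 1; omega

section LastDot

variable {U s : Finset ℕ} {l : ℕ} (hA : ArcSystem f B (U ∪ insert l s)) (hlU : l ∉ U) (hls : l ∉ s)
  (hU : ∀ u ∈ U, u < l) (hs : ∀ u ∈ s, u < l) (hd : Disjoint U s)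

/-- The effect of the strand from `l` to the left projector, up to the weight `strandWt`: if `l` has
the sign `true`, then one of the strands that end at the points of `L` has changed its sign where it
crosses this strand. -/
noncomputable def strandSt (L : List ℕ) (l : ℕ) (v : St) : St := fun ω =>
  if ω l then cDot * lowerOp L v ω else v ω

theorem strandSt_eq (L : List ℕ) (l : ℕ) (v : St) : strandSt L l v = fun ω =>
    (fun ω : ℕ → Bool => if ω l then cDot else 0) ω * lowerOp L v ω +
      (fun ω : ℕ → Bool => if ω l then (0 : HalfLaurent) else 1) ω * v ω := by
  funext ω; unfold strandSt; split_ifs <;> simp_all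

theorem indepAt_of_ne (g : Bool → HalfLaurent) {l p : ℕ} (h : p ≠ l) :
    IndepAt (fun ω => g (ω l)) p := fun ω b => by
  simp only; rw [Function.update_of_ne h.symm]

theorem arcSt_strandSt {L : List ℕ} {u m : ℕ} {ms : List ℕ} (hm : m ≠ l) (hms : l ∉ ms) {h v : St}
    (hhm : IndepAt h m) (hh : ∀ p ∈ ms, IndepAt h p) (ω : ℕ → Bool) :
    arcSt u m ms (fun ω => h ω * strandSt L l v ω) ω =
      h ω * (if ω l then cDot * arcSt u m ms (lowerOp L v) ω else arcSt u m ms v ω) := by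
  have hne : ∀ p ∈ ms, p ≠ l := by rintro p hp rfl; exact hms hp
  rw [arcSt_mul hhm hh, strandSt_eq, arcSt_add, arcSt_mul, arcSt_mul]
  · split_ifs <;> simp_all
  all_goals first
    | exact indepAt_of_ne (fun b => if b then cDot else 0) hm
    | exact indepAt_of_ne (fun b => if b then 0 else 1) hm
    | exact fun p hp => indepAt_of_ne (fun b => if b then cDot else 0) (hne p hp)
    | exact fun p hp => indepAt_of_ne (fun b => if b then 0 else 1) (hne p hp)

/-- The crossing of an arc with the strand of a dotted arc removes the end of the former from the
lowering operator of the latter. -/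
theorem crossSt_strandSt {L : List ℕ} {m : ℕ} {h w : St} (hhm : IndepAt h m) (hhl : IndepAt h l)
    (hw : IndepAt w l) (ω : ℕ → Bool) :
    crossSt m l (fun ω => h ω * strandSt (L ++ [m]) l w ω) ω =
      h ω * hWt (!ω m) * strandSt L l w ω := by
  have ht := hq_mul_hqi
  rw [crossSt_mul hhm hhl]
  simp only [crossSt_eq]
  have e1 : w (Function.update (Function.update ω m true) l false) =
      w (Function.update ω m true) := hw _ _
  simp only [strandSt, lowerOp_append, lowerOp, kProd_cons, kProd_nil, Function.update_self, e1,
    cDot]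
  rcases hωl : ω l <;> rcases hωm : ω m <;> simp [hWt, kWt] <;> grind

include hA

theorem notStageActive_self {P : ℕ} (hPU : P ∈ U) (hPs : P ∉ s) : ¬ StageActive f U s P P := by
  have hPf := hA.lt P (by simp [hPU])
  rintro (h | h | h | h)
  · exact hPs h
  · omega
  · omega
  · omega

theorem notStageActive_right {P : ℕ} (hPU : P ∈ U) :
    ¬ StageActive f U s P (f P) := by
  have hPf := hA.lt P (by simp [hPU])
  rintro (h | h | h | h)
  · have := hA.lt (f P) (by simp [h]); rw [hA.invol] at this; omega
  · omega
  · rw [hA.invol] at h; omega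
  · omega

theorem stageActive_succ_of_mem {P r : ℕ} (hPU : P ∈ U) :
    StageActive f U s (P + 1) r ↔ StageActive f U s P r ∨ r = P ∨ r = f P := by
  have hinv := hA.invol
  constructor
  · rintro (h | h | h | h)
    · exact Or.inl (Or.inl h)
    · by_cases hr : r = P
      · exact Or.inr (Or.inl hr)
      · exact Or.inl (Or.inr (Or.inl ⟨h.1, by omega⟩))
    · by_cases hr : f r = P
      · exact Or.inr (Or.inr (by rw [← hr, hinv]))
      · exact Or.inl (Or.inr (Or.inr (Or.inl ⟨h.1, by omega⟩)))
    · by_cases hr : r = P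
      · exact Or.inr (Or.inl hr)
      · exact Or.inl (Or.inr (Or.inr (Or.inr ⟨h.1, by omega⟩)))
  · rintro ((h | h | h | h) | rfl | rfl)
    · exact Or.inl h
    · exact Or.inr (Or.inl ⟨h.1, by omega⟩)
    · exact Or.inr (Or.inr (Or.inl ⟨h.1, by omega⟩))
    · exact Or.inr (Or.inr (Or.inr ⟨h.1, by omega⟩))
    · exact Or.inr (Or.inl ⟨hPU, by omega⟩)
    · exact Or.inr (Or.inr (Or.inl ⟨by rwa [hinv], by rw [hinv]; omega⟩))

/-- No strands other than those of dotted arcs end inside a new arc. -/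
theorem stageActive_inside {P r : ℕ} (hPU : P ∈ U) (h1 : P < r) (h2 : r < f P) :
    StageActive f U s P r ↔ r ∈ s := by
  refine ⟨?_, Or.inl⟩
  rintro (h | h | h | h)
  · exact h
  · omega
  · exact absurd ⟨h.2, by rw [hA.invol]; exact ⟨h1, h2⟩⟩
      (hA.noncrossing (f r) (by simp [h.1]) P (by simp [hPU]))
  · omega

theorem stageList_of_lt {P : ℕ} (hPU : P ∈ U) (hPs : P ∉ s) (hlt : f P < l) :
    stageList f U s l P = (List.range P).filter (fun r => StageActive f U s P r) ++
        (dotsIn f s P ++ (List.range' (f P + 1) (l - f P - 1)).filter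
          (fun r => StageActive f U s P r)) := by
  have hPf : P < f P := hA.lt P (by simp [hPU])
  unfold stageList
  rw [filter_range_split _ (show P < l by omega),
    filter_range'_split (a := P + 1) (m := f P - P - 1) _ (by omega)]
  congr 1
  rw [List.filter_eq_nil_iff.2 (by simp; exact notStageActive_self hA hPU hPs), List.nil_append,
    show P + 1 + (f P - P - 1) = f P by omega]
  rw [(List.filter_eq_nil_iff (l := List.range' (f P) 1)).2
    (by simp; exact notStageActive_right hA hPU), List.nil_append]
  congr 1
  · refine List.filter_congr fun r hr => ?_
    simp only [List.mem_range'_1] at hr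
    rw [decide_eq_decide]
    exact stageActive_inside hA hPU (by omega) (by omega)
  · congr 2; omega

theorem stageList_succ_of_lt {P : ℕ} (hPU : P ∈ U) (hlt : f P < l) :
    stageList f U s l (P + 1) =
        (List.range P).filter (fun r => StageActive f U s P r) ++
        P :: (dotsIn f s P ++ f P :: (List.range' (f P + 1) (l - f P - 1)).filter
          (fun r => StageActive f U s P r)) := by
  have hPf : P < f P := hA.lt P (by simp [hPU])
  have hact := fun r => stageActive_succ_of_mem (r := r) hA hPU
  unfold stageList
  rw [filter_range_split _ (show P < l by omega),
    filter_range'_split (a := P + 1) (m := f P - P - 1) _ (by omega)]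
  have h1 : StageActive f U s (P + 1) P := (hact P).2 (by simp)
  have h2 : StageActive f U s (P + 1) (f P) := (hact _).2 (by simp)
  rw [show P + 1 + (f P - P - 1) = f P by omega]
  simp only [List.range'_one, List.filter_cons_of_pos, h1, h2, decide_true, List.filter_nil,
    List.cons_append, List.nil_append]
  congr 1
  · refine List.filter_congr fun r hr => ?_
    simp only [List.mem_range] at hr
    rw [decide_eq_decide, hact]
    exact ⟨fun h => h.resolve_right (by omega), Or.inl⟩
  · congr 2
    · refine List.filter_congr fun r hr => ?_
      simp only [List.mem_range'_1] at hr
      rw [decide_eq_decide, hact, ← stageActive_inside hA hPU (by omega) (by omega)]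
      exact ⟨fun h => h.resolve_right (by omega), Or.inl⟩
    · congr 1
      rw [show l - P - 1 - (f P - P - 1) - 1 = l - f P - 1 by omega]
      refine List.filter_congr fun r hr => ?_
      simp only [List.mem_range'_1] at hr
      rw [decide_eq_decide, hact]
      exact ⟨fun h => h.resolve_right (by omega), Or.inl⟩

include hlU hls hU hs hd

theorem dotsIn_of_gt {P : ℕ} (hP : P < l) (hge : l < f P) :
    dotsIn f s P = (List.range' (P + 1) (l - P - 1)).filter (fun r => r ∈ s) ∧
      dotsIn f (insert l s) P = dotsIn f s P ++ [l] := by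
  have key : dotsIn f s P = (List.range' (P + 1) (l - P - 1)).filter (fun r => r ∈ s) := by
    unfold dotsIn
    rw [filter_range'_split (a := P + 1) (m := l - P - 1) _ (by omega)]
    rw [show P + 1 + (l - P - 1) = l by omega]
    rw [(List.filter_eq_nil_iff (l := List.range' (l + 1) _)).2 (by
        intro r hr; simp only [List.mem_range'_1] at hr
        simp only [decide_eq_true_eq]
        intro h
        have := hs r h; omega)]
    simp only [List.range'_one, List.append_nil]
    rw [List.filter_cons_of_neg (by simpa using hls)]
    simp
  refine ⟨key, ?_⟩
  rw [key]
  unfold dotsIn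
  rw [filter_range'_split (a := P + 1) (n := f P - P - 1) (m := l - P - 1) _ (by omega)]
  rw [show P + 1 + (l - P - 1) = l by omega]
  rw [(List.filter_eq_nil_iff (l := List.range' (l + 1) _)).2 (by
      intro r hr; simp only [List.mem_range'_1] at hr
      simp only [Finset.mem_insert, decide_eq_true_eq]
      rintro (h | h)
      · omega
      · have := hs r h; omega)]
  simp only [List.range'_one, List.append_nil]
  rw [List.filter_cons_of_pos (by simp)]
  simp only [List.filter_nil]
  congr 1
  refine List.filter_congr fun r hr => ?_
  simp only [List.mem_range'_1] at hr
  rw [decide_eq_decide, Finset.mem_insert]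
  exact ⟨fun h => h.resolve_left (by omega), Or.inr⟩

theorem stageList_of_gt {P : ℕ} (hP : P < l) (hPU : P ∈ U) (hPs : P ∉ s) (hge : l < f P) :
    stageList f U s l P = (List.range P).filter (fun r => StageActive f U s P r) ++
        (dotsIn f s P ++ []) ∧
    stageList f U s l (P + 1) =
        (List.range P).filter (fun r => StageActive f U s P r) ++ P :: dotsIn f s P := by
  have hdots' := (dotsIn_of_gt hA hlU hls hU hs hd hP hge).1
  have hact := fun r => stageActive_succ_of_mem (r := r) hA hPU
  constructor
  · unfold stageList
    rw [filter_range_split _ (show P < l by omega), hdots']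
    congr 1
    rw [List.filter_eq_nil_iff.2 (by simp; exact notStageActive_self hA hPU hPs),
      List.nil_append, List.append_nil]
    refine List.filter_congr fun r hr => ?_
    simp only [List.mem_range'_1] at hr
    rw [decide_eq_decide]
    exact stageActive_inside hA hPU (by omega) (by omega)
  · unfold stageList
    rw [filter_range_split _ (show P < l by omega), hdots']
    have h1 : StageActive f U s (P + 1) P := (hact P).2 (by simp)
    simp only [List.range'_one, List.filter_cons_of_pos, h1, decide_true, List.filter_nil,
      List.cons_append, List.nil_append]
    congr 1
    · refine List.filter_congr fun r hr => ?_
      simp only [List.mem_range] at hr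
      rw [decide_eq_decide, hact]
      exact ⟨fun h => h.resolve_right (by omega), Or.inl⟩
    · congr 1
      refine List.filter_congr fun r hr => ?_
      simp only [List.mem_range'_1] at hr
      rw [decide_eq_decide, hact, ← stageActive_inside hA hPU (by omega) (by omega)]
      exact ⟨fun h => h.resolve_right (by omega), Or.inl⟩

/-- One step of the comparison of the partial drawings with and without the last dotted arc: an
undotted arc is added. The lowering operator in `strandSt` commutes with this, unless the new arc also
crosses the strand from `l`. -/
theorem stage_insert_succ_of_mem {P : ℕ} (hP : P + 1 ≤ l) (hPU : P ∈ U)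
    (ih : stage f B U (insert l s) P = fun ω =>
      strandWt f B U s l P ω * strandSt (stageList f U s l P) l (stage f B U s P) ω) :
    stage f B U (insert l s) (P + 1) = fun ω =>
      strandWt f B U s l (P + 1) ω *
        strandSt (stageList f U s l (P + 1)) l (stage f B U s (P + 1)) ω := by
  have hinv := hA.invol
  have hPf : P < f P := hA.lt P (by simp [hPU])
  have hPs : P ∉ s := fun h => (Finset.disjoint_left.1 hd) hPU h
  have hfPl : f P ≠ l := by
    intro h
    have := hA.lt l (by simp)
    rw [← h, hinv] at this
    omega
  have hnl : ¬ StageActive f U s (P + 1) l := by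
    have := hA.lt l (by simp)
    rintro (h | h | h | h)
    · exact hls h
    · exact hlU h.1
    · omega
    · omega
  have hms : ∀ r ∈ dotsIn f s P, (P < r ∧ r < f P) ∧ r ∈ s := by
    intro r hr
    simp only [dotsIn, List.mem_filter, List.mem_range'_1, decide_eq_true_eq] at hr
    exact ⟨by omega, hr.2⟩
  have hstep' : stage f B U (insert l s) (P + 1) = arcSt P (f P) (dotsIn f (insert l s) P)
      (stage f B U (insert l s) P) := by simp [stage, hPU]
  have hstep : stage f B U s (P + 1) = arcSt P (f P) (dotsIn f s P) (stage f B U s P) := by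
    simp [stage, hPU]
  have hcov : ∀ r ∈ coverEnds f B U l P, r ≠ f P ∧ l < r := by
    intro r hr
    simp only [coverEnds, Finset.mem_filter, Finset.mem_Ioo] at hr
    refine ⟨?_, hr.1.1⟩
    rintro rfl; rw [hinv] at hr; omega
  have hcard : (s.filter fun a => f a < P + 1) = s.filter fun a => f a < P := by
    refine Finset.filter_congr fun a ha => ?_
    have : f a ≠ P := by
      intro h
      have := hA.lt a (by simp [ha])
      have hb : f P = a := by rw [← h, hinv]
      omega
    omega
  have hwm : IndepAt (strandWt f B U s l P) (f P) := strandWt_indep fun h => (hcov _ h).1 rfl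
  have hwms : ∀ p ∈ dotsIn f s P, IndepAt (strandWt f B U s l P) p := fun p hp =>
    strandWt_indep fun h => by
      have := (hcov _ h).2; have := hs p (hms p hp).2; omega
  have hvP := stage_indep (B := B) hinv (notStageActive_self hA hPU hPs)
  have hvfP := stage_indep (B := B) hinv (notStageActive_right hA hPU)
  have hlms : l ∉ dotsIn f s P := fun h => hls (hms l h).2
  rw [hstep', ih, hstep]
  rcases Nat.lt_or_ge (f P) l with hlt | hge
  · -- the new arc lies to the left of `l`
    have hdots : dotsIn f (insert l s) P = dotsIn f s P := by
      refine List.filter_congr fun r hr => ?_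
      simp only [List.mem_range'_1] at hr
      rw [decide_eq_decide, Finset.mem_insert]
      exact ⟨fun h => h.resolve_left (by omega), Or.inr⟩
    have hL := stageList_of_lt hA hPU hPs hlt
    have hL' := stageList_succ_of_lt hA hPU hlt
    have hw : strandWt f B U s l (P + 1) = strandWt f B U s l P := by
      funext ω
      unfold strandWt
      rw [hcard]
      congr 2
      refine Finset.filter_congr fun r hr => ?_
      simp only [Finset.mem_Ioo] at hr
      have : f r ≠ P := by
        rintro h
        have hb : f P = r := by rw [← h, hinv]
        omega
      exact and_congr_right fun _ => by omega
    funext ω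
    rw [hdots, arcSt_strandSt hfPl hlms hwm hwms, hw]
    congr 1
    unfold strandSt
    rw [hL, hL', arcSt_lowerOp _ hvP hvfP]
    rw [← hL']
    exact List.nodup_range.filter _
  · -- the new arc passes above the strand at `l`
    have hge : l < f P := by omega
    have hdots := (dotsIn_of_gt hA hlU hls hU hs hd hP hge).2
    obtain ⟨hL, hL'⟩ := stageList_of_gt hA hlU hls hU hs hd hP hPU hPs hge
    have hnd : ((List.range P).filter (fun r => StageActive f U s P r) ++
        P :: (dotsIn f s P ++ f P :: [])).Nodup := by
      have h1 : (stageList f U s l (P + 1) ++ [f P]).Nodup := by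
        rw [List.nodup_append]
        refine ⟨List.nodup_range.filter _, by simp, ?_⟩
        intro r hr r' hr'
        rw [mem_stageList] at hr
        simp only [List.mem_singleton] at hr'
        omega
      rw [hL'] at h1
      simpa using h1
    have hw : strandWt f B U s l (P + 1) = fun ω => strandWt f B U s l P ω * hWt (!ω (f P)) := by
      funext ω
      unfold strandWt
      have : coverEnds f B U l (P + 1) = insert (f P) (coverEnds f B U l P) := by
        ext r
        simp only [coverEnds, Finset.mem_filter, Finset.mem_Ioo, Finset.mem_insert]
        have hb := hA.lt_bound P (by simp [hPU])
        constructor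
        · rintro ⟨h1, h2, h3⟩
          by_cases h4 : f r = P
          · left; rw [← h4, hinv]
          · right; exact ⟨h1, h2, by omega⟩
        · rintro (rfl | ⟨h1, h2, h3⟩)
          · rw [hinv]; exact ⟨⟨hge, hb⟩, hPU, by omega⟩
          · exact ⟨h1, h2, by omega⟩
      rw [hcard, this, Finset.prod_insert fun h => (hcov _ h).1 rfl]
      ring
    funext ω
    rw [hdots, arcSt_concat]
    have e : arcSt P (f P) (dotsIn f s P) (fun ω =>
        strandWt f B U s l P ω * strandSt (stageList f U s l P) l (stage f B U s P) ω) =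
        fun ω => strandWt f B U s l P ω * strandSt (stageList f U s l (P + 1) ++ [f P]) l
          (arcSt P (f P) (dotsIn f s P) (stage f B U s P)) ω := by
      funext ω
      rw [arcSt_strandSt hfPl hlms hwm hwms]
      congr 1
      unfold strandSt
      rw [hL, arcSt_lowerOp hnd hvP hvfP, hL']
      simp
    rw [e, crossSt_strandSt hwm _ _, hw]
    · exact strandWt_indep fun h => by have := (hcov _ h).2; omega
    · rw [← hstep]; exact stage_indep hinv hnl

omit hU in
theorem stageActive_succ_of_ne {P r : ℕ} (hPU : P ∉ U) (hr : r ≠ P ∨ f P ∉ s) :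
    StageActive f U s (P + 1) r ↔ StageActive f U s P r := by
  have h1 : f r = P → f r ∉ U := fun h => by rwa [h]
  have h2 : r = P → r ∉ U := fun h => by rwa [h]
  have h3 : r = P → f r ∉ s := fun h => by subst h; exact hr.resolve_left (by simp)
  unfold StageActive
  constructor
  · rintro (h | h | h | h)
    · exact Or.inl h
    · exact Or.inr (Or.inl ⟨h.1, by have : r ≠ P := fun e => h2 e h.1; omega⟩)
    · exact Or.inr (Or.inr (Or.inl ⟨h.1, by have : f r ≠ P := fun e => h1 e h.1; omega⟩))
    · exact Or.inr (Or.inr (Or.inr ⟨h.1, by have : r ≠ P := fun e => h3 e h.1; omega⟩))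
  · rintro (h | h | h | h)
    · exact Or.inl h
    · exact Or.inr (Or.inl ⟨h.1, by omega⟩)
    · exact Or.inr (Or.inr (Or.inl ⟨h.1, by omega⟩))
    · exact Or.inr (Or.inr (Or.inr ⟨h.1, by omega⟩))

/-- One step of the comparison of the partial drawings with and without the last dotted arc: a strand
to the right projector is added, which crosses the strand from `l`. -/
theorem stage_insert_succ_of_right {P : ℕ} (hP : P + 1 ≤ l) (hPU : P ∉ U) (hfP : f P ∈ s)
    (ih : stage f B U (insert l s) P = fun ω =>
      strandWt f B U s l P ω * strandSt (stageList f U s l P) l (stage f B U s P) ω) :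
    stage f B U (insert l s) (P + 1) = fun ω =>
      strandWt f B U s l (P + 1) ω *
        strandSt (stageList f U s l (P + 1)) l (stage f B U s (P + 1)) ω := by
  have hinv := hA.invol
  have ht := hq_mul_hqi
  have hlf := hA.lt l (by simp)
  have hlB := hA.lt_bound l (by simp)
  have hfPP : f P < P := by have := hA.lt (f P) (by simp [hfP]); rwa [hinv] at this
  have hPs : P ∉ s := fun h => by have := hA.lt P (by simp [h]); omega
  have hfPU : f P ∉ U := fun h => (Finset.disjoint_left.1 hd) h hfP
  have hlR : l ∉ rightOf f B U s P := by
    simp only [rightOf, Finset.mem_filter, not_and, not_or]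
    exact fun _ => ⟨hls, fun _ => by omega⟩
  have hR : rightOf f B U (insert l s) P = insert l (rightOf f B U s P) := by
    ext r
    simp only [rightOf, Finset.mem_filter, Finset.mem_Ioo, Finset.mem_insert]
    constructor
    · rintro ⟨h1, (h2 | h2) | h2⟩
      exacts [Or.inl h2, Or.inr ⟨h1, Or.inl h2⟩, Or.inr ⟨h1, Or.inr h2⟩]
    · rintro (rfl | ⟨h1, h2 | h2⟩)
      exacts [⟨by omega, by simp⟩, ⟨h1, Or.inl (Or.inr h2)⟩, ⟨h1, Or.inr h2⟩]
  have hw : strandWt f B U s l (P + 1) = fun ω => hqi * strandWt f B U s l P ω := by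
    funext ω
    unfold strandWt
    have h1 : coverEnds f B U l (P + 1) = coverEnds f B U l P := by
      refine Finset.filter_congr fun r _ => and_congr_right fun h => ?_
      have : f r ≠ P := fun e => hPU (e ▸ h)
      omega
    have h2 : (s.filter fun a => f a < P + 1) = insert (f P) (s.filter fun a => f a < P) := by
      ext a
      simp only [Finset.mem_filter, Finset.mem_insert]
      constructor
      · rintro ⟨h1, h2⟩
        by_cases h : f a = P
        · left; rw [← h, hinv]
        · right; exact ⟨h1, by omega⟩
      · rintro (rfl | h)
        · rw [hinv]; exact ⟨hfP, by omega⟩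
        · exact ⟨h.1, by omega⟩
    rw [h1, h2, Finset.card_insert_of_notMem (by simp [hinv])]
    ring
  set A1 := (List.range P).filter (fun r => StageActive f U s P r) with hA1
  set A2 := (List.range' (P + 1) (l - P - 1)).filter (fun r => StageActive f U s P r) with hA2
  have hL : stageList f U s l P = A1 ++ A2 := by
    unfold stageList
    rw [filter_range_split _ (show P < l by omega)]
    rw [(List.filter_eq_nil_iff (l := List.range' P 1)).2, List.nil_append]
    simp only [List.range'_one, List.mem_singleton, forall_eq, decide_eq_true_eq]
    rintro (h | h | h | h)
    exacts [hPs h, hPU h.1, hfPU h.1, by omega]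
  have hL' : stageList f U s l (P + 1) = A1 ++ P :: A2 := by
    unfold stageList
    rw [filter_range_split _ (show P < l by omega)]
    rw [List.range'_one, List.filter_cons_of_pos (by
      simp only [decide_eq_true_eq]; exact Or.inr (Or.inr (Or.inr ⟨hfP, by omega⟩)))]
    simp only [List.filter_nil, List.cons_append, List.nil_append]
    congr 1
    · refine List.filter_congr fun r hr => ?_
      simp only [List.mem_range] at hr
      rw [decide_eq_decide]
      exact stageActive_succ_of_ne hA hlU hls hs hd hPU (Or.inl (by omega))
    · congr 1
      refine List.filter_congr fun r hr => ?_
      simp only [List.mem_range'_1] at hr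
      rw [decide_eq_decide]
      exact stageActive_succ_of_ne hA hlU hls hs hd hPU (Or.inl (by omega))
  have hA2R : ∀ r ∈ A2, r ∈ rightOf f B U s P ∧ r ≠ P := by
    intro r hr
    simp only [hA2, List.mem_filter, List.mem_range'_1, decide_eq_true_eq] at hr
    simp only [rightOf, Finset.mem_filter, Finset.mem_Ioo]
    refine ⟨⟨by omega, ?_⟩, by omega⟩
    rcases hr.2 with h | h | h | h
    exacts [Or.inl h, by omega, Or.inr h, by omega]
  have hA1R : ∀ r ∈ A1, r ∉ rightOf f B U s P ∧ r ≠ P := by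
    intro r hr
    simp only [hA1, List.mem_filter, List.mem_range] at hr
    simp only [rightOf, Finset.mem_filter, Finset.mem_Ioo]
    exact ⟨by omega, by omega⟩
  have hstep' : stage f B U (insert l s) (P + 1) = fun ω =>
      (if ω P then 0 else -hq ^ 2 * ∏ r ∈ rightOf f B U (insert l s) P, hWt (ω r)) *
        stage f B U (insert l s) P ω := by simp [stage, hPU, hfP]
  have hstep : stage f B U s (P + 1) = fun ω =>
      (if ω P then 0 else -hq ^ 2 * ∏ r ∈ rightOf f B U s P, hWt (ω r)) *
        stage f B U s P ω := by simp [stage, hPU, hfP]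
  rw [hstep', ih, hstep, hw, hR, hL, hL']
  generalize stage f B U s P = v
  funext ω
  simp only [Finset.prod_insert hlR]
  set c : St := fun ω => if ω P then 0 else -hq ^ 2 * ∏ r ∈ rightOf f B U s P, hWt (ω r) with hc
  have hcω : ∀ ω, (if ω P then 0 else -hq ^ 2 * ∏ r ∈ rightOf f B U s P, hWt (ω r)) = c ω :=
    fun ω => rfl
  simp only [hcω]
  have hcl : (if ω P then 0 else -hq ^ 2 * (hWt (ω l) * ∏ r ∈ rightOf f B U s P, hWt (ω r))) =
      hWt (ω l) * c ω := by
    simp only [hc]; split_ifs <;> ring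
  rw [hcl]
  unfold strandSt
  rcases hωl : ω l
  · simp only [hWt, Bool.false_eq_true, if_false]
    ring
  · have e1 : lowerOp A1 (fun ω => c ω * v ω) ω = c ω * lowerOp A1 v ω :=
      lowerOp_mul (fun p hp ω b => by
        have := prod_hWt_indep (hA1R p hp).1 hWt ω b
        simp only at this
        simp only [hc, this, Function.update_of_ne (hA1R p hp).2.symm]) ω
    -- raising the sign of a point to the right of `P` multiplies the weight of the new strand by `q`
    have e2 : lowerOp A2 (fun ω => c ω * v ω) ω = (hq ^ 2 * c ω) * lowerOp A2 v ω := by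
      refine lowerOp_congr_of_false (fun _ _ => rfl) fun p hp hpf => ?_
      congr 1
      simp only [hc, Function.update_of_ne (hA2R p hp).2.symm]
      rw [← Finset.mul_prod_erase _ _ (hA2R p hp).1, ← Finset.mul_prod_erase _ _ (hA2R p hp).1,
        Function.update_self, hpf, Finset.prod_congr rfl fun r hr => by
          rw [Function.update_of_ne (Finset.ne_of_mem_erase hr)]]
      split_ifs
      · simp
      · simp only [hWt, if_true, Bool.false_eq_true, if_false]
        grind
    have e3 : c (Function.update ω P true) = 0 := by simp [hc]
    simp only [lowerOp_append, kProd_cons, lowerOp, e1, e2, e3, hWt, if_true]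
    rcases hωP : ω P
    · simp only [kWt, Bool.false_eq_true, if_false]
      grind
    · have : c ω = 0 := by simp [hc, hωP]
      simp [this]

/-- The partial drawings with and without the last dotted arc differ by the strand of this arc to
the left projector. -/
theorem stage_insert_of_le {P : ℕ} (hP : P ≤ l) :
    stage f B U (insert l s) P = fun ω =>
      strandWt f B U s l P ω * strandSt (stageList f U s l P) l (stage f B U s P) ω := by
  induction P with
  | zero =>
    funext ω
    have h0 : lowerOp (stageList f U s l 0) (stage f B U s 0) ω = 0 := by
      have := lowerOp_congr (L := stageList f U s l 0) (v := fun _ => 0) (w := stage f B U s 0)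
        (ω := ω) (ω' := ω) (a := 0) (fun _ _ => rfl) fun p hp => by
          rw [mul_zero]
          refine if_neg fun h => ?_
          have hps : p ∈ s := by
            rw [mem_stageList] at hp
            rcases hp.2 with h | h | h | h
            exacts [h, by omega, by omega, by omega]
          have := h p hps
          simp at this
      rw [this, zero_mul]
    have h1 : strandWt f B U s l 0 ω = 1 := by simp [strandWt, coverEnds]
    rw [h1, strandSt, h0]
    simp only [stage, Finset.forall_mem_insert]
    rcases ω l <;> simp
  | succ P ih =>
    have ih := ih (by omega)
    by_cases hPU : P ∈ U
    · exact stage_insert_succ_of_mem hA hlU hls hU hs hd hP hPU ih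
    by_cases hfP : f P ∈ s
    · exact stage_insert_succ_of_right hA hlU hls hU hs hd hP hPU hfP ih
    have hinv := hA.invol
    have hfPl : f P ≠ l := by
      intro h
      have := hA.lt l (by simp)
      rw [← h, hinv] at this
      omega
    have e1 : stage f B U (insert l s) (P + 1) = stage f B U (insert l s) P := by
      simp [stage, hPU, hfP, hfPl]
    have e2 : stage f B U s (P + 1) = stage f B U s P := by simp [stage, hPU, hfP]
    have e3 : stageList f U s l (P + 1) = stageList f U s l P :=
      List.filter_congr fun r _ => by
        rw [decide_eq_decide]
        exact stageActive_succ_of_ne hA hlU hls hs hd hPU (Or.inr hfP)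
    have e4 : strandWt f B U s l (P + 1) = strandWt f B U s l P := by
      funext ω
      unfold strandWt
      congr 2
      · congr 1
        refine Finset.filter_congr fun a ha => ?_
        have : f a ≠ P := fun e => hfP (by rw [← e, hinv]; exact ha)
        omega
      · refine Finset.filter_congr fun r _ => and_congr_right fun h => ?_
        have : f r ≠ P := fun e => hPU (e ▸ h)
        omega
    rw [e1, e2, e3, e4, ih]

/-- Neither undotted arcs nor strands to the right projector start between the two ends of the last
dotted arc. -/
theorem stage_const {P : ℕ} (hP : l ≤ P) (hP' : P ≤ f l) :
    stage f B U (insert l s) P = stage f B U (insert l s) l ∧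
      stage f B U s (P + 1) = stage f B U s l := by
  have hinv := hA.invol
  have key : ∀ P, l ≤ P → P ≤ f l → P ∉ U ∧ f P ∉ s := by
    intro P h1 h2
    refine ⟨fun h => by have := hU P h; omega, fun h => ?_⟩
    have h3 := hs _ h
    have h4 := hA.noncrossing (f P) (by simp [h]) l (by simp)
    rw [hinv] at h4
    rcases Nat.lt_or_ge l P with h5 | h5
    · rcases Nat.lt_or_ge P (f l) with h6 | h6
      · exact h4 ⟨h3, h5, h6⟩
      · rw [show P = f l by omega, hinv] at h; exact hls h
    · rw [show P = l by omega] at h3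
      have := hA.lt l (by simp)
      omega
  induction P, hP using Nat.le_induction with
  | base =>
    obtain ⟨h1, h2⟩ := key l le_rfl hP'
    exact ⟨rfl, by simp [stage, h1, h2]⟩
  | succ P hP ih =>
    obtain ⟨i1, i2⟩ := ih (by omega)
    obtain ⟨h1, h2⟩ := key P hP (by omega)
    obtain ⟨h3, h4⟩ := key (P + 1) (by omega) hP'
    have h5 : f P ≠ l := fun h => by rw [← h, hinv] at hP'; omega
    refine ⟨?_, ?_⟩
    · rw [← i1]; simp [stage, h1, h2, h5]
    · rw [← i2]
      conv_lhs => unfold stage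
      simp [h3, h4]

/-- The drawing with the last dotted arc. Both its strands cross the same undotted arcs, one of them
above and one of them below, so that the weights of these crossings cancel. -/
theorem stage_insert_dot {P : ℕ} (hP : f l < P) :
    stage f B U (insert l s) P = fun ω => -hq ^ 2 * hqi ^ (s.filter fun a => f a < l).card *
      dotSt (stageList f U s l l) l (f l) (stage f B U s P) ω := by
  have hinv := hA.invol
  have hlf := hA.lt l (by simp)
  have ht := hq_mul_hqi
  induction P, hP using Nat.le_induction with
  | base =>
    obtain ⟨h1, h2⟩ := stage_const hA hlU hls hU hs hd hlf.le le_rfl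
    have hfU : f l ∉ U := fun h => by have := hU _ h; omega
    rw [h2]
    have hR : rightOf f B U (insert l s) (f l) = coverEnds f B U l l := by
      ext r
      simp only [rightOf, coverEnds, Finset.mem_filter, Finset.mem_Ioo, Finset.mem_insert]
      constructor
      · rintro ⟨h3, (h4 | h4) | h4⟩
        · omega
        · have := hs r h4; omega
        · exact ⟨by omega, h4.1, hU _ h4.1⟩
      · rintro ⟨h3, h4, h5⟩
        have h6 := hA.noncrossing (f r) (by simp [h4]) l (by simp)
        rw [hinv] at h6
        have h7 : r ≠ f l := by rintro rfl; rw [hinv] at h4; exact hlU h4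
        exact ⟨by omega, Or.inr ⟨h4, by omega⟩⟩
    have e : stage f B U (insert l s) (f l + 1) = fun ω =>
        (if ω (f l) then 0 else -hq ^ 2 * ∏ r ∈ coverEnds f B U l l, hWt (ω r)) *
          stage f B U (insert l s) (f l) ω := by
      rw [← hR]; simp [stage, hfU, hinv]
    rw [e, h1, stage_insert_of_le hA hlU hls hU hs hd le_rfl]
    funext ω
    have h3 : (∏ r ∈ coverEnds f B U l l, hWt (ω r)) * ∏ r ∈ coverEnds f B U l l, hWt (!ω r) =
        1 := by
      rw [← Finset.prod_mul_distrib]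
      refine Finset.prod_eq_one fun r _ => ?_
      rcases ω r <;> simp [hWt] <;> grind
    unfold dotSt strandSt strandWt
    split_ifs <;> grind
  | succ P hP ih =>
    have hP : f l + 1 ≤ P := hP
    have hPU : P ∉ U := fun h => by have := hU P h; omega
    have hfPl : f P ≠ l := fun h => by rw [← h, hinv] at hP; omega
    by_cases hfP : f P ∈ s
    · have hR : rightOf f B U (insert l s) P = rightOf f B U s P := by
        refine Finset.filter_congr fun r hr => ?_
        simp only [Finset.mem_Ioo] at hr
        rw [Finset.mem_insert]
        have : r ≠ l := by omega
        simp [this]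
      have hstep' : stage f B U (insert l s) (P + 1) = fun ω =>
          (if ω P then 0 else -hq ^ 2 * ∏ r ∈ rightOf f B U (insert l s) P, hWt (ω r)) *
            stage f B U (insert l s) P ω := by simp [stage, hPU, hfP]
      have hstep : stage f B U s (P + 1) = fun ω =>
          (if ω P then 0 else -hq ^ 2 * ∏ r ∈ rightOf f B U s P, hWt (ω r)) *
            stage f B U s P ω := by simp [stage, hPU, hfP]
      rw [hstep', ih, hstep, hR]
      generalize stage f B U s P = v
      funext ω
      simp only [dotSt]
      rw [lowerOp_mul (h := fun ω => if ω P then 0 else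
        -hq ^ 2 * ∏ r ∈ rightOf f B U s P, hWt (ω r))]
      · split_ifs <;> ring
      · intro p hp ω b
        rw [mem_stageList] at hp
        have := prod_hWt_indep (R := rightOf f B U s P) (p := p) (by
          simp only [rightOf, Finset.mem_filter, Finset.mem_Ioo]; omega) hWt ω b
        simp only at this
        simp only [this, Function.update_of_ne (show P ≠ p by omega)]
    · have e1 : stage f B U (insert l s) (P + 1) = stage f B U (insert l s) P := by
        simp [stage, hPU, hfP, hfPl]
      have e2 : stage f B U s (P + 1) = stage f B U s P := by simp [stage, hPU, hfP]
      rw [e1, e2, ih]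

end LastDot

/-- The drawing with the last arc, if this is not dotted. -/
theorem stage_insert_undotted {U s : Finset ℕ} {l : ℕ} (hA : ArcSystem f B (insert l U ∪ s))
    (hlU : l ∉ U) (hls : l ∉ s) (hU : ∀ u ∈ U, u < l) (hs : ∀ u ∈ s, u < l) {P : ℕ} (hP : l < P) :
    stage f B (insert l U) s P = cupSt l (f l) (stage f B U s P) := by
  have hinv := hA.invol
  have hlf := hA.lt l (by simp)
  have hle : ∀ P ≤ l, stage f B (insert l U) s P = stage f B U s P := by
    intro P hP
    induction P with
    | zero => rfl
    | succ P ih =>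
      have hR : rightOf f B (insert l U) s P = rightOf f B U s P := by
        refine Finset.filter_congr fun r _ => or_congr_right ?_
        rw [Finset.mem_insert]
        exact ⟨fun h => ⟨h.1.resolve_left (by omega), h.2⟩, fun h => ⟨Or.inr h.1, h.2⟩⟩
      have : P ≠ l := by omega
      simp [stage, hR, this, ih (by omega)]
  have hmem : ∀ P, l ≤ P → f P ∈ s → f l < P := by
    intro P h1 h2
    have h3 := hs _ h2
    have h4 := hA.noncrossing (f P) (by simp [h2]) l (by simp)
    rw [hinv] at h4
    have h5 : P ≠ f l := by rintro rfl; rw [hinv] at h2; exact hls h2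
    have h6 : P ≠ l := by rintro rfl; omega
    omega
  induction P, hP using Nat.le_induction with
  | base =>
    have h1 : f l ∉ s := fun h => by have := hmem l le_rfl h; omega
    have h2 : dotsIn f s l = [] := by
      refine List.filter_eq_nil_iff.2 fun r hr => ?_
      simp only [List.mem_range'_1] at hr
      simp only [decide_eq_true_eq]
      intro h; have := hs r h; omega
    simp only [stage, Finset.mem_insert_self, if_true, hlU, if_false, h1, h2, arcSt_nil,
      hle l le_rfl]
  | succ P hP ih =>
    have hP : l + 1 ≤ P := hP
    have hPU : P ∉ U := fun h => by have := hU P h; omega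
    have hPl : P ≠ l := by omega
    by_cases hfP : f P ∈ s
    · have hlt := hmem P (by omega) hfP
      have hR : rightOf f B (insert l U) s P = rightOf f B U s P := by
        refine Finset.filter_congr fun r hr => or_congr_right ?_
        simp only [Finset.mem_Ioo] at hr
        rw [Finset.mem_insert]
        have : f r ≠ l := fun h => by rw [← h, hinv] at hlt; omega
        simp [this]
      simp only [stage, Finset.mem_insert, hPl, hPU, or_self, if_false, hfP, if_true, hR, ih]
      funext ω
      simp only [cupSt]
      ring
    · simp only [stage, Finset.mem_insert, hPl, hPU, or_self, if_false, hfP, ih]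

/-- The unit by which the drawing of an expanded diagram differs from the coordinates `arcsSt`. Its
second factor comes from the crossings of the strands of dotted arcs that are not nested. -/
noncomputable def dotUnit (f : ℕ → ℕ) (s : Finset ℕ) : HalfLaurent :=
  (-hq ^ 2) ^ s.card * hqi ^ ((s ×ˢ s).filter fun p => f p.1 < p.2).card

theorem dotUnit_insert {s : Finset ℕ} {l : ℕ} (hl : ∀ u ∈ s, u < l) (hlf : l < f l) :
    dotUnit f (insert l s) = -hq ^ 2 * hqi ^ (s.filter fun a => f a < l).card * dotUnit f s := by
  have hls : l ∉ s := fun h => lt_irrefl _ (hl l h)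
  have hc : ((insert l s ×ˢ insert l s).filter fun p => f p.1 < p.2) =
      ((s ×ˢ s).filter fun p => f p.1 < p.2) ∪
        (s.filter fun a => f a < l).image fun a => (a, l) := by
    ext ⟨a, b⟩
    simp only [Finset.mem_filter, Finset.mem_product, Finset.mem_insert, Finset.mem_union,
      Finset.mem_image, Prod.mk.injEq]
    constructor
    · rintro ⟨⟨rfl | ha, rfl | hb⟩, h⟩
      · omega
      · have := hl b hb; omega
      · exact Or.inr ⟨a, ⟨ha, h⟩, rfl, rfl⟩
      · exact Or.inl ⟨⟨ha, hb⟩, h⟩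
    · rintro (⟨⟨ha, hb⟩, h⟩ | ⟨a, ⟨ha, h⟩, rfl, rfl⟩)
      · exact ⟨⟨Or.inr ha, Or.inr hb⟩, h⟩
      · exact ⟨⟨Or.inr ha, Or.inl rfl⟩, h⟩
  unfold dotUnit
  rw [hc, Finset.card_union_of_disjoint, Finset.card_image_of_injective,
    Finset.card_insert_of_notMem hls]
  · ring
  · intro a b h; simpa using h
  · rw [Finset.disjoint_left]
    rintro ⟨a, b⟩ h h'
    simp only [Finset.mem_filter, Finset.mem_product, Finset.mem_image, Prod.mk.injEq] at h h'
    obtain ⟨_, _, _, rfl⟩ := h'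
    exact hls h.1.2

/-- The drawing of an expanded diagram, with sign `true` at all points of the projectors, agrees up to
a unit with the system of its arcs. -/
theorem stage_eq_arcsSt {D T : Finset ℕ} (hA : ArcSystem f B T) :
    stage f B (T.filter fun i => i ∉ D) (T.filter fun i => i ∈ D) B = fun ω =>
      dotUnit f (T.filter fun i => i ∈ D) * arcsSt f D (T.sort (· ≥ ·)) ω := by
  induction T using Finset.induction_on_max with
  | empty =>
    have : ∀ P, stage f B ∅ ∅ P = fun _ => 1 := by
      intro P
      induction P with
      | zero => simp [stage]
      | succ P ih => simp [stage, ih]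
    simp [this, dotUnit, arcsSt]
  | insert l T hl ih =>
    have hlT : l ∉ T := fun h => lt_irrefl _ (hl l h)
    have ih := ih (hA.mono (Finset.subset_insert _ _))
    have hlf := hA.lt l (by simp)
    have hsort : (insert l T).sort (· ≥ ·) = l :: T.sort (· ≥ ·) :=
      Finset.sort_insert _ (fun b hb => (hl b hb).le) hlT
    have hU : ∀ u ∈ T.filter (fun i => i ∉ D), u < l := fun u hu => hl u (Finset.mem_filter.1 hu).1
    have hs : ∀ u ∈ T.filter (fun i => i ∈ D), u < l := fun u hu => hl u (Finset.mem_filter.1 hu).1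
    have hd : Disjoint (T.filter fun i => i ∉ D) (T.filter fun i => i ∈ D) := by
      rw [Finset.disjoint_left]
      intro a h1 h2
      exact (Finset.mem_filter.1 h1).2 (Finset.mem_filter.1 h2).2
    have hT : ∀ i, i ∈ T → i ∈ T.filter (fun i => i ∉ D) ∪ T.filter (fun i => i ∈ D) := by
      intro i hi
      by_cases h : i ∈ D <;> simp [hi, h]
    rw [hsort]
    by_cases hlD : l ∈ D
    · rw [Finset.filter_insert, if_neg (by simpa using hlD), Finset.filter_insert, if_pos hlD,
        stage_insert_dot _ _ _ hU hs hd (hA.lt_bound l (by simp)), ih, dotUnit_insert hs hlf]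
      · have hlist : stageList f (T.filter fun i => i ∉ D) (T.filter fun i => i ∈ D) l l =
            below (pts f (T.sort (· ≥ ·))) l := by
          refine List.filter_congr fun r hr => ?_
          simp only [List.mem_range] at hr
          rw [decide_eq_decide, mem_pts]
          simp only [StageActive, Finset.mem_filter, Finset.mem_sort]
          constructor
          · rintro (h | h | h | h)
            · exact ⟨r, h.1, Or.inl rfl⟩
            · exact ⟨r, h.1.1, Or.inl rfl⟩
            · exact ⟨f r, h.1.1, Or.inr (hA.invol r).symm⟩
            · exact ⟨f r, h.1.1, Or.inr (hA.invol r).symm⟩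
          · rintro ⟨i, hi, rfl | rfl⟩
            · by_cases h : r ∈ D <;> simp [hi, h, hr]
            · by_cases h : i ∈ D <;> simp [hi, h, hr, hA.invol, hl]
        funext ω
        simp only [arcsSt, arcStep, if_pos hlD, hlist, dotSt]
        rw [lowerOp_smul]
        split_ifs <;> ring
      · refine hA.mono fun i hi => ?_
        simp only [Finset.mem_union, Finset.mem_filter, Finset.mem_insert] at hi ⊢
        tauto
      · simp [hlT]
      · simp [hlT]
    · rw [Finset.filter_insert, if_pos (by simpa using hlD), Finset.filter_insert, if_neg hlD,
        stage_insert_undotted _ _ _ hU hs (hlf.trans (hA.lt_bound l (by simp))), ih]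
      · funext ω
        simp only [arcsSt, arcStep, if_neg hlD, cupSt]
        ring
      · refine hA.mono fun i hi => ?_
        simp only [Finset.mem_union, Finset.mem_filter, Finset.mem_insert] at hi ⊢
        tauto
      · simp [hlT]
      · simp [hlT]

end Skein


namespace Skein

/-! ### Tensor coordinates of the expansion of a dotted matching -/

variable {n k : ℕ}

theorem position_inl (p : Fin k) : (DottedMatching.position n k (.inl p) : ℕ) = p := by
  simp [DottedMatching.position]

theorem position_mid (j : Fin (2 * n)) :
    (DottedMatching.position n k (.inr (.inl j)) : ℕ) = k + j := by
  simp [DottedMatching.position]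

theorem position_inr (p : Fin k) :
    (DottedMatching.position n k (.inr (.inr p)) : ℕ) = k + 2 * n + p := by
  simp [DottedMatching.position]; omega

/-- The left endpoints of the dotted arcs, as natural numbers. -/
def natDots (x : DottedMatching n k) : Finset ℕ := x.dots.map Fin.valEmbedding

/-- The left endpoints of all arcs, as natural numbers. -/
def natLefts {N : ℕ} (M : PerfectMatching (2 * N)) : Finset ℕ := M.lefts.map Fin.valEmbedding

theorem mem_natLefts {N : ℕ} {M : PerfectMatching (2 * N)} {r : ℕ} :
    r ∈ natLefts M ↔ r < 2 * N ∧ r < natPartner M r := by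
  simp only [natLefts, PerfectMatching.lefts, Finset.mem_map, Finset.mem_filter, Finset.mem_univ,
    true_and, Fin.valEmbedding_apply]
  constructor
  · rintro ⟨i, hi, rfl⟩
    exact ⟨i.2, by rw [natPartner_val]; exact hi⟩
  · rintro ⟨h, hr⟩
    refine ⟨⟨r, h⟩, ?_, rfl⟩
    rw [Fin.lt_def, ← natPartner_val]; exact hr

theorem mem_natDots {x : DottedMatching n k} {j : Fin (2 * n)} : (j : ℕ) ∈ natDots x ↔ j ∈ x.dots := by
  simp only [natDots, Finset.mem_map, Fin.valEmbedding_apply]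
  exact ⟨fun ⟨i, hi, h⟩ => Fin.ext h ▸ hi, fun h => ⟨j, h, rfl⟩⟩

theorem lt_of_mem_natDots {x : DottedMatching n k} {r : ℕ} (h : r ∈ natDots x) : r < 2 * n := by
  simp only [natDots, Finset.mem_map, Fin.valEmbedding_apply] at h
  obtain ⟨i, _, rfl⟩ := h
  exact i.2

variable (x : DottedMatching n k)

theorem natDots_subset : natDots x ⊆ natLefts x.toPerfectMatching := by
  intro r hr
  have h := lt_of_mem_natDots hr
  lift r to Fin (2 * n) using h
  rw [mem_natDots] at hr
  rw [mem_natLefts, natPartner_val]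
  exact ⟨r.2, x.lt_partner_of_mem_dots r hr⟩

theorem card_natDots : (natDots x).card = k := by rw [natDots, Finset.card_map, x.card_dots]

theorem natPartner_mem_natDots {j : Fin (2 * n)} :
    natPartner x.toPerfectMatching j ∈ natDots x ↔ j ∈ x.rightDots := by
  rw [natPartner_val, mem_natDots, x.partner_mem_dots]

theorem natPartner_expand (p : Fin k ⊕ (Fin (2 * n) ⊕ Fin k)) :
    natPartner x.expand (DottedMatching.position n k p) =
      DottedMatching.position n k (x.expandPartner p) := by
  rw [natPartner_val]
  simp [DottedMatching.expand]

theorem expand_dot {j : Fin (2 * n)} (h : j ∈ x.dots) : natPartner x.expand (k + j) =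
    ((x.dots.orderIsoOfFin x.card_dots).symm ⟨j, h⟩).rev := by
  rw [← position_mid, natPartner_expand, DottedMatching.expandPartner, dif_pos h, position_inl]

theorem expand_rightDot {j : Fin (2 * n)} (h : j ∈ x.rightDots) : natPartner x.expand (k + j) =
    k + 2 * n + ((x.rightDots.orderIsoOfFin x.card_rightDots).symm ⟨j, h⟩).rev := by
  rw [← position_mid, natPartner_expand, DottedMatching.expandPartner,
    dif_neg (x.notMem_dots_of_mem_rightDots h), dif_pos h, position_inr]

theorem expand_undotted {r : ℕ} (hr : r < 2 * n) (h : r ∉ natDots x)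
    (h' : natPartner x.toPerfectMatching r ∉ natDots x) :
    natPartner x.expand (k + r) = k + natPartner x.toPerfectMatching r := by
  lift r to Fin (2 * n) using hr
  rw [mem_natDots] at h
  rw [natPartner_mem_natDots] at h'
  rw [← position_mid, natPartner_expand, DottedMatching.expandPartner, dif_neg h, dif_neg h',
    position_mid, natPartner_val]

theorem expand_dot_lt {r : ℕ} (h : r ∈ natDots x) : natPartner x.expand (k + r) < k := by
  have hr := lt_of_mem_natDots h
  lift r to Fin (2 * n) using hr
  rw [mem_natDots] at h
  rw [expand_dot x h]
  exact Fin.is_lt _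

theorem expand_dot_anti {r r' : ℕ} (h : r ∈ natDots x) (h' : r' ∈ natDots x) (hlt : r < r') :
    natPartner x.expand (k + r') < natPartner x.expand (k + r) := by
  have hr := lt_of_mem_natDots h
  lift r to Fin (2 * n) using hr
  have hr' := lt_of_mem_natDots h'
  lift r' to Fin (2 * n) using hr'
  rw [mem_natDots] at h h'
  rw [expand_dot x h, expand_dot x h', ← Fin.lt_def, Fin.rev_lt_rev, OrderIso.lt_iff_lt]
  exact hlt

theorem expand_rightDot_ge {r : ℕ} (hr : r < 2 * n)
    (h : natPartner x.toPerfectMatching r ∈ natDots x) :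
    k + 2 * n ≤ natPartner x.expand (k + r) := by
  lift r to Fin (2 * n) using hr
  rw [natPartner_mem_natDots] at h
  rw [expand_rightDot x h]
  omega

theorem expand_rightDot_anti {r r' : ℕ} (hr : r < 2 * n) (hr' : r' < 2 * n)
    (h : natPartner x.toPerfectMatching r ∈ natDots x)
    (h' : natPartner x.toPerfectMatching r' ∈ natDots x) (hlt : r < r') :
    natPartner x.expand (k + r') < natPartner x.expand (k + r) := by
  lift r to Fin (2 * n) using hr
  lift r' to Fin (2 * n) using hr'
  rw [natPartner_mem_natDots] at h h'
  rw [expand_rightDot x h, expand_rightDot x h', add_lt_add_iff_left, ← Fin.lt_def, Fin.rev_lt_rev,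
    OrderIso.lt_iff_lt]
  exact hlt

theorem expand_left {p : ℕ} (hp : p < k) : ∃ r ∈ natDots x, natPartner x.expand p = k + r := by
  refine ⟨(x.dots.orderIsoOfFin x.card_dots (Fin.rev ⟨p, hp⟩) : Fin (2 * n)),
    mem_natDots.2 (Subtype.prop _), ?_⟩
  have := natPartner_expand x (.inl ⟨p, hp⟩)
  rwa [position_inl, DottedMatching.expandPartner, position_mid] at this

theorem expand_right {p : ℕ} (hp : k + 2 * n ≤ p) (hp' : p < 2 * (n + k)) :
    ∃ r < 2 * n, natPartner x.toPerfectMatching r ∈ natDots x ∧ natPartner x.expand p = k + r := by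
  obtain ⟨p, rfl⟩ := Nat.exists_eq_add_of_le hp
  have hp : p < k := by omega
  refine ⟨(x.rightDots.orderIsoOfFin x.card_rightDots (Fin.rev ⟨p, hp⟩) : Fin (2 * n)), Fin.is_lt _,
    (natPartner_mem_natDots x).2 (Subtype.prop _), ?_⟩
  have := natPartner_expand x (.inr (.inr ⟨p, hp⟩))
  rwa [position_inr, DottedMatching.expandPartner, position_mid] at this

/-- The signs `ω` at the `2n` points in the middle, and `true` at all points of the projectors. -/
def padSigns (n k : ℕ) (ω : ℕ → Bool) : ℕ → Bool := fun p =>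
  if k ≤ p ∧ p < k + 2 * n then ω (p - k) else true

theorem padSigns_mid {ω : ℕ → Bool} {r : ℕ} (h : r < 2 * n) : padSigns n k ω (k + r) = ω r := by
  simp [padSigns, h]

theorem padSigns_of_lt {ω : ℕ → Bool} {p : ℕ} (h : p < k) : padSigns n k ω p = true := by
  unfold padSigns; rw [if_neg (by omega)]

theorem padSigns_of_ge {ω : ℕ → Bool} {p : ℕ} (h : k + 2 * n ≤ p) : padSigns n k ω p = true := by
  unfold padSigns; rw [if_neg (by omega)]

theorem padSigns_update {ω : ℕ → Bool} {r : ℕ} (h : r < 2 * n) (b : Bool) :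
    padSigns n k (Function.update ω r b) = Function.update (padSigns n k ω) (k + r) b := by
  funext p
  by_cases hp : p = k + r
  · subst hp; simp [padSigns_mid h]
  · rw [Function.update_of_ne hp]
    unfold padSigns
    split_ifs with h1
    · rw [Function.update_of_ne (by omega)]
    · rfl

theorem map_padSigns (ω : ℕ → Bool) : (List.range (2 * (n + k))).map (padSigns n k ω) =
    padWord k ((List.range (2 * n)).map ω) := by
  have e : List.range (2 * (n + k)) =
      List.range k ++ ((List.range' k (2 * n)) ++ List.range' (k + 2 * n) k) := by
    rw [List.range'_append_1, List.range_eq_range', List.range_eq_range']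
    have := @List.range'_append_1 0 k (2 * n + k)
    rw [zero_add] at this
    rw [this]; congr 1; omega
  rw [e, padWord]
  simp only [List.map_append, List.append_assoc]
  congr 1
  · refine List.eq_replicate_iff.2 ⟨by simp, fun b hb => ?_⟩
    obtain ⟨p, hp, rfl⟩ := List.mem_map.1 hb
    exact padSigns_of_lt (List.mem_range.1 hp)
  congr 1
  · rw [List.range'_eq_map_range, List.map_map]
    refine List.map_congr_left fun r hr => ?_
    exact padSigns_mid (List.mem_range.1 hr)
  · refine List.eq_replicate_iff.2 ⟨by simp, fun b hb => ?_⟩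
    obtain ⟨p, hp, rfl⟩ := List.mem_map.1 hb
    exact padSigns_of_ge (List.mem_range'_1.1 hp).1

theorem crossSt_padSigns {m p : ℕ} (hm : m < 2 * n) (hp : p < 2 * n) (v : St) (ω : ℕ → Bool) :
    crossSt (k + m) (k + p) v (padSigns n k ω) =
      crossSt m p (fun ω => v (padSigns n k ω)) ω := by
  rw [crossSt_eq, crossSt_eq, padSigns_mid hm, padSigns_mid hp, padSigns_update hp,
    padSigns_update hm]

theorem arcSt_padSigns {u m : ℕ} {ms : List ℕ} (hu : u < 2 * n) (hm : m < 2 * n)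
    (hms : ∀ p ∈ ms, p < 2 * n) (v : St) (ω : ℕ → Bool) :
    arcSt (k + u) (k + m) (ms.map (k + ·)) v (padSigns n k ω) =
      arcSt u m ms (fun ω => v (padSigns n k ω)) ω := by
  induction ms using List.reverseRecOn generalizing ω with
  | nil => simp only [List.map_nil, arcSt_nil, cupSt, padSigns_mid hu, padSigns_mid hm]
  | append_singleton ms p ih =>
    rw [List.map_append, List.map_singleton, arcSt_concat, arcSt_concat,
      crossSt_padSigns hm (hms p (by simp))]
    congr 1
    funext ω
    exact ih (fun r hr => hms r (by simp [hr])) ω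

theorem natPartner_crossingless {N : ℕ} (M : CrossinglessMatching (2 * N)) {i j : ℕ}
    (hj : j < 2 * N) (h1 : i < j) (h2 : j < natPartner M.toPerfectMatching i)
    (h3 : natPartner M.toPerfectMatching i < natPartner M.toPerfectMatching j) : False := by
  lift j to Fin (2 * N) using hj
  have hi : i < 2 * N := by omega
  lift i to Fin (2 * N) using hi
  rw [natPartner_val] at h2 h3
  rw [natPartner_val] at h3
  exact M.crossingless i j ⟨h1, h2, h3⟩

theorem arcSystem_natPartner {N : ℕ} (M : CrossinglessMatching (2 * N)) :
    ArcSystem (natPartner M.toPerfectMatching) (2 * N) (natLefts M.toPerfectMatching) where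
  invol := natPartner_natPartner _
  lt _ hi := (mem_natLefts.1 hi).2
  lt_bound _ hi := natPartner_lt _ (mem_natLefts.1 hi).1
  noncrossing _ _ _ hj h := natPartner_crossingless M (mem_natLefts.1 hj).1 h.1 h.2.1 h.2.2

theorem crossedBy_expand_left {P : ℕ} (hP : P < k) : crossedBy x.expand P = [] := by
  obtain ⟨r, hr, e⟩ := expand_left x hP
  have hinv := natPartner_natPartner x.expand
  refine List.filter_eq_nil_iff.2 fun p hp => ?_
  simp only [List.mem_range'_1] at hp
  simp only [decide_eq_true_eq, not_lt]
  by_contra hlt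
  have hp2 : natPartner x.expand (natPartner x.expand p) = p := hinv p
  obtain ⟨r', hr', e'⟩ := expand_left x (show natPartner x.expand p < k by omega)
  rw [hinv] at e'
  have := expand_dot_anti x hr' hr (by omega)
  rw [← e, ← e', hinv] at this
  omega

theorem drawSt_expand_of_le (ω : ℕ → Bool) {P : ℕ} (hP : P ≤ k) :
    drawSt x.expand P (padSigns n k ω) =
      if ∀ p < P, padSigns n k ω (natPartner x.expand p) = false then 1 else 0 := by
  induction P with
  | zero => simp [drawSt]
  | succ P ih =>
    obtain ⟨r, hr, e⟩ := expand_left x (show P < k by omega)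
    rw [drawSt, if_pos (by omega), crossedBy_expand_left x (by omega), arcSt_nil, cupSt, ih (by omega),
      padSigns_of_lt (show P < k by omega)]
    simp only [Nat.forall_lt_succ_right]
    rcases h : padSigns n k ω (natPartner x.expand P) <;> simp [cupW]

/-- The left endpoints of the undotted arcs. -/
def natUndotted : Finset ℕ := (natLefts x.toPerfectMatching).filter fun i => i ∉ natDots x

theorem drawSt_expand_zero (ω : ℕ → Bool) : drawSt x.expand k (padSigns n k ω) =
    stage (natPartner x.toPerfectMatching) (2 * n) (natUndotted x) (natDots x) 0 ω := by
  rw [drawSt_expand_of_le x ω le_rfl, stage]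
  congr 1
  refine propext ⟨fun h r hr => ?_, fun h p hp => ?_⟩
  · have := h _ (expand_dot_lt x hr)
    rwa [natPartner_natPartner, padSigns_mid (lt_of_mem_natDots hr)] at this
  · obtain ⟨r, hr, e⟩ := expand_left x hp
    rw [e, padSigns_mid (lt_of_mem_natDots hr)]
    exact h r hr

theorem expand_lt_iff {P r : ℕ} (hr : r < 2 * n) (hP : P ≤ r) :
    natPartner x.expand (k + r) < k + P ↔
      r ∈ natDots x ∨ (natPartner x.toPerfectMatching r ∈ natUndotted x ∧
        natPartner x.toPerfectMatching r < P) := by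
  have hinv := natPartner_natPartner x.toPerfectMatching
  have hr' := natPartner_lt x.toPerfectMatching hr
  by_cases h1 : r ∈ natDots x
  · have := expand_dot_lt x h1
    simp only [h1, true_or, iff_true]; omega
  by_cases h2 : natPartner x.toPerfectMatching r ∈ natDots x
  · have := expand_rightDot_ge x hr h2
    simp only [h1, natUndotted, Finset.mem_filter, h2, false_or]
    simp only [not_true, and_false, false_and, iff_false]; omega
  · rw [expand_undotted x hr h1 h2]
    simp only [h1, natUndotted, Finset.mem_filter, h2, false_or, mem_natLefts, hinv]
    simp only [not_false_eq_true, and_true]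
    omega

/-- The arcs crossed by the arc from a right endpoint of a dotted arc to the right projector. -/
theorem crossedBy_expand_rightDot {P : ℕ} (hP : P < 2 * n)
    (hfD : natPartner x.toPerfectMatching P ∈ natDots x) :
    (crossedBy x.expand (k + P)).toFinset =
      (rightOf (natPartner x.toPerfectMatching) (2 * n) (natUndotted x) (natDots x) P).map
        (addLeftEmbedding k) := by
  have h1 := expand_rightDot_ge x hP hfD
  have h1' : natPartner x.expand (k + P) < 2 * (n + k) := natPartner_lt _ (by omega)
  ext p
  simp only [crossedBy, List.mem_toFinset, List.mem_filter, List.mem_range'_1,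
    decide_eq_true_eq, rightOf, Finset.mem_map, Finset.mem_filter, Finset.mem_Ioo,
    addLeftEmbedding_apply]
  constructor
  · rintro ⟨h3, h4⟩
    rcases Nat.lt_or_ge p (k + 2 * n) with h5 | h5
    · obtain ⟨r, rfl⟩ := Nat.exists_eq_add_of_le (show k ≤ p by omega)
      exact ⟨r, ⟨by omega, (expand_lt_iff x (by omega) (by omega)).1 h4⟩, rfl⟩
    · obtain ⟨r, hr, hr', e⟩ := expand_right x h5 (by omega)
      have := expand_rightDot_anti x hr hP hr' hfD (by omega)
      rw [← e, natPartner_natPartner] at this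
      omega
  · rintro ⟨r, ⟨h3, h4⟩, rfl⟩
    exact ⟨by omega, (expand_lt_iff x (by omega) (by omega)).2 h4⟩

/-- The arcs crossed by an undotted arc. -/
theorem crossedBy_expand_undotted {P : ℕ} (hP : P < 2 * n) (hPD : P ∉ natDots x)
    (hfD : natPartner x.toPerfectMatching P ∉ natDots x) :
    crossedBy x.expand (k + P) =
      (dotsIn (natPartner x.toPerfectMatching) (natDots x) P).map (k + ·) := by
  have hinv := natPartner_natPartner x.toPerfectMatching
  have hfP := natPartner_lt x.toPerfectMatching hP
  have e := expand_undotted x hP hPD hfD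
  unfold crossedBy dotsIn
  set f := natPartner x.toPerfectMatching with hf
  rw [e, show k + f P - (k + P) - 1 = f P - P - 1 by omega,
    show k + P + 1 = k + (P + 1) by omega, ← List.map_add_range', List.filter_map]
  congr 1
  refine List.filter_congr fun r hr => ?_
  simp only [List.mem_range'_1] at hr
  simp only [Function.comp_apply]
  rw [decide_eq_decide, expand_lt_iff x (by omega) (by omega), ← hf]
  refine ⟨fun h => h.resolve_right ?_, Or.inl⟩
  rintro ⟨h3, h4⟩
  refine natPartner_crossingless x.toCrossinglessMatching (i := f r) hP h4 ?_ ?_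
  · rw [← hf, hinv]; omega
  · rw [← hf, hinv]; omega

/-- The drawing of the expansion of a dotted matching agrees with `stage`, arc by arc. -/
theorem drawSt_expand_mid {P : ℕ} (hP : P ≤ 2 * n) (ω : ℕ → Bool) :
    drawSt x.expand (k + P) (padSigns n k ω) =
      stage (natPartner x.toPerfectMatching) (2 * n) (natUndotted x) (natDots x) P ω := by
  induction P generalizing ω with
  | zero => exact drawSt_expand_zero x ω
  | succ P ih =>
    have ih := ih (by omega)
    have hinv := natPartner_natPartner x.toPerfectMatching
    have hPn : P < 2 * n := by omega
    have hfP := natPartner_lt x.toPerfectMatching hPn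
    set f := natPartner x.toPerfectMatching with hf
    have hdl : ∀ r ∈ natDots x, r < f r := fun r hr => (mem_natLefts.1 (natDots_subset x hr)).2
    by_cases hPD : P ∈ natDots x
    · have h1 := expand_dot_lt x hPD
      have h2 : P ∉ natUndotted x := by simp [natUndotted, hPD]
      have h3 : f P ∉ natDots x := fun h => by
        have h3 := hdl _ h
        rw [hinv] at h3
        have h4 := hdl _ hPD
        omega
      rw [← Nat.add_assoc, drawSt, if_neg (by omega), ih]
      simp only [stage, h2, h3, if_false]
    by_cases hfD : f P ∈ natDots x
    · have h1 := expand_rightDot_ge x hPn hfD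
      have h1' : natPartner x.expand (k + P) < 2 * (n + k) := natPartner_lt _ (by omega)
      have h2 : P ∉ natUndotted x := by
        simp only [natUndotted, Finset.mem_filter, mem_natLefts, ← hf]
        have := hdl _ hfD
        rw [hinv] at this; omega
      have hc := crossedBy_expand_rightDot x hPn hfD
      rw [← hf] at hc
      have hnd : (crossedBy x.expand (k + P)).Nodup :=
        List.Nodup.filter _ List.nodup_range'
      rw [← Nat.add_assoc, drawSt, if_pos (by omega), arcSt_of_right_true _ _ (padSigns_of_ge h1),
        ih, padSigns_mid hPn, ← List.prod_toFinset _ hnd, hc, Finset.prod_map]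
      · simp only [stage, h2, hfD, if_false, if_true, addLeftEmbedding_apply]
        rw [Finset.prod_congr rfl fun r hr => by
          rw [padSigns_mid (Finset.mem_Ioo.1 (Finset.mem_filter.1 hr).1).2]]
        split_ifs <;> simp
      · simp only [crossedBy, List.mem_filter, List.mem_range'_1]; omega
    have e := expand_undotted x hPn hPD hfD
    rw [← hf] at e
    by_cases hlt : P < f P
    · have h2 : P ∈ natUndotted x := by simp [natUndotted, hPD, mem_natLefts, hPn, ← hf, hlt]
      have hc := crossedBy_expand_undotted x hPn hPD hfD
      rw [← hf] at hc
      rw [← Nat.add_assoc, drawSt, if_pos (by omega), hc, e, arcSt_padSigns hPn hfP]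
      · simp only [stage, h2, if_true]
        congr 1
        funext ω
        exact ih ω
      · intro p hp
        simp only [dotsIn, List.mem_filter, List.mem_range'_1] at hp
        omega
    · have h2 : P ∉ natUndotted x := by simp [natUndotted, mem_natLefts, ← hf, hlt]
      rw [← Nat.add_assoc, drawSt, if_neg (by omega), ih]
      simp only [stage, h2, hfD, if_false]

theorem drawSt_expand (ω : ℕ → Bool) : drawSt x.expand (2 * (n + k)) (padSigns n k ω) =
    stage (natPartner x.toPerfectMatching) (2 * n) (natUndotted x) (natDots x) (2 * n) ω := by
  rw [← drawSt_expand_mid x le_rfl]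
  have : ∀ c ≤ k, drawSt x.expand (k + 2 * n + c) = drawSt x.expand (k + 2 * n) := by
    intro c hc
    induction c with
    | zero => rfl
    | succ c ih =>
      obtain ⟨r, hr, _, e⟩ := expand_right x (show k + 2 * n ≤ k + 2 * n + c by omega) (by omega)
      rw [← Nat.add_assoc, drawSt, if_neg (by omega), ih (by omega)]
  rw [← this k le_rfl]
  congr 1; omega

/-- The number of pairs of dotted arcs is the number of nested pairs plus the number of unnested
pairs. -/
theorem card_unnested_add_nestedPairs :
    ((natDots x ×ˢ natDots x).filter fun p => natPartner x.toPerfectMatching p.1 < p.2).card +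
      x.nestedPairs = (k * k - k) / 2 := by
  have hmap : natDots x ×ˢ natDots x =
      (x.dots ×ˢ x.dots).map (Fin.valEmbedding.prodMap Fin.valEmbedding) := by
    ext ⟨a, b⟩
    simp [natDots, and_and_and_comm]
  rw [hmap, Finset.filter_map, Finset.card_map, DottedMatching.nestedPairs,
    ← Finset.card_union_of_disjoint]
  · have h1 : (x.dots ×ˢ x.dots).filter (fun p => p.1 < p.2) ∪
        (x.dots ×ˢ x.dots).filter (fun p => p.2 < p.1) = x.dots.offDiag := by
      ext ⟨a, b⟩
      simp only [Finset.mem_union, Finset.mem_filter, Finset.mem_product, Finset.mem_offDiag]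
      constructor
      · rintro (⟨⟨h1, h2⟩, h3⟩ | ⟨⟨h1, h2⟩, h3⟩)
        exacts [⟨h1, h2, h3.ne⟩, ⟨h1, h2, h3.ne'⟩]
      · rintro ⟨h1, h2, h3⟩
        rcases lt_or_gt_of_ne h3 with h | h
        exacts [Or.inl ⟨⟨h1, h2⟩, h⟩, Or.inr ⟨⟨h1, h2⟩, h⟩]
    have h2 : ((x.dots ×ˢ x.dots).filter fun p => p.2 < p.1).card =
        ((x.dots ×ˢ x.dots).filter fun p => p.1 < p.2).card := by
      refine Finset.card_bij (fun p _ => p.swap) ?_ ?_ ?_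
      · rintro ⟨a, b⟩ h
        simp only [Finset.mem_filter, Finset.mem_product, Prod.swap_prod_mk] at h ⊢
        exact ⟨⟨h.1.2, h.1.1⟩, h.2⟩
      · rintro a _ b _ h; exact Prod.swap_injective h
      · rintro ⟨a, b⟩ h
        simp only [Finset.mem_filter, Finset.mem_product] at h
        exact ⟨(b, a), by simp only [Finset.mem_filter, Finset.mem_product]; tauto, rfl⟩
    have h3 := Finset.offDiag_card x.dots
    rw [← h1, Finset.card_union_of_disjoint, h2, x.card_dots] at h3
    · rw [← h3, ← two_mul, Nat.mul_div_cancel_left _ two_pos]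
      congr 1
      ext ⟨a, b⟩
      simp only [Finset.mem_union, Finset.mem_filter, Finset.mem_product, Function.comp_apply,
        Function.Embedding.coe_prodMap, Prod.map_apply, Fin.valEmbedding_apply, natPartner_val]
      have hc := x.crossingless a b
      have hne : a ≠ b → x.partner a ≠ x.partner b := fun h h' => h (by
        rw [← x.partner_partner a, h', x.partner_partner])
      have hlt := x.lt_partner_of_mem_dots a
      constructor
      · rintro (⟨⟨ha, hb⟩, h⟩ | ⟨⟨ha, hb⟩, h⟩)
        · exact ⟨⟨ha, hb⟩, (hlt ha).trans (Fin.lt_def.2 h)⟩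
        · exact ⟨⟨ha, hb⟩, h.1⟩
      · rintro ⟨⟨ha, hb⟩, h⟩
        rcases lt_trichotomy (x.partner a) b with h4 | h4 | h4
        · exact Or.inl ⟨⟨ha, hb⟩, h4⟩
        · have := x.lt_partner_of_mem_dots b hb
          rw [← h4, x.partner_partner] at this
          exact absurd this (hlt ha).not_gt
        · refine Or.inr ⟨⟨ha, hb⟩, h, ?_⟩
          exact lt_of_le_of_ne (not_lt.1 fun h5 => hc ⟨h, h4, h5⟩) (hne h.ne).symm
    · rw [Finset.disjoint_left]
      rintro ⟨a, b⟩ h h'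
      simp only [Finset.mem_filter] at h h'
      exact absurd h.2 h'.2.not_gt
  · rw [Finset.disjoint_left]
    rintro ⟨a, b⟩ h h'
    simp only [Finset.mem_filter, Finset.mem_product, Function.comp_apply,
        Function.Embedding.coe_prodMap, Prod.map_apply, Fin.valEmbedding_apply, natPartner_val] at h h'
    have h1 := x.lt_partner_of_mem_dots b h'.1.2
    have h2 := h'.2.2
    have h3 := h.2
    simp only [Fin.lt_def] at h1 h2
    omega

/-- The common unit in the tensor coordinates of the images of all dotted matchings. It does not
depend on the matching: the number of unnested pairs of dotted arcs enters with the drawing, and the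
number of nested pairs with the normalization of the expansion map. -/
noncomputable def russellUnit (k : ℕ) : HalfLaurent := (-hq ^ 2) ^ k * hqi ^ ((k * k - k) / 2)

theorem hqi_pow (p : ℕ) : hqi ^ p = qHalfPow (-(p : ℤ)) := by
  induction p with
  | zero => simp [qHalfPow_zero]
  | succ p ih =>
    rw [pow_succ, ih, hqi, ← qHalfPow_add]; congr 1; push_cast; ring

theorem isUnit_russellUnit (k : ℕ) : IsUnit (russellUnit k) :=
  (((isUnit_qHalfPow 1).pow 2).neg.pow k).mul ((isUnit_qHalfPow (-1)).pow _)

/-- The tensor coordinates of the image of a dotted matching. -/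
theorem evQuot_expansionMap_single {l : List Bool} (hl : l.length = 2 * n) :
    evQuot n k ((klEncloseRange n k).mkQ (expansionMap n k (Finsupp.single x 1))) l =
      russellUnit k * arcsSt (natPartner x.toPerfectMatching) (natDots x)
        ((natLefts x.toPerfectMatching).sort (· ≥ ·)) fun r => l.getD r false := by
  have e1 : (List.range (2 * n)).map (fun r => l.getD r false) = l := by
    refine List.ext_getElem (by simp [hl]) fun i h1 h2 => ?_
    simp [List.getD_eq_getElem?_getD, h2]
  have e2 : expansionMap n k (Finsupp.single x 1) =
      qHalfPow (-(x.nestedPairs : ℤ)) • klClass n k x.expand.draw := by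
    simp [expansionMap]
  have e3 : (natLefts x.toPerfectMatching).filter (fun i => i ∈ natDots x) = natDots x := by
    ext i
    rw [Finset.mem_filter]
    exact ⟨fun h => h.2, fun h => ⟨natDots_subset x h, h⟩⟩
  have e4 := stage_eq_arcsSt (D := natDots x) (arcSystem_natPartner x.toCrossinglessMatching)
  rw [e3] at e4
  rw [e2, map_smul, map_smul, Pi.smul_apply, evQuot_klClass _ hl]
  nth_rewrite 1 [← e1]
  rw [← map_padSigns, ev_draw, drawSt_expand, natUndotted, e4, smul_eq_mul, ← mul_assoc]
  congr 1
  rw [dotUnit, card_natDots, ← hqi_pow, russellUnit, ← card_unnested_add_nestedPairs x, pow_add]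
  ring

end Skein


namespace Skein

/-! ### The relations hold in coordinates -/

variable {n k : ℕ}

theorem ArcSystem.innerFirst {f : ℕ → ℕ} {B : ℕ} {T : Finset ℕ} (hA : ArcSystem f B T)
    {ls : List ℕ} (hT : ∀ i ∈ ls, i ∈ T) (h : ls.Pairwise fun i j => j < i ∨ f i < j) :
    InnerFirst f ls := by
  refine ⟨fun i hi => hA.lt i (hT i hi), ?_⟩
  rw [List.pairwise_iff_forall_sublist] at h ⊢
  intro i j hij
  have hi := hT i (hij.subset (by simp))
  have hj := hT j (hij.subset (by simp))
  have h1 := h hij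
  refine ⟨h1, ?_⟩
  have h2 := hA.noncrossing j hj i hi
  have h3 := hA.lt i hi
  have h4 := hA.lt j hj
  have h5 : f j ≠ i := by rintro rfl; rw [hA.invol] at h3; omega
  have h6 : f j ≠ f i := by
    intro e
    have := hA.invol j
    rw [e, hA.invol] at this
    omega
  unfold OffArc
  omega

theorem pairwise_sort_ge (T : Finset ℕ) : (T.sort (· ≥ ·)).Pairwise fun i j => j < i := by
  have h1 := T.pairwise_sort (· ≥ ·)
  have h2 := T.sort_nodup (· ≥ ·)
  exact (h1.and h2).imp fun h => lt_of_le_of_ne h.1 h.2.symm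

theorem innerFirst_sort {f : ℕ → ℕ} {B : ℕ} {T : Finset ℕ} (hA : ArcSystem f B T) :
    InnerFirst f (T.sort (· ≥ ·)) :=
  hA.innerFirst (fun _ hi => (Finset.mem_sort _).1 hi) ((pairwise_sort_ge T).imp Or.inl)

/-- The left endpoints, to the right of `a`, of the arcs other than that of `c`, from right to
left. -/
def innerLefts (M : PerfectMatching (2 * n)) (a c : ℕ) : List ℕ :=
  ((natLefts M).filter fun r => a < r ∧ r ≠ c).sort (· ≥ ·)

/-- The left endpoints smaller than `a`, from right to left. -/
def outerLefts (M : PerfectMatching (2 * n)) (a : ℕ) : List ℕ :=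
  ((natLefts M).filter fun r => r < a).sort (· ≥ ·)

theorem mem_innerLefts {M : PerfectMatching (2 * n)} {a c r : ℕ} :
    r ∈ innerLefts M a c ↔ r ∈ natLefts M ∧ a < r ∧ r ≠ c := by simp [innerLefts]

theorem mem_outerLefts {M : PerfectMatching (2 * n)} {a r : ℕ} :
    r ∈ outerLefts M a ↔ r ∈ natLefts M ∧ r < a := by simp [outerLefts]

section

variable {α β : CrossinglessMatching (2 * n)} {a b c d : Fin (2 * n)}

theorem _root_.ArcMove.natPartner_eq (h : ArcMove α β a b c d) {r : ℕ} (ha : r ≠ a) (hb : r ≠ b)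
    (hc : r ≠ c) (hd : r ≠ d) :
    natPartner α.toPerfectMatching r = natPartner β.toPerfectMatching r := by
  unfold natPartner
  split_ifs with hr
  · have h1 : ∀ x : Fin (2 * n), r ≠ x → (⟨r, hr⟩ : Fin (2 * n)) ≠ x := fun x hx e =>
      hx (by rw [← e])
    rw [h.eq_elsewhere _ (h1 a ha) (h1 b hb) (h1 c hc) (h1 d hd)]
  · rfl

theorem _root_.ArcMove.natPartner_values (h : ArcMove α β a b c d) :
    natPartner α.toPerfectMatching a = b ∧ natPartner α.toPerfectMatching b = a ∧
      natPartner α.toPerfectMatching c = d ∧ natPartner α.toPerfectMatching d = c ∧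
      natPartner β.toPerfectMatching a = d ∧ natPartner β.toPerfectMatching d = a ∧
      natPartner β.toPerfectMatching b = c ∧ natPartner β.toPerfectMatching c = b := by
  have e1 : natPartner α.toPerfectMatching a = b := by rw [natPartner_val, h.left_ab]
  have e2 : natPartner α.toPerfectMatching c = d := by rw [natPartner_val, h.left_cd]
  have e3 : natPartner β.toPerfectMatching a = d := by rw [natPartner_val, h.right_ad]
  have e4 : natPartner β.toPerfectMatching b = c := by rw [natPartner_val, h.right_bc]
  refine ⟨e1, ?_, e2, ?_, e3, ?_, e4, ?_⟩
  · rw [← e1, natPartner_natPartner]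
  · rw [← e2, natPartner_natPartner]
  · rw [← e3, natPartner_natPartner]
  · rw [← e4, natPartner_natPartner]

theorem _root_.ArcMove.mem_natLefts_right (h : ArcMove α β a b c d) {r : ℕ} :
    r ∈ natLefts β.toPerfectMatching ↔
      r = b ∨ (r ≠ c ∧ r ∈ natLefts α.toPerfectMatching) := by
  obtain ⟨e1, e2, e3, e4, e5, e6, e7, e8⟩ := h.natPartner_values
  have h1 := Fin.lt_def.1 h.lt_ab
  have h2 := Fin.lt_def.1 h.lt_bc
  have h3 := Fin.lt_def.1 h.lt_cd
  rw [mem_natLefts, mem_natLefts]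
  by_cases ha : r = a
  · subst ha; rw [e1, e5]; omega
  by_cases hb : r = b
  · subst hb; rw [e2, e7]; omega
  by_cases hc : r = c
  · subst hc; rw [e3, e8]; omega
  by_cases hd : r = d
  · subst hd; rw [e4, e6]; omega
  rw [h.natPartner_eq ha hb hc hd]
  simp [hb, hc]

/-- Lists of arcs for the local move. -/
theorem _root_.ArcMove.listMove (h : ArcMove α β a b c d) :
    ListMove (natPartner α.toPerfectMatching) (natPartner β.toPerfectMatching) a b c d
      (innerLefts α.toPerfectMatching a c) (outerLefts α.toPerfectMatching a) := by
  obtain ⟨e1, e2, e3, e4, e5, e6, e7, e8⟩ := h.natPartner_values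
  have h1 := Fin.lt_def.1 h.lt_ab
  have h2 := Fin.lt_def.1 h.lt_bc
  have h3 := Fin.lt_def.1 h.lt_cd
  have hα := arcSystem_natPartner α
  have hβ := arcSystem_natPartner β
  have hin : ∀ i ∈ innerLefts α.toPerfectMatching a c,
      (i < 2 * n ∧ i < natPartner α.toPerfectMatching i) ∧ a < i ∧ i ≠ b ∧ i ≠ c ∧ i ≠ d := by
    intro i hi
    rw [mem_innerLefts, mem_natLefts] at hi
    refine ⟨hi.1, hi.2.1, ?_, hi.2.2, ?_⟩
    · rintro rfl; rw [e2] at hi; omega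
    · rintro rfl; rw [e4] at hi; omega
  have hout : ∀ i ∈ outerLefts α.toPerfectMatching a,
      (i < 2 * n ∧ i < natPartner α.toPerfectMatching i) ∧ i < a := by
    intro i hi
    rwa [mem_outerLefts, mem_natLefts] at hi
  have eqin : ∀ i ∈ innerLefts α.toPerfectMatching a c,
      natPartner α.toPerfectMatching i = natPartner β.toPerfectMatching i := fun i hi =>
    h.natPartner_eq (by have := hin i hi; omega) (hin i hi).2.2.1 (hin i hi).2.2.2.1
      (hin i hi).2.2.2.2
  have eqout : ∀ i ∈ outerLefts α.toPerfectMatching a,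
      natPartner α.toPerfectMatching i = natPartner β.toPerfectMatching i := fun i hi =>
    h.natPartner_eq (by have := hout i hi; omega) (by have := hout i hi; omega)
      (by have := hout i hi; omega) (by have := hout i hi; omega)
  refine ⟨h1, h2, h3, e1, e3, e5, e7, eqin, eqout, hα.innerFirst ?_ ?_, hβ.innerFirst ?_ ?_⟩
  · intro i hi
    simp only [List.mem_append, List.mem_cons, mem_innerLefts, mem_outerLefts] at hi
    rcases hi with hi | rfl | rfl | hi
    exacts [hi.1, mem_natLefts.2 ⟨a.2, by omega⟩, mem_natLefts.2 ⟨c.2, by omega⟩, hi.1]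
  · simp only [List.pairwise_append, List.pairwise_cons, List.mem_cons]
    refine ⟨(pairwise_sort_ge _).imp Or.inl, ⟨?_, ?_, (pairwise_sort_ge _).imp Or.inl⟩, ?_⟩
    · rintro i (rfl | hi)
      · omega
      · have := hout i hi; omega
    · intro i hi
      have := hout i hi; omega
    · intro i hi j hj
      have hi' := hin i hi
      rcases hj with rfl | rfl | hj
      · omega
      · by_contra hlt
        have h4 := fun h5 h6 h7 => natPartner_crossingless α (i := i) (j := c) c.2 h5 h6 h7
        have h5 := fun h6 h7 => natPartner_crossingless β (i := a) (j := i) hi'.1.1 hi'.2.1 h6 h7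
        rw [e3] at h4
        rw [e5, ← eqin i hi] at h5
        have h6 : natPartner α.toPerfectMatching i ≠ c := by
          intro h6
          have := natPartner_natPartner α.toPerfectMatching i
          rw [h6] at this; omega
        have h7 : natPartner α.toPerfectMatching i ≠ d := by
          intro h6
          have := natPartner_natPartner α.toPerfectMatching i
          rw [h6] at this; omega
        by_cases h8 : natPartner α.toPerfectMatching i < d
        · exact h4 (by omega) (by omega) h8
        · exact h5 (by omega) (by omega)
      · have := hout j hj; omega
  · intro i hi
    simp only [List.mem_append, List.mem_cons, mem_innerLefts, mem_outerLefts] at hi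
    rw [h.mem_natLefts_right]
    rcases hi with hi | rfl | rfl | hi
    exacts [Or.inr ⟨hi.2.2, hi.1⟩, Or.inl rfl, Or.inr ⟨by omega, mem_natLefts.2 ⟨a.2, by omega⟩⟩,
      Or.inr ⟨by omega, hi.1⟩]
  · simp only [List.pairwise_append, List.pairwise_cons, List.mem_cons]
    refine ⟨(pairwise_sort_ge _).imp Or.inl, ⟨?_, ?_, (pairwise_sort_ge _).imp Or.inl⟩, ?_⟩
    · rintro i (rfl | hi)
      · omega
      · have := hout i hi; omega
    · intro i hi
      have := hout i hi; omega
    · intro i hi j hj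
      have hi' := hin i hi
      rw [← eqin i hi]
      rcases hj with rfl | rfl | hj
      · by_contra hlt
        have h4 := fun h6 h7 => natPartner_crossingless α (i := a) (j := i) hi'.1.1 hi'.2.1 h6 h7
        rw [e1] at h4
        have h6 : natPartner α.toPerfectMatching i ≠ b := by
          intro h6
          have := natPartner_natPartner α.toPerfectMatching i
          rw [h6] at this; omega
        exact h4 (by omega) (by omega)
      · omega
      · have := hout j hj; omega

/-- The two lists of `ArcMove.listMove` contain all arcs of the matchings, in an order that differs
from the one in `evQuot_expansionMap_single`. -/
theorem _root_.ArcMove.perm_left (h : ArcMove α β a b c d) :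
    ((natLefts α.toPerfectMatching).sort (· ≥ ·)).Perm
      (innerLefts α.toPerfectMatching a c ++ (a : ℕ) :: (c : ℕ) :: outerLefts α.toPerfectMatching a) := by
  obtain ⟨e1, e2, e3, e4, e5, e6, e7, e8⟩ := h.natPartner_values
  have h1 := Fin.lt_def.1 h.lt_ab
  have h2 := Fin.lt_def.1 h.lt_bc
  have h3 := Fin.lt_def.1 h.lt_cd
  refine (List.perm_ext_iff_of_nodup (Finset.sort_nodup _ _) h.listMove.inner_f.nodup).2 fun r => ?_
  simp only [Finset.mem_sort, List.mem_append, List.mem_cons, mem_innerLefts, mem_outerLefts]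
  have ha : (a : ℕ) ∈ natLefts α.toPerfectMatching := mem_natLefts.2 ⟨a.2, by omega⟩
  have hc : (c : ℕ) ∈ natLefts α.toPerfectMatching := mem_natLefts.2 ⟨c.2, by omega⟩
  constructor
  · intro hr
    rcases lt_trichotomy r a with h4 | h4 | h4
    · exact Or.inr (Or.inr (Or.inr ⟨hr, h4⟩))
    · exact Or.inr (Or.inl h4)
    · by_cases h5 : r = c
      · exact Or.inr (Or.inr (Or.inl h5))
      · exact Or.inl ⟨hr, h4, h5⟩
  · rintro (hr | rfl | rfl | hr)
    exacts [hr.1, ha, hc, hr.1]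

theorem _root_.ArcMove.perm_right (h : ArcMove α β a b c d) :
    ((natLefts β.toPerfectMatching).sort (· ≥ ·)).Perm
      (innerLefts α.toPerfectMatching a c ++ (b : ℕ) :: (a : ℕ) :: outerLefts α.toPerfectMatching a) := by
  obtain ⟨e1, e2, e3, e4, e5, e6, e7, e8⟩ := h.natPartner_values
  have h1 := Fin.lt_def.1 h.lt_ab
  have h2 := Fin.lt_def.1 h.lt_bc
  have h3 := Fin.lt_def.1 h.lt_cd
  refine (List.perm_ext_iff_of_nodup (Finset.sort_nodup _ _) h.listMove.inner_g.nodup).2 fun r => ?_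
  simp only [Finset.mem_sort, List.mem_append, List.mem_cons, mem_innerLefts, mem_outerLefts,
    h.mem_natLefts_right]
  have ha : (a : ℕ) ∈ natLefts α.toPerfectMatching := mem_natLefts.2 ⟨a.2, by omega⟩
  constructor
  · rintro (rfl | ⟨h4, hr⟩)
    · exact Or.inr (Or.inl rfl)
    rcases lt_trichotomy r a with h5 | h5 | h5
    · exact Or.inr (Or.inr (Or.inr ⟨hr, h5⟩))
    · exact Or.inr (Or.inr (Or.inl h5))
    · exact Or.inl ⟨hr, h5, h4⟩
  · rintro (hr | rfl | rfl | hr)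
    exacts [Or.inr ⟨hr.2.2, hr.1⟩, Or.inl rfl, Or.inr ⟨by omega, ha⟩, Or.inr ⟨by omega, hr.1⟩]

theorem _root_.ArcMove.cover_iff (h : ArcMove α β a b c d) (x : Fin (2 * n)) :
    ((x : ℕ) ∈ outerLefts α.toPerfectMatching a ∧ (x : ℕ) < a ∧
      (a : ℕ) ≤ natPartner α.toPerfectMatching x) ↔ x < a ∧ d < α.partner x := by
  obtain ⟨e1, e2, e3, e4, e5, e6, e7, e8⟩ := h.natPartner_values
  have h1 := Fin.lt_def.1 h.lt_ab
  have h2 := Fin.lt_def.1 h.lt_bc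
  have h3 := Fin.lt_def.1 h.lt_cd
  rw [mem_outerLefts, mem_natLefts, Fin.lt_def, Fin.lt_def, ← natPartner_val]
  constructor
  · rintro ⟨⟨h4, h5⟩, _, h6⟩
    refine ⟨h5, ?_⟩
    have h7 : natPartner α.toPerfectMatching x ≠ a := by
      intro h7
      have := natPartner_natPartner α.toPerfectMatching x
      rw [h7] at this; omega
    have h8 : natPartner α.toPerfectMatching x ≠ d := by
      intro h7
      have := natPartner_natPartner α.toPerfectMatching x
      rw [h7] at this; omega
    have h9 := fun h10 h11 => natPartner_crossingless β (i := x) (j := a) a.2 h5 h10 h11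
    rw [e5, ← h.natPartner_eq (by omega) (by omega) (by omega) (by omega)] at h9
    by_contra h10
    exact h9 (by omega) (by omega)
  · rintro ⟨h4, h5⟩
    exact ⟨⟨⟨x.2, by omega⟩, h4⟩, h4, by omega⟩

variable {s : Finset (Fin (2 * n))}

theorem mem_map_val {s : Finset (Fin (2 * n))} {x : Fin (2 * n)} :
    (x : ℕ) ∈ s.map Fin.valEmbedding ↔ x ∈ s := by
  simp only [Finset.mem_map, Fin.valEmbedding_apply]
  exact ⟨fun ⟨i, hi, h⟩ => Fin.ext h ▸ hi, fun h => ⟨x, h, rfl⟩⟩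

theorem _root_.ArcMove.covers_eq (h : ArcMove α β a b c d) :
    covers (natPartner α.toPerfectMatching) (s.map Fin.valEmbedding)
      (outerLefts α.toPerfectMatching a) a = (outerUndotted α s a d).map Fin.valEmbedding := by
  have key : ∀ x : Fin (2 * n), (x : ℕ) ∈ covers (natPartner α.toPerfectMatching)
      (s.map Fin.valEmbedding) (outerLefts α.toPerfectMatching a) a ↔
      (x : ℕ) ∈ (outerUndotted α s a d).map Fin.valEmbedding := by
    intro x
    rw [mem_map_val]
    have := h.cover_iff x
    simp only [covers, outerUndotted, Finset.mem_filter, List.mem_toFinset, Finset.mem_univ,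
      true_and, mem_map_val] at this ⊢
    tauto
  ext r
  by_cases hr : r < 2 * n
  · exact key ⟨r, hr⟩
  · refine iff_of_false (fun h' => hr ?_) fun h' => hr ?_
    · simp only [covers, Finset.mem_filter, List.mem_toFinset, mem_outerLefts, mem_natLefts] at h'
      exact h'.1.1.1
    · obtain ⟨i, _, rfl⟩ := Finset.mem_map.1 h'
      exact i.2

theorem _root_.ArcMove.coverCount_eq (h : ArcMove α β a b c d) (x : Fin (2 * n)) (e : Bool) :
    coverCount (natPartner α.toPerfectMatching) (s.map Fin.valEmbedding)
      (outerLefts α.toPerfectMatching a) a x e =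
    (Finset.univ.filter fun y : Fin (2 * n) =>
      x < y ∧ (y < a ∧ d < α.partner y) ∧ decide (y ∈ s) = e).card := by
  have hnd : (outerLefts α.toPerfectMatching a).Nodup := Finset.sort_nodup _ _
  rw [coverCount, ← List.toFinset_card_of_nodup (hnd.filter _), ← Finset.card_map Fin.valEmbedding]
  congr 1
  have key : ∀ y : Fin (2 * n), (y : ℕ) ∈ ((outerLefts α.toPerfectMatching a).filter fun y : ℕ =>
      decide ((x : ℕ) < y ∧ y < (a : ℕ) ∧ (a : ℕ) ≤ natPartner α.toPerfectMatching y ∧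
        decide (y ∈ s.map Fin.valEmbedding) = e)).toFinset ↔ (y : ℕ) ∈ (Finset.univ.filter fun y : Fin (2 * n) =>
      x < y ∧ (y < a ∧ d < α.partner y) ∧ decide (y ∈ s) = e).map Fin.valEmbedding := by
    intro y
    rw [mem_map_val]
    have h1 := h.cover_iff y
    have h2 : decide ((y : ℕ) ∈ s.map Fin.valEmbedding) = decide (y ∈ s) := by
      rw [decide_eq_decide, mem_map_val]
    simp only [Finset.mem_filter, List.mem_toFinset, List.mem_filter, Finset.mem_univ, true_and,
      decide_eq_true_eq, h2, Fin.lt_def] at h1 ⊢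
    tauto
  ext r
  by_cases hr : r < 2 * n
  · exact key ⟨r, hr⟩
  · refine iff_of_false (fun h' => hr ?_) fun h' => hr ?_
    · simp only [List.mem_toFinset, List.mem_filter, mem_outerLefts, mem_natLefts] at h'
      exact h'.1.1.1
    · obtain ⟨i, _, rfl⟩ := Finset.mem_map.1 h'
      exact i.2

theorem _root_.ArcMove.coverExp_eq (h : ArcMove α β a b c d) {x : Fin (2 * n)} (hx : x ∈ outerUndotted α s a d) :
    coverExp (natPartner α.toPerfectMatching) (s.map Fin.valEmbedding)
      (outerLefts α.toPerfectMatching a) a x =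
    (outerIndex α s a d x : ℤ) - 1 - dottedBetween α s a d x := by
  have hx' := (Finset.mem_filter.1 hx).2
  rw [coverExp, h.coverCount_eq, h.coverCount_eq]
  have e1 : outerIndex α s a d x = (Finset.univ.filter fun y : Fin (2 * n) =>
      x < y ∧ (y < a ∧ d < α.partner y) ∧ decide (y ∈ s) = false).card + 1 := by
    rw [outerIndex, ← Finset.card_insert_of_notMem (a := x) (by simp)]
    congr 1
    ext y
    simp only [outerUndotted, Finset.mem_filter, Finset.mem_univ, true_and, Finset.mem_insert,
      decide_eq_false_iff_not]
    constructor
    · rintro ⟨h1, h2⟩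
      rcases h2.lt_or_eq with h3 | h3
      · exact Or.inr ⟨h3, ⟨h1.1, h1.2.1⟩, h1.2.2⟩
      · exact Or.inl h3.symm
    · rintro (rfl | h1)
      · exact ⟨hx', le_rfl⟩
      · exact ⟨⟨h1.2.1.1, h1.2.1.2, h1.2.2⟩, h1.1.le⟩
  have e2 : dottedBetween α s a d x = (Finset.univ.filter fun y : Fin (2 * n) =>
      x < y ∧ (y < a ∧ d < α.partner y) ∧ decide (y ∈ s) = true).card := by
    rw [dottedBetween]
    congr 1
    ext y
    simp only [Finset.mem_filter, Finset.mem_univ, true_and, decide_eq_true_eq]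
    constructor
    · rintro ⟨h1, h2, h3, h4, h5⟩
      exact ⟨h2, ⟨h3, h4⟩, h1⟩
    · rintro ⟨h2, ⟨h3, h4⟩, h1⟩
      refine ⟨h1, h2, h3, h4, ?_⟩
      have h5 := α.crossingless x y
      have h6 : α.partner x ≠ α.partner y := fun e => h2.ne (by
        rw [← α.partner_partner x, e, α.partner_partner])
      have had : a < d := h.lt_ab.trans (h.lt_bc.trans h.lt_cd)
      refine lt_of_le_of_ne (not_lt.1 fun h7 => h5 ⟨h2, ?_, h7⟩) h6.symm
      exact h3.trans (had.trans hx'.2.1)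
  rw [e1, e2]
  push_cast
  ring

end

/-- The coordinates of the image of an element of the free module on dotted matchings. -/
noncomputable def evRussell (n k : ℕ) : FreeRussell n k →ₗ[QLaurent] Coord :=
  ((evQuot n k ∘ₗ (klEncloseRange n k).mkQ).restrictScalars QLaurent) ∘ₗ expansionMap n k

theorem evRussell_apply (r : FreeRussell n k) :
    evRussell n k r = evQuot n k ((klEncloseRange n k).mkQ (expansionMap n k r)) := rfl

theorem evQuot_of_length_ne {l : List Bool} (hl : l.length ≠ 2 * n) (y : KLQuotient n k) :
    evQuot n k y l = 0 := by
  obtain ⟨y, rfl⟩ := Submodule.mkQ_surjective _ y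
  obtain ⟨y, rfl⟩ := Submodule.mkQ_surjective _ y
  change evPad n k y l = 0
  simp [evPad, hl]

theorem smul_coord (p : QLaurent) (v : Coord) (l : List Bool) : (p • v) l = qInclusion p * v l :=
  Algebra.smul_def p (v l)

theorem evRussell_of_isDiagram {x : DottedMatching n k} {α : CrossinglessMatching (2 * n)}
    {t : Finset (Fin (2 * n))} (hx : x.IsDiagram α t) {ls : List ℕ}
    (hls : InnerFirst (natPartner α.toPerfectMatching) ls)
    (hperm : ((natLefts α.toPerfectMatching).sort (· ≥ ·)).Perm ls) {l : List Bool}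
    (hl : l.length = 2 * n) :
    evRussell n k (Finsupp.single x 1) l = russellUnit k *
      arcsSt (natPartner α.toPerfectMatching) (t.map Fin.valEmbedding) ls
        fun r => l.getD r false := by
  obtain ⟨rfl, rfl⟩ := hx
  rw [evRussell_apply, evQuot_expansionMap_single x hl]
  rw [arcsSt_perm hperm (innerFirst_sort (arcSystem_natPartner _)) hls]
  rfl

theorem qPow_neg_one : qInclusion (qPow (-1)) = hqi ^ 2 := by
  rw [qInclusion_qPow, hqi_pow]; rfl

theorem qPow_neg_two : qInclusion (qPow (-2)) = hqi ^ 4 := by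
  rw [qInclusion_qPow, hqi_pow]; rfl

theorem evRussell_typeI {r : FreeRussell n k} (hr : r ∈ typeIRelations n k) :
    evRussell n k r = 0 := by
  obtain ⟨α, β, a, b, c, d, s, m, m₁, m₂, m₁', mx, h, ha, hb, hc, hd, hm, hm₁, hm₂, hm₁', hmx,
    rfl⟩ := hr
  funext l
  by_cases hl : l.length = 2 * n
  swap
  · rw [evRussell_apply, evQuot_of_length_ne hl]; rfl
  have hA := fun {x : DottedMatching n k} {t} (hx : x.IsDiagram α t) =>
    evRussell_of_isDiagram hx h.listMove.inner_f h.perm_left hl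
  have hB := fun {x : DottedMatching n k} {t} (hx : x.IsDiagram β t) =>
    evRussell_of_isDiagram hx h.listMove.inner_g h.perm_right hl
  have key := h.listMove.typeI (s := s.map Fin.valEmbedding) (by rwa [mem_map_val])
    (by rwa [mem_map_val]) (by rwa [mem_map_val]) fun r => l.getD r false
  rw [h.covers_eq, Finset.sum_map] at key
  simp only [map_sub, map_add, map_smul, map_sum, Pi.sub_apply, Pi.add_apply, smul_coord,
    Finset.sum_apply, qPow_neg_one, qPow_neg_two, map_one]
  rw [hB hm, hA hm₁, hA hm₂, hB hm₁', Finset.sum_congr rfl fun x hx => by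
    rw [hA (hmx x hx), Finset.map_insert, Fin.valEmbedding_apply, qInclusion_qPow,
      show (outerIndex α s a d x : ℤ) - dottedBetween α s a d x =
        coverExp (natPartner α.toPerfectMatching) (s.map Fin.valEmbedding)
          (outerLefts α.toPerfectMatching a) a x + 1 by rw [h.coverExp_eq hx]; ring,
      mul_left_comm], ← Finset.mul_sum]
  simp only [Finset.map_insert, Fin.valEmbedding_apply] at key ⊢
  rw [key]
  simp only [Pi.zero_apply]
  ring

theorem evRussell_typeII {r : FreeRussell n k} (hr : r ∈ typeIIRelations n k) :
    evRussell n k r = 0 := by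
  obtain ⟨α, β, a, b, c, d, s, m, m', mx, h, ha, hb, hc, hd, hm, hm', hmx, rfl⟩ := hr
  funext l
  by_cases hl : l.length = 2 * n
  swap
  · rw [evRussell_apply, evQuot_of_length_ne hl]; rfl
  have hA := fun {x : DottedMatching n k} {t} (hx : x.IsDiagram α t) =>
    evRussell_of_isDiagram hx h.listMove.inner_f h.perm_left hl
  have hB := fun {x : DottedMatching n k} {t} (hx : x.IsDiagram β t) =>
    evRussell_of_isDiagram hx h.listMove.inner_g h.perm_right hl
  have key := h.listMove.typeII (s := s.map Fin.valEmbedding) (b := b) (by rwa [mem_map_val])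
    fun r => l.getD r false
  rw [h.covers_eq, Finset.sum_map] at key
  simp only [map_sub, map_add, map_smul, map_sum, Pi.sub_apply, Pi.add_apply, smul_coord,
    Finset.sum_apply, qPow_neg_two, map_one]
  rw [hA hm, hB hm', Finset.sum_congr rfl fun x hx => by
    rw [hB (hmx x hx), Finset.map_insert, Finset.map_insert, Fin.valEmbedding_apply,
      qInclusion_qPow, ← h.coverExp_eq hx,
      mul_left_comm], ← Finset.mul_sum]
  simp only [Finset.map_insert, Fin.valEmbedding_apply] at key ⊢
  rw [key]
  simp only [Pi.zero_apply]
  ring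

theorem russellRelations_le_ker : russellRelations n k ≤ LinearMap.ker (evRussell n k) :=
  Submodule.span_le.2 fun _ hr => LinearMap.mem_ker.2
    (hr.elim evRussell_typeI evRussell_typeII)

end Skein


namespace Skein

open Diagram

/-! ### Diagrams without crossings and maxima -/

/-- The submodule spanned by the Kauffman–Lins relations. -/
noncomputable def relSpan (m : ℕ) : Submodule HalfLaurent (Comb m) :=
  Submodule.span HalfLaurent {x | Relation m x}

/-- Two diagrams are equal modulo the Kauffman–Lins relations. -/
def Same {m : ℕ} (D D' : Diagram m) : Prop := of D - of D' ∈ relSpan m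

theorem Same.refl {m : ℕ} (D : Diagram m) : Same D D := by simp [Same]

theorem Same.symm {m : ℕ} {D D' : Diagram m} (h : Same D D') : Same D' D := by
  have := (relSpan m).neg_mem h
  rwa [neg_sub] at this

theorem Same.trans {m : ℕ} {D D' D'' : Diagram m} (h : Same D D') (h' : Same D' D'') :
    Same D D'' := by
  have := (relSpan m).add_mem h h'
  rwa [sub_add_sub_cancel] at this

theorem same_of_relation {m : ℕ} {D D' : Diagram m} (h : Relation m (of D - of D')) : Same D D' :=
  Submodule.subset_span h

theorem mapDomain_of {m m' : ℕ} (f : Diagram m → Diagram m') (D : Diagram m) :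
    (of D).mapDomain f = of (f D) := Finsupp.mapDomain_single

theorem mapDomain_sub' {m m' : ℕ} (f : Diagram m → Diagram m') (x y : Comb m) :
    (x - y).mapDomain f = x.mapDomain f - y.mapDomain f :=
  map_sub (Finsupp.lmapDomain HalfLaurent HalfLaurent f) x y

theorem relSpan_mapDomain {m m' : ℕ} (f : Diagram m → Diagram m')
    (hf : ∀ x, Relation m x → Relation m' (x.mapDomain f)) {x : Comb m} (hx : x ∈ relSpan m) :
    x.mapDomain f ∈ relSpan m' := by
  have : relSpan m ≤ (relSpan m').comap (Finsupp.lmapDomain HalfLaurent HalfLaurent f) :=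
    Submodule.span_le.2 fun x hx => Submodule.subset_span (hf x hx)
  exact this hx

theorem Same.cup {m : ℕ} {D D' : Diagram m} (h : Same D D') (i : ℕ) (hi : i ≤ m) :
    Same (cup i hi D) (cup i hi D') := by
  have := relSpan_mapDomain (Diagram.cup i hi) (fun x hx => Relation.below_cup i hi x hx) h
  rwa [mapDomain_sub', mapDomain_of, mapDomain_of] at this

/-- The diagram consists of minima only, and `w` is the word of its endpoints, in which left
ends of arcs are represented by `true` and right ends by `false`. -/
inductive CupWord : ∀ {m : ℕ}, Diagram m → List Bool → Prop
  | empty : CupWord empty []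
  | cup {m : ℕ} {i : ℕ} (hi : i ≤ m) {D : Diagram m} {w₁ w₂ : List Bool} (hw : w₁.length = i)
      (h : CupWord D (w₁ ++ w₂)) : CupWord (cup i hi D) (w₁ ++ true :: false :: w₂)

theorem CupWord.length_eq {m : ℕ} {D : Diagram m} {w : List Bool} (h : CupWord D w) :
    w.length = m := by
  induction h with
  | empty => rfl
  | cup hi hw h ih => simp at ih ⊢; omega

theorem append_eq_append_of_lt {w₁ w₂ v₁ v₂ : List Bool} (h : w₁ ++ w₂ = v₁ ++ v₂)
    (hl : v₁.length ≤ w₁.length) : ∃ u, w₁ = v₁ ++ u ∧ v₂ = u ++ w₂ := by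
  rcases List.append_eq_append_iff.1 h with ⟨u, h1, h2⟩ | ⟨u, h1, h2⟩
  · have : u = [] := by
      have := congrArg List.length h1
      simp at this
      exact List.eq_nil_of_length_eq_zero (by omega)
    subst this
    exact ⟨[], by simpa using h1.symm, by simpa using h2.symm⟩
  · exact ⟨u, h1, h2⟩

/-- A minimum that joins two neighbouring endpoints may be moved to the top. -/
theorem CupWord.exists_same_cup {m : ℕ} {D : Diagram (m + 2)} {w : List Bool} (h : CupWord D w) :
    ∀ {v₁ v₂ : List Bool}, w = v₁ ++ true :: false :: v₂ → ∃ (hj : v₁.length ≤ m) (D' : Diagram m),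
      CupWord D' (v₁ ++ v₂) ∧ Same D (Diagram.cup v₁.length hj D') := by
  induction m using Nat.strong_induction_on generalizing w with
  | _ m ih =>
  intro v₁ v₂ hw
  cases h with
  | @cup _ i hi D w₁ w₂ hi' h =>
  have hlen := h.length_eq
  have hlen' := congrArg List.length hw
  simp only [List.length_append, List.length_cons] at hlen hlen'
  have hj : v₁.length ≤ m := by omega
  refine ⟨hj, ?_⟩
  rcases lt_trichotomy v₁.length i with hlt | heq | hgt
  · obtain ⟨u, rfl, hu⟩ := append_eq_append_of_lt hw (by omega)
    rcases u with _ | ⟨x, _ | ⟨y, u⟩⟩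
    · simp at hi'; omega
    · simp at hu
    · simp only [List.cons_append, List.cons.injEq] at hu
      obtain ⟨rfl, rfl, rfl⟩ := hu
      simp only [List.append_assoc, List.cons_append] at h
      simp only [List.length_append, List.length_cons] at hlen hi'
      obtain ⟨m, rfl⟩ : ∃ m', m = m' + 2 := ⟨m - 2, by omega⟩
      obtain ⟨hj', D', h1, h2⟩ := ih m (by omega) h rfl
      refine ⟨Diagram.cup (i - 2) (by omega) D', ?_, ?_⟩
      · rw [← List.append_assoc]
        rw [← List.append_assoc] at h1
        exact CupWord.cup _ (by simp; omega) h1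
      · refine (h2.cup i hi).trans ?_
        obtain ⟨i, rfl⟩ : ∃ i', i = i' + 2 := ⟨i - 2, by omega⟩
        exact (same_of_relation (Relation.cup_cup _ i (by omega) hj' hj (by omega) hi D')).symm
  · subst heq
    obtain ⟨h1, h2⟩ := List.append_inj hw hi'
    obtain rfl : w₂ = v₂ := by simpa using h2
    subst h1
    exact ⟨D, h, Same.refl _⟩
  · obtain ⟨u, rfl, hu⟩ := append_eq_append_of_lt hw.symm (by omega)
    rcases u with _ | ⟨x, _ | ⟨y, u⟩⟩
    · simp at hgt; omega
    · simp at hu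
    · simp only [List.cons_append, List.cons.injEq] at hu
      obtain ⟨rfl, rfl, rfl⟩ := hu
      rw [← List.append_assoc] at h
      simp only [List.length_append, List.length_cons] at hlen hgt hj
      obtain ⟨m, rfl⟩ : ∃ m', m = m' + 2 := ⟨m - 2, by omega⟩
      obtain ⟨hj', D', h1, h2⟩ := ih m (by omega) h rfl
      refine ⟨Diagram.cup i (by omega) D', ?_, ?_⟩
      · simp only [List.append_assoc, List.cons_append] at h1 ⊢
        exact CupWord.cup _ hi' h1
      · refine (h2.cup i hi).trans ?_
        have := same_of_relation (Relation.cup_cup i (w₁ ++ u).length (by simp; omega) (by omega)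
          hi hj' (by simp; omega) D')
        convert this using 2
        simp; omega

/-- Diagrams without crossings and maxima that have the same word are isotopic. -/
theorem CupWord.same {m : ℕ} {D D' : Diagram m} {w : List Bool} (h : CupWord D w)
    (h' : CupWord D' w) : Same D D' := by
  induction h with
  | empty => cases h'; exact Same.refl _
  | cup hi hw h ih =>
    subst hw
    obtain ⟨_, D₂, h1, h2⟩ := h'.exists_same_cup rfl
    exact ((ih h1).cup _ _).trans h2.symm

/-! ### Elimination of crossings and maxima -/

/-- The submodule generated by the Kauffman–Lins relations and the diagrams without crossings and
maxima. -/
noncomputable def cupSpan (m : ℕ) : Submodule HalfLaurent (Comb m) :=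
  Submodule.span HalfLaurent ({x | Relation m x} ∪ of '' {D | ∃ w, CupWord D w})

theorem relSpan_le_cupSpan (m : ℕ) : relSpan m ≤ cupSpan m :=
  Submodule.span_mono Set.subset_union_left

theorem CupWord.mem_cupSpan {m : ℕ} {D : Diagram m} {w : List Bool} (h : CupWord D w) :
    of D ∈ cupSpan m := Submodule.subset_span (Or.inr ⟨D, ⟨w, h⟩, rfl⟩)

theorem mem_cupSpan_of_relation {m : ℕ} {D : Diagram m} {y : Comb m}
    (h : Relation m (of D - y)) (hy : y ∈ cupSpan m) : of D ∈ cupSpan m := by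
  have := (cupSpan m).add_mem (relSpan_le_cupSpan m (Submodule.subset_span h)) hy
  rwa [sub_add_cancel] at this

theorem cupSpan_mapDomain {m m' : ℕ} (f : Diagram m → Diagram m')
    (hf : ∀ x, Relation m x → Relation m' (x.mapDomain f))
    (hf' : ∀ D w, CupWord D w → of (f D) ∈ cupSpan m') {x : Comb m} (hx : x ∈ cupSpan m) :
    x.mapDomain f ∈ cupSpan m' := by
  have : cupSpan m ≤ (cupSpan m').comap (Finsupp.lmapDomain HalfLaurent HalfLaurent f) := by
    refine Submodule.span_le.2 ?_
    rintro x (hx | ⟨D, ⟨w, h⟩, rfl⟩)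
    · exact relSpan_le_cupSpan m' (Submodule.subset_span (hf x hx))
    · change (of D).mapDomain f ∈ cupSpan m'
      rw [mapDomain_of]
      exact hf' D w h
  exact this hx

theorem CupWord.cup' {m : ℕ} {i : ℕ} (hi : i ≤ m) {D : Diagram m} {w : List Bool}
    (h : CupWord D w) : CupWord (Diagram.cup i hi D) (w.take i ++ true :: false :: w.drop i) :=
  CupWord.cup hi (by simp [h.length_eq, hi]) (by rwa [List.take_append_drop])

theorem cup_mem_cupSpan {m : ℕ} {i : ℕ} (hi : i ≤ m) {D : Diagram m} (h : of D ∈ cupSpan m) :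
    of (Diagram.cup i hi D) ∈ cupSpan (m + 2) := by
  have := cupSpan_mapDomain (Diagram.cup i hi) (fun x hx => Relation.below_cup i hi x hx)
    (fun D w h => (h.cup' hi).mem_cupSpan) h
  rwa [mapDomain_of] at this

/-- A maximum on top of a diagram of minima forms a circle or a zigzag with the topmost minimum, or
moves below it. -/
theorem CupWord.cap_mem_cupSpan {m : ℕ} {D : Diagram (m + 2)} {w : List Bool} (h : CupWord D w)
    {i : ℕ} (hi : i ≤ m) : of (Diagram.cap i hi D) ∈ cupSpan m := by
  induction m using Nat.strong_induction_on generalizing w i with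
  | _ m ih =>
  cases h with
  | @cup _ j hj D w₁ w₂ hj' h =>
  have hD := h.mem_cupSpan
  by_cases h1 : i = j
  · subst h1
    exact mem_cupSpan_of_relation (Relation.circle i hi D) ((cupSpan m).smul_mem _ hD)
  by_cases h2 : i = j + 1
  · subst h2
    exact mem_cupSpan_of_relation (Relation.zigzag_left j hj hi D) hD
  by_cases h3 : j = i + 1
  · subst h3
    exact mem_cupSpan_of_relation (Relation.zigzag_right i hi hj D) hD
  obtain ⟨m, rfl⟩ : ∃ m', m = m' + 2 := ⟨m - 2, by omega⟩
  rcases Nat.lt_or_ge i j with h4 | h4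
  · obtain ⟨j, rfl⟩ : ∃ j', j = j' + 2 := ⟨j - 2, by omega⟩
    have := Relation.cap_cup i j (by omega) (by omega) hi (by omega) hj D
    have h5 := cup_mem_cupSpan (i := j) (by omega) (ih m (by omega) h (i := i) (by omega))
    have h6 := (cupSpan (m + 2)).sub_mem h5 (relSpan_le_cupSpan _ (Submodule.subset_span this))
    rwa [sub_sub_cancel] at h6
  · obtain ⟨i, rfl⟩ : ∃ i', i = i' + 2 := ⟨i - 2, by omega⟩
    have := Relation.cup_cap j i (by omega) (by omega) hj (by omega) hi D
    have h5 := cup_mem_cupSpan (i := j) (by omega) (ih m (by omega) h (i := i) (by omega))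
    have h6 := (cupSpan (m + 2)).sub_mem h5 (relSpan_le_cupSpan _ (Submodule.subset_span this))
    rwa [sub_sub_cancel] at h6

theorem cap_mem_cupSpan {m : ℕ} {i : ℕ} (hi : i ≤ m) {D : Diagram (m + 2)}
    (h : of D ∈ cupSpan (m + 2)) : of (Diagram.cap i hi D) ∈ cupSpan m := by
  have := cupSpan_mapDomain (Diagram.cap i hi) (fun x hx => Relation.below_cap i hi x hx)
    (fun D w h => h.cap_mem_cupSpan hi) h
  rwa [mapDomain_of] at this

theorem of_mem_cupSpan {m : ℕ} (D : Diagram m) : of D ∈ cupSpan m := by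
  induction D with
  | empty => exact CupWord.empty.mem_cupSpan
  | cup i hi D ih => exact cup_mem_cupSpan hi ih
  | cap i hi D ih => exact cap_mem_cupSpan hi ih
  | @cross m o i hi D ih =>
    have h := cup_mem_cupSpan hi (cap_mem_cupSpan hi ih)
    cases o
    · exact mem_cupSpan_of_relation (Relation.crossing_under i hi D)
        (add_mem (Submodule.smul_mem _ _ ih) (Submodule.smul_mem _ _ h))
    · exact mem_cupSpan_of_relation (Relation.crossing_over i hi D)
        (add_mem (Submodule.smul_mem _ _ ih) (Submodule.smul_mem _ _ h))

/-- Diagrams without crossings and maxima generate everything. -/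
theorem cupSpan_eq_top (m : ℕ) : cupSpan m = ⊤ := by
  refine eq_top_iff.2 fun x _ => ?_
  induction x using Finsupp.induction_linear with
  | zero => exact zero_mem _
  | add x y hx hy => exact add_mem (hx trivial) (hy trivial)
  | single D a =>
    have := (cupSpan m).smul_mem a (of_mem_cupSpan D)
    rwa [of, Finsupp.smul_single, smul_eq_mul, mul_one] at this

end Skein


namespace Skein

open Diagram

/-! ### Matchings and words of left and right ends -/

/-- The function `f` pairs the left ends (letters `true`) with the right ends (letters `false`) of
a word, without crossings. -/
structure WordMatching (w : List Bool) (f : ℕ → ℕ) : Prop where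
  invol : ∀ r, f (f r) = r
  lt : ∀ r < w.length, f r < w.length
  ne : ∀ r < w.length, f r ≠ r
  letter : ∀ r < w.length, w[r]? = some (decide (r < f r))
  noncrossing : ∀ i j, j < w.length → i < j → j < f i → f i < f j → False

/-- Inserting an arc with neighbouring ends at the positions `i` and `i + 1`. -/
theorem WordMatching.insert {w₁ w₂ : List Bool} {f : ℕ → ℕ} (h : WordMatching (w₁ ++ w₂) f) {i : ℕ}
    (hi : w₁.length = i) : WordMatching (w₁ ++ true :: false :: w₂) fun r =>
      if r = i then i + 1 else if r = i + 1 then i else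
        if f (if r < i then r else r - 2) < i then f (if r < i then r else r - 2)
        else f (if r < i then r else r - 2) + 2 := by
  set g : ℕ → ℕ := fun r => if r = i then i + 1 else if r = i + 1 then i else
        if f (if r < i then r else r - 2) < i then f (if r < i then r else r - 2)
        else f (if r < i then r else r - 2) + 2 with hg
  have hlen : (w₁ ++ true :: false :: w₂).length = (w₁ ++ w₂).length + 2 := by simp; omega
  have hlen' : (w₁ ++ w₂).length = i + w₂.length := by simp [hi]
  have g1 : g i = i + 1 := by simp [hg]
  have g2 : g (i + 1) = i := by simp [hg]
  -- every other point comes from a point of the smaller word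
  have g3 : ∀ r, r ≠ i → r ≠ i + 1 → ∃ s, ((r = s ∧ s < i) ∨ (r = s + 2 ∧ i ≤ s)) ∧
      ((g r = f s ∧ f s < i) ∨ (g r = f s + 2 ∧ i ≤ f s)) := by
    intro r h1 h2
    by_cases hr : r < i
    · refine ⟨r, Or.inl ⟨rfl, hr⟩, ?_⟩
      simp only [hg, h1, h2, hr, if_true, if_false]
      by_cases hf : f r < i
      · simp [hf]
      · simp [hf]; omega
    · refine ⟨r - 2, Or.inr ⟨by omega, by omega⟩, ?_⟩
      simp only [hg, h1, h2, hr, if_false]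
      by_cases hf : f (r - 2) < i
      · simp [hf]
      · simp [hf]; omega
  have hinj : ∀ s s', f s = f s' → s = s' := fun s s' e => by rw [← h.invol s, e, h.invol]
  rw [hlen'] at hlen
  refine ⟨fun r => ?_, fun r hr => ?_, fun r hr => ?_, fun r hr => ?_, fun a b hb hab hba hgab => ?_⟩
  · by_cases h1 : r = i
    · rw [h1, g1, g2]
    by_cases h2 : r = i + 1
    · rw [h2, g2, g1]
    obtain ⟨s, hs, hs'⟩ := g3 r h1 h2
    obtain ⟨t, ht, ht'⟩ := g3 (g r) (by omega) (by omega)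
    have : t = f s := by omega
    subst this
    rw [h.invol] at ht'
    omega
  · by_cases h1 : r = i
    · rw [h1, g1, hlen]; omega
    by_cases h2 : r = i + 1
    · rw [h2, g2, hlen]; omega
    obtain ⟨s, hs, hs'⟩ := g3 r h1 h2
    have := h.lt s (by omega)
    omega
  · by_cases h1 : r = i
    · rw [h1, g1]; omega
    by_cases h2 : r = i + 1
    · rw [h2, g2]; omega
    obtain ⟨s, hs, hs'⟩ := g3 r h1 h2
    have := h.ne s (by omega)
    omega
  · by_cases h1 : r = i
    · rw [h1, g1, List.getElem?_append_right (by omega), hi]; simp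
    by_cases h2 : r = i + 1
    · rw [h2, g2, List.getElem?_append_right (by omega), hi]; simp
    obtain ⟨s, hs, hs'⟩ := g3 r h1 h2
    have h3 := h.letter s (by omega)
    have h4 : (r < g r) ↔ (s < f s) := by omega
    simp only [h4]
    rw [← h3]
    rcases hs with ⟨rfl, hs⟩ | ⟨rfl, hs⟩
    · rw [List.getElem?_append_left (by omega), List.getElem?_append_left (by omega)]
    · rw [List.getElem?_append_right (by omega), List.getElem?_append_right (by omega), hi,
        show s + 2 - i = s - i + 2 by omega]
      simp
  · by_cases h1 : a = i
    · rw [h1, g1] at hba; omega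
    by_cases h2 : a = i + 1
    · rw [h2, g2] at hba; omega
    by_cases h3 : b = i
    · rw [h3, g1] at hgab
      obtain ⟨s, hs, hs'⟩ := g3 a h1 h2
      omega
    by_cases h4 : b = i + 1
    · rw [h4, g2] at hgab; omega
    obtain ⟨s, hs, hs'⟩ := g3 a h1 h2
    obtain ⟨t, ht, ht'⟩ := g3 b h3 h4
    exact h.noncrossing s t (by omega) (by omega) (by omega) (by omega)

/-- The word of a diagram without crossings and maxima has a matching; if the first and the last
end are matched, then the remaining ends are the ends of another diagram. -/
theorem CupWord.exists_matching {m : ℕ} {D : Diagram m} {w : List Bool} (h : CupWord D w) :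
    ∃ f, WordMatching w f ∧ (f 0 + 1 = m → ∃ (m' : ℕ) (D' : Diagram m') (w' : List Bool),
      w = true :: (w' ++ [false]) ∧ CupWord D' w') := by
  induction h with
  | empty => exact ⟨id, ⟨by simp, by simp, by simp, by simp, by simp⟩, by simp⟩
  | @cup m i hi D w₁ w₂ hw hD ih =>
    obtain ⟨f, hf, h0⟩ := ih
    have hlen := hD.length_eq
    refine ⟨_, hf.insert hw, fun h => ?_⟩
    by_cases hi0 : i = 0
    · subst hi0
      simp only [if_true] at h
      obtain rfl := List.eq_nil_of_length_eq_zero hw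
      have : m = 0 := by omega
      subst this
      obtain rfl := List.eq_nil_of_length_eq_zero hlen
      exact ⟨0, _, [], rfl, hD⟩
    · rw [if_neg (by omega), if_neg (by omega)] at h
      simp only [show 0 < i by omega, if_true] at h
      have hlt := hf.lt 0 (by omega)
      split_ifs at h with h1
      · omega
      obtain ⟨m', D', w', hw', hD'⟩ := h0 (by omega)
      have hlen' := hD'.length_eq
      have hm : m = m' + 2 := by rw [← hlen, hw']; simp [hlen']
      obtain ⟨x, w₁, rfl⟩ := List.exists_cons_of_ne_nil (l := w₁) (by rintro rfl; simp at hw; omega)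
      simp only [List.cons_append, List.cons.injEq] at hw'
      obtain ⟨rfl, hw'⟩ := hw'
      simp only [List.length_cons] at hw
      obtain ⟨u, rfl, hu⟩ := append_eq_append_of_lt hw'.symm (by omega)
      refine ⟨m' + 2, Diagram.cup w₁.length (by simp at hlen'; omega) D',
        w₁ ++ true :: false :: u, by simp [hu], CupWord.cup _ rfl hD'⟩

theorem CupWord.enclose {m : ℕ} {D : Diagram m} {w : List Bool} (h : CupWord D w) :
    CupWord (Diagram.enclose D) (true :: (w ++ [false])) := by
  induction h with
  | empty => exact CupWord.cup (w₁ := []) (w₂ := []) _ rfl CupWord.empty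
  | @cup m i hi D w₁ w₂ hw hD ih =>
    have e : true :: (w₁ ++ true :: false :: w₂ ++ [false]) =
      (true :: w₁) ++ true :: false :: (w₂ ++ [false]) := by simp
    rw [e]
    exact CupWord.cup _ (by simp [hw]) (by simpa using ih)

/-- The drawing of a matching without crossings consists of minima only. -/
theorem cupWord_draw {N : ℕ} (M : PerfectMatching (2 * N))
    (h : ∀ P < 2 * N, P < natPartner M P → crossedBy M P = []) :
    CupWord M.draw ((List.range (2 * N)).map fun r => decide (r < natPartner M r)) := by
  have := drawFirst_induction M
    (fun P t D => CupWord D ((activeList M P).map fun r => decide (r < natPartner M r)))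
    (by simpa [activeList] using CupWord.empty)
    (fun P t D hP hl hle ih => by
      have hc := h P hP hl
      have hc0 : (crossedBy M P).length = 0 := by rw [hc]; rfl
      rw [activeList_of_left M hP hl, hc, List.nil_append, List.map_append] at ih
      have e : (activeList M (P + 1)).map (fun r => decide (r < natPartner M r)) =
          (List.range P).map (fun r => decide (r < natPartner M r)) ++
            true :: false :: (activeRight M P).map (fun r => decide (r < natPartner M r)) := by
        rw [activeList_succ_of_left M hP hl, hc, List.nil_append, List.map_append, List.map_cons,
          List.map_cons, natPartner_natPartner, decide_eq_true hl, decide_eq_false (by omega)]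
      rw [e]
      generalize (crossedBy M P).length = c at hle hc0
      subst hc0
      exact CupWord.cup _ (by simp) ih)
    (fun P t D hP hl ih => by rwa [activeList_succ_of_not_left M hl])
  rwa [activeList, List.filter_eq_self.2] at this
  simp +contextual

/-! ### Standard dotted matchings -/

variable {n k : ℕ}

/-- The dotted arcs are nested in each other, and none of them lies inside an undotted arc. -/
structure Standard (x : DottedMatching n k) : Prop where
  nested : ∀ a ∈ x.dots, ∀ b ∈ x.dots, a < b → b < x.partner a
  outer : ∀ a ∈ x.dots, ∀ u, u ∉ x.dots → u < a → ¬ a < x.partner u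

theorem Standard.nat_nested {x : DottedMatching n k} (hx : Standard x) {a b : ℕ}
    (ha : a ∈ natDots x) (hb : b ∈ natDots x) (h : a < b) :
    b < natPartner x.toPerfectMatching a := by
  have h1 := lt_of_mem_natDots ha
  have h2 := lt_of_mem_natDots hb
  lift a to Fin (2 * n) using h1
  lift b to Fin (2 * n) using h2
  rw [mem_natDots] at ha hb
  rw [natPartner_val]
  exact hx.nested a ha b hb h

theorem Standard.nat_outer {x : DottedMatching n k} (hx : Standard x) {a u : ℕ}
    (ha : a ∈ natDots x) (hu : u ∉ natDots x) (h : u < a) :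
    ¬ a < natPartner x.toPerfectMatching u := by
  have h1 := lt_of_mem_natDots ha
  have h2 : u < 2 * n := by omega
  lift a to Fin (2 * n) using h1
  lift u to Fin (2 * n) using h2
  rw [mem_natDots] at ha hu
  rw [natPartner_val]
  exact hx.outer a ha u hu h

/-- The expansion of a standard dotted matching has no crossings. -/
theorem Standard.crossedBy_eq_nil {x : DottedMatching n k} (hx : Standard x) {P : ℕ}
    (hP : P < 2 * (n + k)) (hl : P < natPartner x.expand P) : crossedBy x.expand P = [] := by
  set f := natPartner x.toPerfectMatching with hf
  have hinv := natPartner_natPartner x.toPerfectMatching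
  rcases Nat.lt_or_ge P k with h1 | h1
  · exact crossedBy_expand_left x h1
  rcases Nat.lt_or_ge P (k + 2 * n) with h2 | h2
  swap
  · obtain ⟨r, hr, _, e⟩ := expand_right x h2 hP
    omega
  obtain ⟨P, rfl⟩ := Nat.exists_eq_add_of_le h1
  by_cases hD : P ∈ natDots x
  · have := expand_dot_lt x hD; omega
  by_cases hfD : f P ∈ natDots x
  · have hfP : f P < P := by
      have := (mem_natLefts.1 (natDots_subset x hfD)).2
      rwa [hinv] at this
    have hR : rightOf f (2 * n) (natUndotted x) (natDots x) P = ∅ := by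
      refine Finset.filter_eq_empty_iff.2 fun r hr => ?_
      rw [Finset.mem_Ioo] at hr
      rintro (h | ⟨h, h'⟩)
      · have := hx.nat_nested hfD h (by omega)
        rw [hinv] at this; omega
      · have hu := (Finset.mem_filter.1 h).2
        rcases lt_trichotomy (f r) (f P) with h3 | h3 | h3
        · refine hx.nat_outer hfD hu h3 ?_
          rw [show natPartner x.toPerfectMatching (f r) = r from hinv r]; omega
        · exact hu (h3 ▸ hfD)
        · refine natPartner_crossingless x.toCrossinglessMatching
            (natPartner_lt _ (show r < 2 * n by omega)) h3 ?_ ?_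
          · rwa [show natPartner x.toPerfectMatching (f P) = P from hinv P]
          · rw [show natPartner x.toPerfectMatching (f P) = P from hinv P,
              show natPartner x.toPerfectMatching (f r) = r from hinv r]
            omega
    have := crossedBy_expand_rightDot x (by omega) hfD
    rw [← hf, hR, Finset.map_empty, List.toFinset_eq_empty_iff] at this
    exact this
  · rw [crossedBy_expand_undotted x (by omega) hD hfD, List.map_eq_nil_iff, dotsIn,
      List.filter_eq_nil_iff]
    intro r hr
    rw [List.mem_range'_1] at hr
    simp only [decide_eq_true_eq]
    intro h
    exact hx.nat_outer h hD (by omega) (by omega)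

/-- The left ends of the expansion of a dotted matching. -/
theorem expand_left_iff (x : DottedMatching n k) {p : ℕ} (hp : p < 2 * (n + k)) :
    p < natPartner x.expand p ↔ p < k ∨ ∃ r < 2 * n, p = k + r ∧
      (natPartner x.toPerfectMatching r ∈ natDots x ∨ r ∈ natUndotted x) := by
  have hinv := natPartner_natPartner x.toPerfectMatching
  rcases Nat.lt_or_ge p k with h1 | h1
  · obtain ⟨r, hr, e⟩ := expand_left x h1
    exact iff_of_true (by omega) (Or.inl h1)
  rcases Nat.lt_or_ge p (k + 2 * n) with h2 | h2
  swap
  · obtain ⟨r, hr, _, e⟩ := expand_right x h2 hp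
    exact iff_of_false (by omega) (by rintro (h | ⟨r, hr, h, _⟩) <;> omega)
  obtain ⟨r, rfl⟩ := Nat.exists_eq_add_of_le h1
  have hr : r < 2 * n := by omega
  have e : (k + r < k ∨ ∃ r' < 2 * n, k + r = k + r' ∧
      (natPartner x.toPerfectMatching r' ∈ natDots x ∨ r' ∈ natUndotted x)) ↔
      (natPartner x.toPerfectMatching r ∈ natDots x ∨ r ∈ natUndotted x) := by
    constructor
    · rintro (h | ⟨r', _, h, h'⟩)
      · omega
      · obtain rfl : r = r' := by omega
        exact h'
    · intro h
      exact Or.inr ⟨r, hr, rfl, h⟩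
  rw [e]
  by_cases hD : r ∈ natDots x
  · have h3 := expand_dot_lt x hD
    refine iff_of_false (by omega) ?_
    rintro (h | h)
    · have h4 := (mem_natLefts.1 (natDots_subset x h)).2
      have h5 := (mem_natLefts.1 (natDots_subset x hD)).2
      rw [hinv] at h4
      omega
    · exact (Finset.mem_filter.1 h).2 hD
  by_cases hfD : natPartner x.toPerfectMatching r ∈ natDots x
  · have := expand_rightDot_ge x hr hfD
    exact iff_of_true (by omega) (Or.inl hfD)
  · rw [expand_undotted x hr hD hfD, natUndotted, Finset.mem_filter, mem_natLefts]
    simp only [hD, hfD, false_or, not_false_eq_true, and_true, hr, true_and]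
    omega

section OfMatching

variable {f : ℕ → ℕ} (hinv : ∀ r, f (f r) = r) (hlt : ∀ r < 2 * (n + k), f r < 2 * (n + k))
  (hne : ∀ r < 2 * (n + k), f r ≠ r)
  (hnc : ∀ i j, j < 2 * (n + k) → i < j → j < f i → f i < f j → False)
  (hleft : ∀ p < k, k ≤ f p ∧ f p < k + 2 * n)
  (hright : ∀ p, k + 2 * n ≤ p → p < 2 * (n + k) → k ≤ f p ∧ f p < k + 2 * n)

/-- The matching of the `2n` points in the middle that closes up each pair of arcs ending at
points of the projectors that are mirror images of each other. -/
def closeUp (n k : ℕ) (f : ℕ → ℕ) (r : ℕ) : ℕ :=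
  if k ≤ f (k + r) ∧ f (k + r) < k + 2 * n then f (k + r) - k
  else f (2 * (n + k) - 1 - f (k + r)) - k

include hinv hlt hleft hright

/-- Each point in the middle is matched with its partner in `f` or with the point at the other end of
the mirror image. -/
theorem closeUp_cases {r : ℕ} (hr : r < 2 * n) :
    (k ≤ f (k + r) ∧ k + closeUp n k f r = f (k + r) ∧ f (k + r) < k + 2 * n) ∨
    ∃ p q, p < k ∧ q = 2 * (n + k) - 1 - p ∧ k ≤ f p ∧ f p < k + 2 * n ∧ k ≤ f q ∧ f q < k + 2 * n ∧
      ((f p = k + r ∧ f q = k + closeUp n k f r) ∨ (f q = k + r ∧ f p = k + closeUp n k f r)) := by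
  have h1 := hlt (k + r) (by omega)
  have h2 := hinv (k + r)
  unfold closeUp
  split_ifs with h
  · left; omega
  · right
    rcases Nat.lt_or_ge (f (k + r)) k with h3 | h3
    · have h4 := hleft _ h3
      have h5 := hright (2 * (n + k) - 1 - f (k + r)) (by omega) (by omega)
      exact ⟨f (k + r), _, h3, rfl, h4.1, h4.2, h5.1, h5.2, Or.inl ⟨h2, by omega⟩⟩
    · have h4 := hright (f (k + r)) (by omega) h1
      have h5 := hleft (2 * (n + k) - 1 - f (k + r)) (by omega)
      exact ⟨_, f (k + r), by omega, by omega, h5.1, h5.2, h4.1, h4.2, Or.inr ⟨h2, by omega⟩⟩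

theorem closeUp_lt {r : ℕ} (hr : r < 2 * n) : closeUp n k f r < 2 * n := by
  rcases closeUp_cases hinv hlt hleft hright hr with h | ⟨p, q, h⟩ <;> omega

theorem closeUp_closeUp {r : ℕ} (hr : r < 2 * n) : closeUp n k f (closeUp n k f r) = r := by
  have hr' := closeUp_lt hinv hlt hleft hright hr
  rcases closeUp_cases hinv hlt hleft hright hr with h | ⟨p, q, h1, h2, h3, h4, h5, h6, h⟩
  · have h1 := hinv (k + r)
    rw [← h.2.1] at h1
    unfold closeUp at h1 ⊢
    rw [h1, if_pos (by omega)]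
    omega
  · rcases h with ⟨e1, e2⟩ | ⟨e1, e2⟩
    · have h7 : f (k + closeUp n k f r) = q := by rw [← e2, hinv]
      generalize closeUp n k f r = c at h7 hr' e2 ⊢
      unfold closeUp
      rw [h7, if_neg (by omega), show 2 * (n + k) - 1 - q = p by omega, e1]
      omega
    · have h7 : f (k + closeUp n k f r) = p := by rw [← e2, hinv]
      generalize closeUp n k f r = c at h7 hr' e2 ⊢
      unfold closeUp
      rw [h7, if_neg (by omega), show 2 * (n + k) - 1 - p = q by omega, e1]
      omega

include hnc in
/-- The arc at a point of the left projector ends to the left of the arc at the mirror image. -/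
theorem closeUp_arcs {p q : ℕ} (hp : p < k) (hq : q = 2 * (n + k) - 1 - p) : f p < f q := by
  have h1 := hleft p hp
  have h2 := hright q (by omega) (by omega)
  by_contra h
  have h3 : f p ≠ f q := fun e => by
    have := congrArg f e
    rw [hinv, hinv] at this
    omega
  exact hnc p (f q) (by omega) (by omega) (by omega) (by rw [hinv]; omega)

include hnc in
theorem closeUp_crossingless {i j : ℕ} (hj : j < 2 * n) (h1 : i < j) (h2 : j < closeUp n k f i)
    (h3 : closeUp n k f i < closeUp n k f j) : False := by
  have hii := hinv (k + i)
  have hjj := hinv (k + j)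
  rcases closeUp_cases hinv hlt hleft hright (show i < 2 * n by omega) with
    hi | ⟨p, q, p1, p2, p3, p4, p5, p6, hi⟩ <;>
  rcases closeUp_cases hinv hlt hleft hright hj with
    hj | ⟨p', q', p1', p2', p3', p4', p5', p6', hj⟩
  · exact hnc (k + i) (k + j) (by omega) (by omega) (by omega) (by omega)
  · have h4 := closeUp_arcs hinv hlt hnc hleft hright p1' p2'
    rcases hj with hj | hj
    · exact hnc p' (k + i) (by omega) (by omega) (by omega) (by omega)
    · omega
  · have h4 := closeUp_arcs hinv hlt hnc hleft hright p1 p2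
    rcases hi with hi | hi
    · exact hnc (k + j) (f q) (by omega) (by omega) (by omega) (by rw [hinv]; omega)
    · omega
  · have h4 := closeUp_arcs hinv hlt hnc hleft hright p1 p2
    have h4' := closeUp_arcs hinv hlt hnc hleft hright p1' p2'
    rcases hi with hi | hi
    · rcases hj with hj | hj
      · have h5 : p ≠ p' := by rintro rfl; omega
        rcases lt_or_gt_of_ne h5 with h6 | h6
        · exact hnc p p' (by omega) (by omega) (by omega) (by omega)
        · exact hnc (f q) (f q') (by omega) (by omega) (by rw [hinv]; omega)
            (by rw [hinv, hinv]; omega)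
      · omega
    · omega

include hne hnc in
/-- A crossingless matching without arcs between the projectors comes from a standard dotted
matching. -/
theorem exists_standard : ∃ x : DottedMatching n k, Standard x ∧
    ∀ p < 2 * (n + k), p < natPartner x.expand p ↔ p < f p := by
  have hdot : ∀ r < 2 * n, f (k + r) < k → r < closeUp n k f r ∧
      k + 2 * n ≤ f (k + closeUp n k f r) := by
    intro r hr h
    rcases closeUp_cases hinv hlt hleft hright hr with h' | ⟨p, q, p1, p2, p3, p4, p5, p6, hi⟩
    · omega
    have h4 := closeUp_arcs hinv hlt hnc hleft hright p1 p2
    rcases hi with hi | hi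
    · rw [← hi.2, hinv]; omega
    · rw [← hi.1, hinv] at h; omega
  have hdot' : ∀ r < 2 * n, k + 2 * n ≤ f (k + r) → f (k + closeUp n k f r) < k := by
    intro r hr h
    rcases closeUp_cases hinv hlt hleft hright hr with h' | ⟨p, q, p1, p2, p3, p4, p5, p6, hi⟩
    · omega
    rcases hi with hi | hi
    · rw [← hi.1, hinv] at h; omega
    · rw [← hi.2, hinv]; omega
  have hmid : ∀ r < 2 * n, k ≤ f (k + r) → f (k + r) < k + 2 * n →
      k + closeUp n k f r = f (k + r) := by
    intro r hr h h'
    unfold closeUp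
    rw [if_pos ⟨h, h'⟩]; omega
  let x : DottedMatching n k :=
    { partner := fun i => ⟨closeUp n k f i, closeUp_lt hinv hlt hleft hright i.2⟩
      partner_partner := fun i => Fin.ext (closeUp_closeUp hinv hlt hleft hright i.2)
      partner_ne := fun i h => by
        have h := congrArg Fin.val h
        simp only at h
        rcases closeUp_cases hinv hlt hleft hright i.2 with h' | ⟨p, q, p1, p2, p3, p4, p5, p6, hi⟩
        · exact hne (k + i) (by omega) (by omega)
        · have h4 := closeUp_arcs hinv hlt hnc hleft hright p1 p2
          omega
      crossingless := fun i j h => closeUp_crossingless hinv hlt hnc hleft hright j.2 h.1 h.2.1 h.2.2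
      dots := Finset.univ.filter fun i : Fin (2 * n) => f (k + i) < k
      lt_partner_of_mem_dots := fun i hi => (hdot i i.2 (Finset.mem_filter.1 hi).2).1
      card_dots := by
        refine Eq.trans (b := (Finset.range k).card) ?_ (Finset.card_range k)
        refine Finset.card_bij (fun i _ => f (k + i)) ?_ ?_ ?_
        · intro i hi; simpa using hi
        · intro i _ j _ h
          have := congrArg f h
          rw [hinv, hinv] at this
          exact Fin.ext (by omega)
        · intro p hp
          rw [Finset.mem_range] at hp
          have h1 := hleft p hp
          refine ⟨⟨f p - k, by omega⟩, ?_, ?_⟩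
          · simp only [Finset.mem_filter, Finset.mem_univ, true_and]
            rw [show k + (f p - k) = f p by omega, hinv]; exact hp
          · simp only
            rw [show k + (f p - k) = f p by omega, hinv] }
  have hxd : ∀ i : Fin (2 * n), i ∈ x.dots ↔ f (k + i) < k := fun i => by simp [x]
  have hxp : ∀ i : Fin (2 * n), (x.partner i : ℕ) = closeUp n k f i := fun i => rfl
  have hxp' : ∀ r < 2 * n, natPartner x.toPerfectMatching r = closeUp n k f r := fun r hr => by
    rw [show r = ((⟨r, hr⟩ : Fin (2 * n)) : ℕ) from rfl, natPartner_val]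
  have hxd' : ∀ r < 2 * n, r ∈ natDots x ↔ f (k + r) < k := fun r hr => by
    rw [show r = ((⟨r, hr⟩ : Fin (2 * n)) : ℕ) from rfl, mem_natDots, hxd]
  refine ⟨x, ⟨fun a ha b hb h => ?_, fun a ha u hu h h' => ?_⟩, fun p hp => ?_⟩
  · rw [hxd] at ha hb
    rw [Fin.lt_def] at h ⊢
    rw [hxp]
    obtain ⟨h1, h2⟩ := hdot a a.2 ha
    by_contra h3
    have h4 := closeUp_lt hinv hlt hleft hright a.2
    have haa := hinv (k + a)
    have hbb := hinv (k + b)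
    -- the two arcs to the left projector are nested
    have h5 : f (k + b) < f (k + a) := by
      by_contra h5
      have h6 : f (k + b) ≠ f (k + a) := fun e => by
        have := congrArg f e
        rw [haa, hbb] at this
        omega
      exact hnc (f (k + a)) (f (k + b)) (by omega) (by omega) (by omega) (by omega)
    have h6 : k + closeUp n k f a ≠ k + b := fun e => by rw [e] at h2; omega
    exact hnc (f (k + b)) (k + closeUp n k f a) (by omega) (by omega) (by omega) (by omega)
  · rw [hxd] at ha hu
    rw [Fin.lt_def] at h h'
    rw [hxp] at h'
    have haa := hinv (k + a)
    rcases Nat.lt_or_ge (f (k + u)) (k + 2 * n) with h1 | h1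
    · have h2 := hmid u u.2 (by omega) h1
      exact hnc (f (k + a)) (k + u) (by omega) (by omega) (by omega) (by omega)
    · have h2 := hdot' u u.2 h1
      have h3 := (hdot _ (closeUp_lt hinv hlt hleft hright u.2) h2).1
      rw [closeUp_closeUp hinv hlt hleft hright u.2] at h3
      omega
  · rw [expand_left_iff x hp]
    rcases Nat.lt_or_ge p k with h1 | h1
    · have := hleft p h1
      exact iff_of_true (Or.inl h1) (by omega)
    rcases Nat.lt_or_ge p (k + 2 * n) with h2 | h2
    swap
    · have := hright p h2 hp
      exact iff_of_false (by rintro (h | ⟨r, hr, h, _⟩) <;> omega) (by omega)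
    obtain ⟨r, rfl⟩ := Nat.exists_eq_add_of_le h1
    have hr : r < 2 * n := by omega
    have hr' := closeUp_lt hinv hlt hleft hright hr
    have e : (natPartner x.toPerfectMatching r ∈ natDots x ∨ r ∈ natUndotted x) ↔
        k + r < f (k + r) := by
      rw [natUndotted, Finset.mem_filter, mem_natLefts, hxd' r hr, hxp' r hr, hxd' _ hr']
      rcases Nat.lt_or_ge (f (k + r)) k with h3 | h3
      · have := hdot r hr h3
        omega
      rcases Nat.lt_or_ge (f (k + r)) (k + 2 * n) with h4 | h4
      · have h5 := hmid r hr h3 h4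
        have h6 := hinv (k + r)
        rw [h5, h6]
        omega
      · have := hdot' r hr h4
        omega
    rw [← e]
    constructor
    · rintro (h | ⟨r', _, h, h'⟩)
      · omega
      · obtain rfl : r = r' := by omega
        exact h'
    · intro h
      exact Or.inr ⟨r, hr, rfl, h⟩

end OfMatching

end Skein


namespace Skein

open Diagram

/-! ### Standard dotted matchings generate `S^q_{n,k}` -/

variable {n k : ℕ}

theorem klClass_eq_of_same {D D' : Diagram (2 * (n + k))} (h : Same D D') :
    klClass n k D = klClass n k D' := by
  have hle : relSpan (2 * (n + k)) ≤ klRelations n k := Submodule.span_mono Set.subset_union_left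
  rw [klClass, klClass, ← sub_eq_zero, ← map_sub, Submodule.mkQ_apply, Submodule.Quotient.mk_eq_zero]
  exact hle h

theorem CupWord.exists_same_topCup {m : ℕ} {D : Diagram m} {v₁ v₂ : List Bool}
    (h : CupWord D (v₁ ++ true :: false :: v₂)) :
    ∃ D' : Diagram m, Same D D' ∧ D'.topCup = some v₁.length := by
  have hlen := h.length_eq
  simp only [List.length_append, List.length_cons] at hlen
  obtain ⟨m, rfl⟩ : ∃ m', m = m' + 2 := ⟨m - 2, by omega⟩
  obtain ⟨hj, D', _, h2⟩ := h.exists_same_cup rfl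
  exact ⟨_, h2, rfl⟩

/-- Between a letter `true` and a later letter `false`, there is a letter `true` that is followed by
the letter `false`. -/
theorem exists_true_false {w : List Bool} {a b : ℕ} (hab : a ≤ b) (ha : w[a]? = some true)
    (hb : w[b]? = some false) :
    ∃ v₁ v₂, w = v₁ ++ true :: false :: v₂ ∧ a ≤ v₁.length ∧ v₁.length < b := by
  induction b, hab using Nat.le_induction with
  | base => rw [ha] at hb; simp at hb
  | succ b hab ih =>
    have hlt : b + 1 < w.length := by
      by_contra h
      rw [List.getElem?_eq_none (by omega)] at hb
      simp at hb
    have hb' : w[b]? = some w[b] := List.getElem?_eq_getElem (by omega)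
    cases hx : w[b]
    · rw [hx] at hb'
      obtain ⟨v₁, v₂, h1, h2, h3⟩ := ih hb'
      exact ⟨v₁, v₂, h1, h2, by omega⟩
    · refine ⟨w.take b, w.drop (b + 2), ?_, by rw [List.length_take]; omega, by rw [List.length_take]; omega⟩
      have e : w[b + 1] = false := by
        rw [List.getElem?_eq_getElem hlt] at hb
        simpa using hb
      conv_lhs => rw [← List.take_append_drop b w]
      rw [List.drop_eq_getElem_cons (by omega), List.drop_eq_getElem_cons hlt, hx, e]

theorem klClass_eq_zero_of_word {D : Diagram (2 * (n + k))} {v₁ v₂ : List Bool}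
    (h : CupWord D (v₁ ++ true :: false :: v₂))
    (hv : v₁.length + 1 < k ∨ 2 * n + k ≤ v₁.length) : klClass n k D = 0 := by
  obtain ⟨D', h1, h2⟩ := h.exists_same_topCup
  rw [klClass_eq_of_same h1, klClass, Submodule.mkQ_apply, Submodule.Quotient.mk_eq_zero]
  exact Submodule.subset_span (Or.inr ⟨D', ⟨_, h2, hv⟩, rfl⟩)

theorem klClass_enclose_mem {m : ℕ} {D' : Diagram m} {w' : List Bool} (h' : CupWord D' w') (hk : 0 < k)
    {D : Diagram (2 * (n + k))} (h : CupWord D (true :: (w' ++ [false]))) :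
    klClass n k D ∈ klEncloseRange n k := by
  obtain ⟨k, rfl⟩ : ∃ k', k = k' + 1 := ⟨k - 1, by omega⟩
  have h1 := h.length_eq
  have h2 := h'.length_eq
  simp only [List.length_cons, List.length_append, List.length_nil] at h1
  obtain rfl : m = 2 * (n + k) := by omega
  have h3 : Same D (Diagram.enclose D') := h.same h'.enclose
  rw [klClass_eq_of_same h3]
  refine ⟨klClass n k D', ?_⟩
  simp [klEnclose, klClass, Diagram.of]

theorem Standard.cupWord_draw {x : DottedMatching n k} (hx : Standard x) :
    CupWord x.expand.draw
      ((List.range (2 * (n + k))).map fun r => decide (r < natPartner x.expand r)) :=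
  Skein.cupWord_draw _ fun _ hP hl => hx.crossedBy_eq_nil hP hl

/-- The class of a diagram without crossings and maxima is zero or the class of the expansion of a
standard dotted matching. -/
theorem CupWord.mkQ_klClass {D : Diagram (2 * (n + k))} {w : List Bool} (h : CupWord D w) :
    (klEncloseRange n k).mkQ (klClass n k D) = 0 ∨ ∃ x : DottedMatching n k, Standard x ∧
      klClass n k D = klClass n k x.expand.draw := by
  obtain ⟨f, hf, h0⟩ := h.exists_matching
  have hlen := h.length_eq
  have hinv := hf.invol
  have hlt := hf.lt
  rw [hlen] at hlt
  have hletter := hf.letter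
  rw [hlen] at hletter
  have hne := hf.ne
  rw [hlen] at hne
  have hnc := hf.noncrossing
  rw [hlen] at hnc
  by_cases hz : klClass n k D = 0
  · left; rw [hz, map_zero]
  by_cases hE : 0 < k ∧ f 0 + 1 = 2 * (n + k)
  · left
    obtain ⟨m', D', w', rfl, hD'⟩ := h0 hE.2
    rw [Submodule.mkQ_apply, Submodule.Quotient.mk_eq_zero]
    exact klClass_enclose_mem hD' hE.1 h
  right
  -- two ends in one projector, a left one before a right one, would allow to turn back into it
  have hturn : ∀ a b, a < b → a < 2 * (n + k) → b < 2 * (n + k) → a < f a → f b < b →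
      (b < k ∨ 2 * n + k ≤ a) → False := by
    intro a b hab ha hb h1 h2 h3
    have e1 := hletter a ha
    have e2 := hletter b hb
    rw [decide_eq_true h1] at e1
    rw [decide_eq_false (by omega)] at e2
    obtain ⟨v₁, v₂, rfl, h4, h5⟩ := exists_true_false hab.le e1 e2
    exact hz (klClass_eq_zero_of_word h (by omega))
  -- points of the same projector are not matched, and neither are points of different projectors
  have hl : ∀ p < k, k ≤ f p ∨ f p < p := by
    intro p hp
    by_contra hc
    have h1 := hne p (by omega)
    have h2 := hinv p
    exact hturn p (f p) (by omega) (by omega) (by omega) (by omega) (by omega) (by omega)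
  have hl' : ∀ p < k, k ≤ f p := by
    intro p hp
    by_contra hc
    have h1 := hl p hp
    have h2 := hl (f p) (by omega)
    rw [hinv] at h2
    omega
  have hr' : ∀ p, k + 2 * n ≤ p → p < 2 * (n + k) → f p < k + 2 * n := by
    intro p hp hp'
    by_contra hc
    have h1 := hne p (by omega)
    have h2 := hinv p
    have h3 := hlt p hp'
    rcases lt_or_gt_of_ne h1 with h4 | h4
    · exact hturn (f p) p h4 (by omega) hp' (by omega) (by omega) (by omega)
    · exact hturn p (f p) h4 hp' (by omega) (by omega) (by omega) (by omega)
  have hacross : ∀ p < k, f p < k + 2 * n := by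
    intro p hp
    by_contra hc
    refine hE ⟨by omega, ?_⟩
    have h1 := hlt p (by omega)
    have h2 := hinv p
    have h3 := hlt 0 (by omega)
    have h4 := hl' 0 (by omega)
    have h5 := hinv 0
    have h6 : f p ≤ f 0 := by
      by_contra h6
      rcases Nat.eq_zero_or_pos p with rfl | hp0
      · omega
      rcases Nat.lt_or_ge p (f 0) with h7 | h7
      · exact hnc 0 p (by omega) hp0 h7 (by omega)
      · have : p = f 0 := by omega
        omega
    by_contra h7
    have h8 := hlt (2 * (n + k) - 1) (by omega)
    have h9 := hr' (2 * (n + k) - 1) (by omega) (by omega)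
    have h10 := hinv (2 * (n + k) - 1)
    rcases Nat.eq_zero_or_pos (f (2 * (n + k) - 1)) with h11 | h11
    · rw [h11] at h10; omega
    · exact hnc 0 (f (2 * (n + k) - 1)) h8 h11 (by omega) (by omega)
  have hacross' : ∀ p, k + 2 * n ≤ p → p < 2 * (n + k) → k ≤ f p := by
    intro p hp hp'
    by_contra hc
    have := hacross (f p) (by omega)
    rw [hinv] at this; omega
  obtain ⟨x, hx, hxf⟩ := exists_standard hinv hlt hne hnc
    (fun p hp => ⟨hl' p hp, hacross p hp⟩) (fun p hp hp' => ⟨hacross' p hp hp', hr' p hp hp'⟩)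
  refine ⟨x, hx, klClass_eq_of_same (h.same ?_)⟩
  have hw : w = (List.range (2 * (n + k))).map fun r => decide (r < natPartner x.expand r) := by
    refine List.ext_getElem? fun i => ?_
    rcases Nat.lt_or_ge i (2 * (n + k)) with hi | hi
    · rw [hletter i hi, List.getElem?_map, List.getElem?_range hi]
      simp [hxf i hi]
    · rw [List.getElem?_eq_none (by omega), List.getElem?_eq_none (by simpa using hi)]
  rw [hw]
  exact hx.cupWord_draw

/-- The classes of the expansions of standard dotted matchings generate `S^q_{n,k}`. -/
theorem span_standard_eq_top (n k : ℕ) : Submodule.span HalfLaurent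
    {y : KLQuotient n k | ∃ x : DottedMatching n k, Standard x ∧
      y = (klEncloseRange n k).mkQ (klClass n k x.expand.draw)} = ⊤ := by
  set Z := Submodule.span HalfLaurent {y : KLQuotient n k | ∃ x : DottedMatching n k, Standard x ∧
      y = (klEncloseRange n k).mkQ (klClass n k x.expand.draw)} with hZ
  refine eq_top_iff.2 fun y _ => ?_
  obtain ⟨y, rfl⟩ := Submodule.mkQ_surjective _ y
  obtain ⟨y, rfl⟩ := Submodule.mkQ_surjective _ y
  have hle : cupSpan (2 * (n + k)) ≤
      Z.comap ((klEncloseRange n k).mkQ ∘ₗ (klRelations n k).mkQ) := by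
    refine Submodule.span_le.2 ?_
    rintro y (hy | ⟨D, ⟨w, h⟩, rfl⟩)
    · have : (klRelations n k).mkQ y = 0 := by
        rw [Submodule.mkQ_apply, Submodule.Quotient.mk_eq_zero]
        exact Submodule.subset_span (Or.inl hy)
      change (klEncloseRange n k).mkQ ((klRelations n k).mkQ y) ∈ Z
      rw [this, map_zero]
      exact zero_mem _
    · change (klEncloseRange n k).mkQ (klClass n k D) ∈ Z
      rcases h.mkQ_klClass with h | ⟨x, hx, h⟩
      · rw [h]; exact zero_mem _
      · rw [h]; exact Submodule.subset_span ⟨x, hx, rfl⟩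
  rw [cupSpan_eq_top] at hle
  exact hle (Submodule.mem_top (x := y))

end Skein


namespace Skein

/-! ### Standard dotted matchings are determined by their undotted arcs -/

variable {n k : ℕ}

theorem mem_natUndotted {x : DottedMatching n k} {r : ℕ} : r ∈ natUndotted x ↔
    (r < 2 * n ∧ r < natPartner x.toPerfectMatching r) ∧ r ∉ natDots x := by
  rw [natUndotted, Finset.mem_filter, mem_natLefts]

theorem partner_notMem_natLefts {N : ℕ} {M : PerfectMatching (2 * N)} {r : ℕ} (hr : r ∈ natLefts M) :
    natPartner M r ∉ natLefts M := by
  rw [mem_natLefts] at hr ⊢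
  rw [natPartner_natPartner]
  omega

/-- Points inside an undotted arc of a standard matching belong to undotted arcs inside of it. -/
theorem Standard.inside {x : DottedMatching n k} (hx : Standard x) {u p : ℕ} (hu : u ∈ natUndotted x)
    (h1 : u < p) (h2 : p < natPartner x.toPerfectMatching u) :
    p ∈ natUndotted x ∨
      natPartner x.toPerfectMatching p ∈ natUndotted x ∧ u < natPartner x.toPerfectMatching p := by
  set f := natPartner x.toPerfectMatching with hf
  have hinv : ∀ r, f (f r) = r := natPartner_natPartner x.toPerfectMatching
  rw [mem_natUndotted] at hu
  have hp : p < 2 * n := h2.trans (natPartner_lt _ hu.1.1)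
  have hne : f p ≠ p := natPartner_ne _ hp
  have hpD : p ∉ natDots x := fun h => hx.nat_outer h hu.2 h1 h2
  rcases lt_or_gt_of_ne hne with h | h
  · right
    have h3 : f p ≠ u := fun e => by rw [← e, hinv] at h2; omega
    have h4 : u < f p := by
      by_contra h4
      exact natPartner_crossingless x.toCrossinglessMatching hu.1.1 (show f p < u by omega)
        (by rw [← hf, hinv]; exact h1) (by rw [← hf, hinv]; exact h2)
    refine ⟨mem_natUndotted.2 ⟨⟨natPartner_lt _ hp, by rw [← hf, hinv]; exact h⟩, fun hD => ?_⟩, h4⟩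
    exact hx.nat_outer hD hu.2 h4 (show f p < f u by omega)
  · exact Or.inl (mem_natUndotted.2 ⟨⟨hp, h⟩, hpD⟩)

theorem natPartner_injective {N : ℕ} (M : PerfectMatching (2 * N)) :
    Function.Injective (natPartner M) :=
  Function.LeftInverse.injective (natPartner_natPartner M)

/-- If the undotted arcs to the right of `u` agree, then the partner of `u` in `x` cannot be inside of
the arc of `u` in `y`, where it would belong to an undotted arc between the ends. -/
theorem Standard.not_lt_of_undotted {x y : DottedMatching n k} (hy : Standard y)
    (hU : natUndotted x = natUndotted y) {u : ℕ} (hu : u ∈ natUndotted x)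
    (ih : ∀ u' ∈ natUndotted x, u < u' →
      natPartner x.toPerfectMatching u' = natPartner y.toPerfectMatching u') :
    ¬ natPartner x.toPerfectMatching u < natPartner y.toPerfectMatching u := by
  intro h
  have hu' := mem_natUndotted.1 hu
  rcases hy.inside (hU ▸ hu) hu'.1.2 h with h1 | ⟨h1, h2⟩
  · rw [← hU, mem_natUndotted, natPartner_natPartner] at h1
    omega
  · rw [← hU] at h1
    have h3 := ih _ h1 h2
    rw [natPartner_natPartner] at h3
    have h4 := natPartner_injective _ h3
    omega

theorem Standard.eq_of_undotted {x y : DottedMatching n k} (hx : Standard x) (hy : Standard y)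
    (hU : natUndotted x = natUndotted y) {u : ℕ} (hu : u ∈ natUndotted x) :
    natPartner x.toPerfectMatching u = natPartner y.toPerfectMatching u := by
  have key : ∀ d, ∀ u ∈ natUndotted x, 2 * n ≤ u + d →
      natPartner x.toPerfectMatching u = natPartner y.toPerfectMatching u := by
    intro d
    induction d with
    | zero =>
      intro u hu h
      have := (mem_natUndotted.1 hu).1.1
      omega
    | succ d ih =>
      intro u hu h
      have h1 := hy.not_lt_of_undotted hU hu fun u' hu' h' => ih u' hu' (by omega)
      have h2 := hx.not_lt_of_undotted hU.symm (hU ▸ hu) fun u' hu' h' =>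
        (ih u' (hU ▸ hu') (by omega)).symm
      omega
  exact key (2 * n) u hu (by omega)

/-- A point that does not belong to an undotted arc belongs to a dotted one. -/
theorem mem_natDots_or {x : DottedMatching n k} {p : ℕ} (hp : p < 2 * n) (h1 : p ∉ natUndotted x)
    (h2 : natPartner x.toPerfectMatching p ∉ natUndotted x) :
    p ∈ natDots x ∨ natPartner x.toPerfectMatching p ∈ natDots x := by
  have h3 := natPartner_ne x.toPerfectMatching hp
  have h4 := natPartner_lt x.toPerfectMatching hp
  have h5 := natPartner_natPartner x.toPerfectMatching p
  rw [mem_natUndotted] at h1 h2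
  rw [h5] at h2
  by_contra h6
  push Not at h6
  rcases lt_or_gt_of_ne h3 with h | h
  · exact h2 ⟨⟨h4, h⟩, h6.2⟩
  · exact h1 ⟨⟨hp, h⟩, h6.1⟩

theorem lt_natPartner_of_mem_natDots {x : DottedMatching n k} {p : ℕ} (h : p ∈ natDots x) :
    p < natPartner x.toPerfectMatching p := (mem_natLefts.1 (natDots_subset x h)).2

/-- The points of undotted arcs of two standard matchings with the same undotted left ends agree. -/
theorem Standard.partner_mem_iff {x y : DottedMatching n k} (hx : Standard x) (hy : Standard y)
    (hU : natUndotted x = natUndotted y) {p : ℕ} :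
    natPartner x.toPerfectMatching p ∈ natUndotted x ↔
      natPartner y.toPerfectMatching p ∈ natUndotted y := by
  constructor
  · intro h
    have := hx.eq_of_undotted hy hU h
    rw [natPartner_natPartner] at this
    rw [← hU]
    nth_rewrite 1 [this]
    rwa [natPartner_natPartner]
  · intro h
    have := hy.eq_of_undotted hx hU.symm h
    rw [natPartner_natPartner] at this
    rw [hU]
    nth_rewrite 1 [this]
    rwa [natPartner_natPartner]

/-- The point `p` is the right end of a dotted arc of `y`, and all dotted arcs of `y` are nested. -/
theorem Standard.dot_lt {x y : DottedMatching n k} (hx : Standard x) (hy : Standard y)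
    (hU : natUndotted x = natUndotted y) {p q : ℕ} (hp : p ∈ natDots x) (hpy : p ∉ natDots y)
    (hq : q ∈ natDots y) : q < p := by
  have hp2 := lt_of_mem_natDots hp
  have h1 : p ∉ natUndotted y := by
    rw [← hU, mem_natUndotted]; exact fun h => h.2 hp
  have h2 : natPartner y.toPerfectMatching p ∉ natUndotted y := by
    rw [← hx.partner_mem_iff hy hU, mem_natUndotted, natPartner_natPartner]
    have := lt_natPartner_of_mem_natDots hp
    omega
  have h3 := (mem_natDots_or hp2 h1 h2).resolve_left hpy
  have h4 := lt_natPartner_of_mem_natDots h3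
  rw [natPartner_natPartner] at h4
  rcases lt_trichotomy q (natPartner y.toPerfectMatching p) with h5 | h5 | h5
  · omega
  · omega
  · have := hy.nat_nested h3 hq h5
    rwa [natPartner_natPartner] at this

theorem Standard.natDots_subset {x y : DottedMatching n k} (hx : Standard x) (hy : Standard y)
    (hU : natUndotted x = natUndotted y) : natDots x ⊆ natDots y := by
  intro p hp
  by_contra hpy
  have : ¬ natDots y ⊆ natDots x := fun h => hpy (by
    rw [Finset.eq_of_subset_of_card_le h (by rw [card_natDots, card_natDots])]
    exact hp)
  obtain ⟨q, hq, hqx⟩ := Finset.not_subset.1 this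
  have h1 := hx.dot_lt hy hU hp hpy hq
  have h2 := hy.dot_lt hx hU.symm hq hqx hp
  omega

theorem Standard.partner_anti {x : DottedMatching n k} (hx : Standard x) {a b : ℕ}
    (ha : a ∈ natDots x) (hb : b ∈ natDots x) (h : a < b) :
    natPartner x.toPerfectMatching b < natPartner x.toPerfectMatching a := by
  have h1 := hx.nat_nested ha hb h
  by_contra h2
  have h3 : natPartner x.toPerfectMatching a ≠ natPartner x.toPerfectMatching b := fun e => by
    have := natPartner_injective _ e
    omega
  exact natPartner_crossingless x.toCrossinglessMatching (lt_of_mem_natDots hb) h h1 (by omega)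

theorem Standard.not_lt_of_dot {x y : DottedMatching n k} (hx : Standard x) (hy : Standard y)
    (hU : natUndotted x = natUndotted y) (hD : natDots x = natDots y) {a : ℕ} (ha : a ∈ natDots x)
    (ih : ∀ b ∈ natDots x, b < a →
      natPartner x.toPerfectMatching b = natPartner y.toPerfectMatching b) :
    ¬ natPartner x.toPerfectMatching a < natPartner y.toPerfectMatching a := by
  intro h
  have ha' := lt_natPartner_of_mem_natDots (hD ▸ ha)
  have hlt := natPartner_lt y.toPerfectMatching (lt_of_mem_natDots ha)
  -- the partner of `a` in `y` is the partner in `x` of another dot `b`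
  have h1 : natPartner y.toPerfectMatching a ∉ natUndotted x := by
    rw [hU, mem_natUndotted, natPartner_natPartner]; omega
  have h2 : natPartner x.toPerfectMatching (natPartner y.toPerfectMatching a) ∉ natUndotted x := by
    rw [hx.partner_mem_iff hy hU, natPartner_natPartner, mem_natUndotted, ← hD]
    exact fun h => h.2 ha
  have h3 : natPartner y.toPerfectMatching a ∉ natDots x := by
    rw [hD]
    intro h3
    have := lt_natPartner_of_mem_natDots h3
    rw [natPartner_natPartner] at this
    omega
  have hb := (mem_natDots_or hlt h1 h2).resolve_left h3
  have e := natPartner_natPartner x.toPerfectMatching (natPartner y.toPerfectMatching a)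
  generalize natPartner x.toPerfectMatching (natPartner y.toPerfectMatching a) = b at hb e
  rcases lt_trichotomy b a with h4 | h4 | h4
  · have := ih b hb h4
    rw [e] at this
    have := natPartner_injective _ this
    omega
  · rw [h4] at e; omega
  · have := hx.partner_anti ha hb h4
    omega

/-- A standard dotted matching is determined by the left ends of its undotted arcs. -/
theorem Standard.eq_of_natUndotted_eq {x y : DottedMatching n k} (hx : Standard x)
    (hy : Standard y) (hU : natUndotted x = natUndotted y) : x = y := by
  have hD : natDots x = natDots y :=
    (hx.natDots_subset hy hU).antisymm (hy.natDots_subset hx hU.symm)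
  have hdot : ∀ a, a ∈ natDots x →
      natPartner x.toPerfectMatching a = natPartner y.toPerfectMatching a := by
    intro a
    induction a using Nat.strong_induction_on with
    | _ a ih =>
    intro ha
    have h1 := hx.not_lt_of_dot hy hU hD ha fun b hb h => ih b h hb
    have h2 := hy.not_lt_of_dot hx hU.symm hD.symm (hD ▸ ha) fun b hb h =>
      (ih b h (hD ▸ hb)).symm
    omega
  have hleft : ∀ a, a ∈ natLefts x.toPerfectMatching →
      natPartner x.toPerfectMatching a = natPartner y.toPerfectMatching a := by
    intro a ha
    by_cases h : a ∈ natDots x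
    · exact hdot a h
    · exact hx.eq_of_undotted hy hU (Finset.mem_filter.2 ⟨ha, h⟩)
  have hall : ∀ a < 2 * n,
      natPartner x.toPerfectMatching a = natPartner y.toPerfectMatching a := by
    intro a ha
    by_cases h : a ∈ natLefts x.toPerfectMatching
    · exact hleft a h
    · have h1 : natPartner x.toPerfectMatching a ∈ natLefts x.toPerfectMatching := by
        have := natPartner_ne x.toPerfectMatching ha
        rw [mem_natLefts] at h ⊢
        rw [natPartner_natPartner]
        exact ⟨natPartner_lt _ ha, by omega⟩
      have h2 := hleft _ h1
      rw [natPartner_natPartner] at h2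
      nth_rewrite 2 [h2]
      rw [natPartner_natPartner]
  have hp : x.partner = y.partner := by
    funext i
    refine Fin.ext ?_
    rw [← natPartner_val, ← natPartner_val]
    exact hall i i.2
  have hd : x.dots = y.dots := Finset.map_injective Fin.valEmbedding hD
  obtain ⟨⟨⟨_, _, _⟩, _⟩, _, _, _⟩ := x
  obtain ⟨⟨⟨_, _, _⟩, _⟩, _, _, _⟩ := y
  simp only at hp hd
  subst hp hd
  rfl

/-! ### Linear independence -/

/-- The coordinates of a standard dotted matching are a product over its arcs, as the lowering
operators of the dotted arcs vanish. -/
theorem Standard.arcsSt_eq {x : DottedMatching n k} (hx : Standard x) {ls : List ℕ}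
    (hls : ∀ i ∈ ls, i ∈ natLefts x.toPerfectMatching)
    (hI : InnerFirst (natPartner x.toPerfectMatching) ls) (ω : ℕ → Bool) :
    arcsSt (natPartner x.toPerfectMatching) (natDots x) ls ω =
      (ls.map fun i => if i ∈ natDots x then
        (if ω i ∨ ω (natPartner x.toPerfectMatching i) then 0 else 1)
        else cupW (ω i) (ω (natPartner x.toPerfectMatching i))).prod := by
  induction ls with
  | nil => rfl
  | cons i ls ih =>
    rw [innerFirst_cons] at hI
    have ih := ih (fun j hj => hls j (by simp [hj])) hI.2.2
    rw [List.map_cons, List.prod_cons, ← ih, arcsSt, arcStep]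
    by_cases hi : i ∈ natDots x
    · have hc : covers (natPartner x.toPerfectMatching) (natDots x) ls i = ∅ := by
        refine Finset.filter_eq_empty_iff.2 fun u hu => ?_
        rintro ⟨h1, h2, h3⟩
        have h4 := hx.nat_outer hi h1 h2
        have h5 := partner_notMem_natLefts (hls u (by simp [List.mem_toFinset.1 hu]))
        have h6 : i ≠ natPartner x.toPerfectMatching u := fun e => h5 (e ▸ Skein.natDots_subset x hi)
        omega
      have h0 := lowerOp_arcsSt (s := natDots x) hI.2.2 i ω
      rw [hc, Finset.sum_empty] at h0
      rw [if_pos hi, if_pos hi, dotSt, h0, mul_zero]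
      rcases ω i <;> rcases ω (natPartner x.toPerfectMatching i) <;> simp
    · rw [if_neg hi, if_neg hi, cupSt]

/-- The signs that are `true` at the left ends of the undotted arcs. -/
def undottedWord (x : DottedMatching n k) : List Bool :=
  (List.range (2 * n)).map fun r => decide (r ∈ natUndotted x)

theorem getD_undottedWord (x : DottedMatching n k) (r : ℕ) :
    (undottedWord x).getD r false = decide (r ∈ natUndotted x) := by
  rw [undottedWord, List.getD_eq_getElem?_getD, List.getElem?_map]
  by_cases hr : r < 2 * n
  · rw [List.getElem?_range hr]; rfl
  · rw [List.getElem?_eq_none (by simpa using hr), eq_comm]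
    simpa using fun h => hr (mem_natUndotted.1 h).1.1

theorem Standard.evRussell_eq {y : DottedMatching n k} (hy : Standard y) (x : DottedMatching n k) :
    evRussell n k (Finsupp.single y 1) (undottedWord x) = russellUnit k *
      (((natLefts y.toPerfectMatching).sort (· ≥ ·)).map fun i => if i ∈ natDots y then
        (if i ∈ natUndotted x ∨ natPartner y.toPerfectMatching i ∈ natUndotted x then 0 else 1)
        else cupW (decide (i ∈ natUndotted x))
          (decide (natPartner y.toPerfectMatching i ∈ natUndotted x))).prod := by
  rw [evRussell_apply, evQuot_expansionMap_single y (by simp [undottedWord]),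
    hy.arcsSt_eq (fun i hi => (Finset.mem_sort _).1 hi)
      (innerFirst_sort (arcSystem_natPartner y.toCrossinglessMatching))]
  simp only [getD_undottedWord, decide_eq_true_eq]

theorem Standard.evRussell_self {x : DottedMatching n k} (hx : Standard x) :
    evRussell n k (Finsupp.single x 1) (undottedWord x) = russellUnit k := by
  rw [hx.evRussell_eq, List.prod_eq_one, mul_one]
  intro z hz
  obtain ⟨i, hi, rfl⟩ := List.mem_map.1 hz
  rw [Finset.mem_sort] at hi
  have h1 : natPartner x.toPerfectMatching i ∉ natUndotted x := fun h =>
    partner_notMem_natLefts hi (Finset.mem_filter.1 h).1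
  by_cases hD : i ∈ natDots x
  · have h2 : i ∉ natUndotted x := fun h => (mem_natUndotted.1 h).2 hD
    simp [hD, h1, h2]
  · have h2 : i ∈ natUndotted x := Finset.mem_filter.2 ⟨hi, hD⟩
    simp [hD, h1, h2, cupW]

theorem card_natUndotted (x : DottedMatching n k) : (natUndotted x).card + k = n := by
  have h1 : (natLefts x.toPerfectMatching).card = n := by
    rw [natLefts, Finset.card_map, PerfectMatching.card_lefts]
  have h2 : natUndotted x = natLefts x.toPerfectMatching \ natDots x := by
    ext r; simp [natUndotted]
  have h3 := Finset.card_sdiff_add_card_eq_card (natDots_subset x)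
  rw [card_natDots, h1] at h3
  rw [h2]
  exact h3

/-- A coordinate of `y` at the word of `x` does not vanish only if one end of each undotted arc of `y`
is a left end of an undotted arc of `x`. As left ends are the smaller ends, the sum of the left ends
of `x` is at least that of `y`, and if they are equal, then so are the sets of left ends. -/
theorem Standard.eq_of_evRussell_ne_zero {x y : DottedMatching n k} (hx : Standard x)
    (hy : Standard y) (h : evRussell n k (Finsupp.single y 1) (undottedWord x) ≠ 0)
    (hw : ∑ u ∈ natUndotted x, u ≤ ∑ u ∈ natUndotted y, u) : x = y := by
  rw [hy.evRussell_eq] at h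
  have hinj := natPartner_injective y.toPerfectMatching
  -- each undotted arc of `y` has exactly one end that is a left end of an undotted arc of `x`
  have hone : ∀ u ∈ natUndotted y,
      ¬ (u ∈ natUndotted x ↔ natPartner y.toPerfectMatching u ∈ natUndotted x) := by
    intro u hu hiff
    refine h ?_
    rw [List.prod_eq_zero, mul_zero]
    refine List.mem_map.2 ⟨u, (Finset.mem_sort _).2 (Finset.mem_filter.1 hu).1, ?_⟩
    rw [if_neg (mem_natUndotted.1 hu).2]
    by_cases h1 : u ∈ natUndotted x
    · simp [h1, hiff.1 h1, cupW]
    · have h2 : natPartner y.toPerfectMatching u ∉ natUndotted x := fun h2 => h1 (hiff.2 h2)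
      simp only [h1, h2, decide_false]
      rfl
  set e : ℕ → ℕ := fun u => if u ∈ natUndotted x then u else natPartner y.toPerfectMatching u
    with he
  have he1 : ∀ u ∈ natUndotted y, u ≤ e u := by
    intro u hu
    simp only [he]
    split_ifs
    · exact le_rfl
    · exact (mem_natUndotted.1 hu).1.2.le
  have he2 : ∀ u ∈ natUndotted y, e u ∈ natUndotted x := by
    intro u hu
    have := hone u hu
    simp only [he]
    split_ifs with h1
    · exact h1
    · tauto
  have he3 : Set.InjOn e (natUndotted y) := by
    intro u hu v hv huv
    have hu' := partner_notMem_natLefts (Finset.mem_filter.1 hu).1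
    have hv' := partner_notMem_natLefts (Finset.mem_filter.1 hv).1
    simp only [he] at huv
    split_ifs at huv with h1 h2 h2
    · exact huv
    · exact absurd (Finset.mem_filter.1 hu).1 (huv ▸ hv')
    · exact absurd (Finset.mem_filter.1 hv).1 (huv ▸ hu')
    · exact hinj huv
  have hsub : (natUndotted y).image e ⊆ natUndotted x := Finset.image_subset_iff.2 he2
  have hsum : ∑ u ∈ natUndotted y, e u ≤ ∑ u ∈ natUndotted x, u := by
    rw [← Finset.sum_image (f := fun u => u) he3]
    exact Finset.sum_le_sum_of_subset hsub
  have hsum' : ∑ u ∈ natUndotted y, u = ∑ u ∈ natUndotted y, e u :=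
    le_antisymm (Finset.sum_le_sum he1) (hsum.trans hw)
  have heq := (Finset.sum_eq_sum_iff_of_le he1).1 hsum'
  have hyx : natUndotted y ⊆ natUndotted x := fun u hu => by
    rw [heq u hu]; exact he2 u hu
  have hc := card_natUndotted x
  have hc' := card_natUndotted y
  exact hx.eq_of_natUndotted_eq hy (Finset.eq_of_subset_of_card_le hyx (by omega)).symm

/-- The coordinates of the standard dotted matchings form a triangular system with units on the
diagonal. -/
theorem linearIndependent_standard (n k : ℕ) : LinearIndependent HalfLaurent
    fun x : {x : DottedMatching n k // Standard x} =>
      evRussell n k (Finsupp.single (x : DottedMatching n k) 1) := by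
  classical
  rw [linearIndependent_iff']
  intro s c hc
  by_contra hne
  push Not at hne
  obtain ⟨i₀, hi₀, hci₀⟩ := hne
  obtain ⟨i, hi, hmin⟩ := Finset.exists_min_image (s.filter fun i => c i ≠ 0)
    (fun i => ∑ u ∈ natUndotted (i : DottedMatching n k), u)
    ⟨i₀, Finset.mem_filter.2 ⟨hi₀, hci₀⟩⟩
  obtain ⟨his, hci⟩ := Finset.mem_filter.1 hi
  refine hci ?_
  have h := congrFun hc (undottedWord (i : DottedMatching n k))
  rw [Finset.sum_apply, Finset.sum_eq_single i, Pi.smul_apply, i.2.evRussell_self, smul_eq_mul] at h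
  · exact (isUnit_russellUnit k).mul_left_eq_zero.1 h
  · intro j hj hji
    rw [Pi.smul_apply, smul_eq_mul]
    by_cases hcj : c j = 0
    · rw [hcj, zero_mul]
    · by_cases h0 : evRussell n k (Finsupp.single (j : DottedMatching n k) 1)
        (undottedWord (i : DottedMatching n k)) = 0
      · rw [h0, mul_zero]
      · exact absurd (Subtype.ext (i.2.eq_of_evRussell_ne_zero j.2 h0
          (hmin j (Finset.mem_filter.2 ⟨hj, hcj⟩)))) hji.symm
  · exact fun h => absurd his h

end Skein


/-! ### The quantum Russell space is spanned by standard matchings -/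

namespace Skein

variable {n k : ℕ}

/-- The arc of `b` inside the arc of `a` may be taken out if no arc lies in between. -/
theorem _root_.ArcMove.exists_unnest (β : CrossinglessMatching (2 * n)) {a b : Fin (2 * n)}
    (hab : a < b) (hb : b < β.partner b) (hba : β.partner b < β.partner a)
    (hgap : ∀ e, a < e → e < b → ¬ β.partner b < β.partner e) :
    ∃ α, ArcMove α β a b (β.partner b) (β.partner a) := by
  set f := β.partner with hf
  have hinv : ∀ i, f (f i) = i := β.partner_partner
  have hne : ∀ i, f i ≠ i := β.partner_ne
  have hcr : ∀ i j, i < j → j < f i → ¬ f i < f j := fun i j h1 h2 h3 =>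
    β.crossingless i j ⟨h1, h2, h3⟩
  obtain ⟨c, hc⟩ : ∃ c, f b = c := ⟨_, rfl⟩
  obtain ⟨d, hd⟩ : ∃ d, f a = d := ⟨_, rfl⟩
  rw [hc] at hb hba hgap ⊢
  rw [hd] at hba ⊢
  have hc' : f c = b := by rw [← hc, hinv]
  have hd' : f d = a := by rw [← hd, hinv]
  refine ⟨⟨⟨fun j => if j = a then b else if j = b then a else if j = c then d else
    if j = d then c else f j, ?_, ?_⟩, ?_⟩, ?_⟩
  · grind
  · grind
  · have key : ∀ j, j ≠ a → j ≠ b → j ≠ c → j ≠ d →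
        (f j ≠ a ∧ f j ≠ b ∧ f j ≠ c ∧ f j ≠ d) ∧
        (a < j → j < b → a < f j ∧ f j < b) ∧ (c < j → j < d → c < f j ∧ f j < d) := by
      grind
    grind
  · constructor <;> grind

/-- Two arcs side by side may be nested if no arc contains only one of them. -/
theorem _root_.ArcMove.exists_nest (α : CrossinglessMatching (2 * n)) {a c : Fin (2 * n)}
    (ha : a < α.partner a) (hac : α.partner a < c) (hc : c < α.partner c)
    (hgap : ∀ e, α.partner a < e → e < c → α.partner a < α.partner e ∧ α.partner e < c) :
    ∃ β, ArcMove α β a (α.partner a) c (α.partner c) := by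
  set f := α.partner with hf
  have hinv : ∀ i, f (f i) = i := α.partner_partner
  have hne : ∀ i, f i ≠ i := α.partner_ne
  have hcr : ∀ i j, i < j → j < f i → ¬ f i < f j := fun i j h1 h2 h3 =>
    α.crossingless i j ⟨h1, h2, h3⟩
  obtain ⟨b, hb⟩ : ∃ b, f a = b := ⟨_, rfl⟩
  obtain ⟨d, hd⟩ : ∃ d, f c = d := ⟨_, rfl⟩
  rw [hb] at ha hac hgap ⊢
  rw [hd] at hc ⊢
  have hb' : f b = a := by rw [← hb, hinv]
  have hd' : f d = c := by rw [← hd, hinv]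
  refine ⟨⟨⟨fun j => if j = a then d else if j = d then a else if j = b then c else
    if j = c then b else f j, ?_, ?_⟩, ?_⟩, ?_⟩
  · grind
  · grind
  · grind
  · constructor <;> grind

/-- The number of arcs `(u, f u)` with `u < i < f u`. -/
def depth (α : CrossinglessMatching (2 * n)) (i : Fin (2 * n)) : ℕ :=
  (Finset.univ.filter fun u => u < i ∧ i < α.partner u).card

theorem _root_.ArcMove.depth_le {α β : CrossinglessMatching (2 * n)} {a b c d : Fin (2 * n)}
    (h : ArcMove α β a b c d) {i : Fin (2 * n)} (hb : i ≠ b) (hc : i ≠ c) :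
    depth α i ≤ depth β i := by
  obtain ⟨h1, h2, h3, h4, h5, h6, h7, h8⟩ := h
  have h4' := α.partner_partner a
  have h5' := α.partner_partner c
  have h6' := β.partner_partner a
  have h7' := β.partner_partner b
  -- if the arc `(c, d)` of `α` covers `i`, then the arc `(a, d)` of `β` takes its place
  refine Finset.card_le_card_of_injOn (fun u => if u = c then a else u) ?_ ?_
  · intro u hu
    simp only [Finset.coe_filter, Finset.mem_univ, true_and, Set.mem_ofPred_eq] at hu ⊢
    grind
  · intro u hu v hv huv
    simp only [Finset.coe_filter, Finset.mem_univ, true_and, Set.mem_ofPred_eq] at hu hv huv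
    grind

/-- The arcs of `α` around `i` lie around `b` in `β`, and there they do not exhaust the arcs around
`b`, since `(a, d)` is missing. -/
theorem _root_.ArcMove.depth_lt {α β : CrossinglessMatching (2 * n)} {a b c d : Fin (2 * n)}
    (h : ArcMove α β a b c d) {i : Fin (2 * n)}
    (hi : i = a ∨ i = c ∨ i < a ∧ d < α.partner i) :
    depth α i < depth β b := by
  obtain ⟨h1, h2, h3, h4, h5, h6, h7, h8⟩ := h
  have h4' := α.partner_partner a
  have h5' := α.partner_partner c
  have hcr : ∀ i j, i < j → j < α.partner i → ¬ α.partner i < α.partner j :=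
    fun i j h1 h2 h3 => α.crossingless i j ⟨h1, h2, h3⟩
  have hcr' : ∀ i j, i < j → j < β.partner i → ¬ β.partner i < β.partner j :=
    fun i j h1 h2 h3 => β.crossingless i j ⟨h1, h2, h3⟩
  refine Finset.card_lt_card (Finset.ssubset_iff_subset_ne.2 ⟨fun u hu => ?_, fun e => ?_⟩)
  · simp only [Finset.mem_filter, Finset.mem_univ, true_and] at hu ⊢
    have h9 := h8 u
    clear h8
    rcases hi with rfl | rfl | ⟨hi1, hi2⟩
    · have := hcr' u i
      clear hcr hcr'
      grind
    · have := hcr' b u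
      clear hcr hcr'
      grind
    · have := hcr u i
      clear hcr hcr'
      grind
  · have ha : a ∈ Finset.univ.filter fun u => u < b ∧ b < β.partner u := by
      simp only [Finset.mem_filter, Finset.mem_univ, true_and]
      grind
    rw [← e] at ha
    simp only [Finset.mem_filter, Finset.mem_univ, true_and] at ha
    grind

theorem _root_.ArcMove.depth_lt_right {α β : CrossinglessMatching (2 * n)} {a b c d : Fin (2 * n)}
    (h : ArcMove α β a b c d) : depth β a < depth β b := by
  obtain ⟨h1, h2, h3, h4, h5, h6, h7, h8⟩ := h
  have hcr' : ∀ i j, i < j → j < β.partner i → ¬ β.partner i < β.partner j :=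
    fun i j h1 h2 h3 => β.crossingless i j ⟨h1, h2, h3⟩
  refine Finset.card_lt_card (Finset.ssubset_iff_subset_ne.2 ⟨fun u hu => ?_, fun e => ?_⟩)
  · simp only [Finset.mem_filter, Finset.mem_univ, true_and] at hu ⊢
    have := hcr' u a
    clear hcr' h8
    grind
  · have ha : a ∈ Finset.univ.filter fun u => u < b ∧ b < β.partner u := by
      simp only [Finset.mem_filter, Finset.mem_univ, true_and]
      grind
    rw [← e] at ha
    simp at ha

end Skein


namespace Skein

variable {n k : ℕ}

theorem exists_isDiagram (α : CrossinglessMatching (2 * n)) {t : Finset (Fin (2 * n))}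
    (ht : ∀ i ∈ t, i < α.partner i) (hc : t.card = k) :
    ∃ m : DottedMatching n k, m.IsDiagram α t :=
  ⟨⟨α, t, ht, hc⟩, rfl, rfl⟩

/-- The total depth of the dotted arcs. -/
def dotDepth (x : DottedMatching n k) : ℕ := ∑ i ∈ x.dots, depth x.toCrossinglessMatching i

theorem dotDepth_of_isDiagram {m : DottedMatching n k} {α : CrossinglessMatching (2 * n)}
    {i : Fin (2 * n)} {s : Finset (Fin (2 * n))} (h : m.IsDiagram α (insert i s)) (hi : i ∉ s) :
    dotDepth m = depth α i + ∑ j ∈ s, depth α j := by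
  rw [dotDepth, h.1, h.2, Finset.sum_insert hi]

/-- No dotted arc lies inside an undotted arc. -/
def DotsOutermost (x : DottedMatching n k) : Prop :=
  ∀ a ∈ x.dots, ∀ u, u ∉ x.dots → u < a → ¬ a < x.partner u

/-- An undotted arc immediately around a dotted arc. -/
theorem exists_innermost_undotted {x : DottedMatching n k} (hx : ¬ DotsOutermost x) :
    ∃ a b, a ∉ x.dots ∧ b ∈ x.dots ∧ a < b ∧ x.partner b < x.partner a ∧
      ∀ e, a < e → e < b → ¬ x.partner b < x.partner e := by
  classical
  simp only [DotsOutermost, not_forall, not_not] at hx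
  obtain ⟨b, hb, a, ha, hab, hba⟩ := hx
  have hne : (Finset.univ.filter fun p : Fin (2 * n) × Fin (2 * n) => p.1 ∉ x.dots ∧ p.2 ∈ x.dots ∧
      p.1 < p.2 ∧ p.2 < x.partner p.1).Nonempty := ⟨(a, b), by simp [ha, hb, hab, hba]⟩
  obtain ⟨⟨a, b⟩, hp, hmin⟩ := Finset.exists_min_image _
    (fun p : Fin (2 * n) × Fin (2 * n) => (p.2 : ℕ) - (p.1 : ℕ)) hne
  simp only [Finset.mem_filter, Finset.mem_univ, true_and, Prod.forall] at hp hmin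
  have hcr : ∀ i j, i < j → j < x.partner i → ¬ x.partner i < x.partner j := fun i j h1 h2 h3 =>
    x.crossingless i j ⟨h1, h2, h3⟩
  obtain ⟨ha, hb, hab, hba⟩ := hp
  have hbl := x.lt_partner_of_mem_dots b hb
  have hinv := x.partner_partner
  refine ⟨a, b, ha, hb, hab, ?_, fun e h1 h2 h3 => ?_⟩
  · have := hcr a b hab hba
    have h5 : x.partner b ≠ x.partner a := fun e => by
      have := congrArg x.partner e
      rw [hinv, hinv] at this
      exact hab.ne' this
    exact lt_of_le_of_ne (not_lt.1 this) h5
  -- an arc in between, dotted or not, would be closer to one of the two arcs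
  · by_cases he : e ∈ x.dots
    · have h4 := hmin a e ⟨ha, he, h1, h2.trans hba⟩
      rw [Fin.lt_def] at h1 h2
      omega
    · have h4 := hmin e b ⟨he, hb, h2, hbl.trans h3⟩
      rw [Fin.lt_def] at h1 h2
      omega

/-- The Type I relation moves the dot on an arc out of an undotted arc immediately around it: in all
the other terms, the total depth of the dots is smaller. -/
theorem single_mem_of_dotsOutermost {P : Submodule QLaurent (FreeRussell n k)}
    (hP : russellRelations n k ≤ P) (h : ∀ x, DotsOutermost x → Finsupp.single x 1 ∈ P)
    (x : DottedMatching n k) : Finsupp.single x 1 ∈ P := by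
  induction hN : dotDepth x using Nat.strong_induction_on generalizing x with
  | _ N ih =>
  subst hN
  by_cases hx : DotsOutermost x
  · exact h x hx
  obtain ⟨a, b, ha, hb, hab, hba, hgap⟩ := exists_innermost_undotted hx
  have hbl := x.lt_partner_of_mem_dots b hb
  obtain ⟨α, hα⟩ := ArcMove.exists_unnest x.toCrossinglessMatching hab hbl hba hgap
  have hinv := x.partner_partner
  set s := x.dots.erase b with hs
  have hdot : ∀ j ∈ s, j < x.partner j := fun j hj =>
    x.lt_partner_of_mem_dots j (Finset.mem_of_mem_erase hj)
  have has : a ∉ s := fun h => ha (Finset.mem_of_mem_erase h)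
  have hbs : b ∉ s := Finset.notMem_erase b _
  have hcs : x.partner b ∉ s := fun h => by
    have := hdot _ h
    rw [hinv] at this
    exact this.not_gt hbl
  have hds : x.partner a ∉ s := fun h => by
    have := hdot _ h
    rw [hinv] at this
    exact this.not_gt (hab.trans (hbl.trans hba))
  have hsα : ∀ j ∈ s, j < α.partner j := fun j hj => by
    rw [hα.eq_elsewhere j (fun e => has (e ▸ hj)) (fun e => hbs (e ▸ hj)) (fun e => hcs (e ▸ hj))
      (fun e => hds (e ▸ hj))]
    exact hdot j hj
  have hcard : ∀ i, i ∉ s → (insert i s).card = k := fun i hi => by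
    rw [Finset.card_insert_of_notMem hi, hs, Finset.card_erase_add_one hb, x.card_dots]
  have hins : ∀ {γ : CrossinglessMatching (2 * n)} {i}, (∀ j ∈ s, j < γ.partner j) →
      i < γ.partner i → ∀ j ∈ insert i s, j < γ.partner j := fun h1 h2 j hj => by
    rcases Finset.mem_insert.1 hj with rfl | hj
    exacts [h2, h1 j hj]
  have hdepth : ∀ i, i ∉ s → depth α i < depth x.toCrossinglessMatching b → ∀ y : DottedMatching n k,
      y.IsDiagram α (insert i s) → Finsupp.single y 1 ∈ P := fun i hi hlt y hy => by
    refine ih _ ?_ y rfl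
    rw [dotDepth_of_isDiagram hy hi, dotDepth_of_isDiagram (m := x) (s := s)
      ⟨rfl, (Finset.insert_erase hb).symm⟩ hbs]
    refine add_lt_add_of_lt_of_le hlt (Finset.sum_le_sum fun j hj => ?_)
    exact hα.depth_le (fun e => hbs (e ▸ hj)) (fun e => hcs (e ▸ hj))
  obtain ⟨m₁, hm₁⟩ := exists_isDiagram α (hins hsα (hα.left_ab.symm ▸ hab)) (hcard a has)
  obtain ⟨m₂, hm₂⟩ := exists_isDiagram α (hins hsα (hα.left_cd.symm ▸ hba)) (hcard _ hcs)
  obtain ⟨m₁', hm₁'⟩ := exists_isDiagram x.toCrossinglessMatching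
    (hins hdot (hab.trans (hbl.trans hba))) (hcard a has)
  have hmx : ∀ u, ∃ y : DottedMatching n k, u ∈ outerUndotted α s a (x.partner a) →
      y.IsDiagram α (insert u s) := fun u => by
    by_cases hu : u ∈ outerUndotted α s a (x.partner a)
    · obtain ⟨h1, h2, h3⟩ := (Finset.mem_filter.1 hu).2
      obtain ⟨y, hy⟩ := exists_isDiagram α
        (hins hsα (h1.trans ((hab.trans (hbl.trans hba)).trans h2))) (hcard u h3)
      exact ⟨y, fun _ => hy⟩
    · exact ⟨x, fun h => absurd h hu⟩
  choose mx hmx using hmx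
  have hrel := hP (Submodule.subset_span (Or.inl ⟨α, x.toCrossinglessMatching, a, b, _, _, s, x, m₁, m₂,
    m₁', mx, hα, has, hbs, hcs, hds, ⟨rfl, (Finset.insert_erase hb).symm⟩, hm₁, hm₂, hm₁', hmx, rfl⟩))
  refine (Submodule.sub_mem_iff_left P ?_).1 hrel
  refine P.add_mem (P.add_mem (P.add_mem ?_ ?_) (P.smul_mem _ ?_)) (P.smul_mem _ (P.sum_mem
    fun u hu => P.smul_mem _ ?_))
  · exact hdepth a has (hα.depth_lt (Or.inl rfl)) m₁ hm₁
  · exact hdepth _ hcs (hα.depth_lt (Or.inr (Or.inl rfl))) m₂ hm₂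
  · refine ih _ ?_ m₁' rfl
    rw [dotDepth_of_isDiagram hm₁' has, dotDepth_of_isDiagram (m := x) (s := s)
      ⟨rfl, (Finset.insert_erase hb).symm⟩ hbs]
    exact Nat.add_lt_add_right hα.depth_lt_right _
  · obtain ⟨h1, h2, h3⟩ := (Finset.mem_filter.1 hu).2
    exact hdepth u h3 (hα.depth_lt (Or.inr (Or.inr ⟨h1, h2⟩))) _ (hmx u hu)

/-- Two dotted arcs side by side, with no arc around only one of them. -/
theorem exists_adjacent_dotted {x : DottedMatching n k} (hx : DotsOutermost x)
    (hx' : ¬ ∀ a ∈ x.dots, ∀ b ∈ x.dots, a < b → b < x.partner a) :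
    ∃ a ∈ x.dots, ∃ c ∈ x.dots, x.partner a < c ∧
      ∀ e, x.partner a < e → e < c → x.partner a < x.partner e ∧ x.partner e < c := by
  classical
  simp only [not_forall] at hx'
  obtain ⟨a, ha, c, hc, hac, hca⟩ := hx'
  have hinv := x.partner_partner
  have hlt : x.partner a < c := lt_of_le_of_ne (not_lt.1 hca) fun e => by
    have h1 := x.lt_partner_of_mem_dots a ha
    have h2 := x.lt_partner_of_mem_dots c hc
    rw [← e, hinv] at h2
    exact h1.not_gt h2
  have hne : (Finset.univ.filter fun p : Fin (2 * n) × Fin (2 * n) => p.1 ∈ x.dots ∧ p.2 ∈ x.dots ∧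
      x.partner p.1 < p.2).Nonempty := ⟨(a, c), by simp [ha, hc, hlt]⟩
  obtain ⟨⟨a, c⟩, hp, hmin⟩ := Finset.exists_min_image _
    (fun p : Fin (2 * n) × Fin (2 * n) => (p.2 : ℕ) - (x.partner p.1 : ℕ)) hne
  simp only [Finset.mem_filter, Finset.mem_univ, true_and, Prod.forall] at hp hmin
  obtain ⟨ha, hc, hac⟩ := hp
  have hcr : ∀ i j, i < j → j < x.partner i → ¬ x.partner i < x.partner j := fun i j h1 h2 h3 =>
    x.crossingless i j ⟨h1, h2, h3⟩
  have hal := x.lt_partner_of_mem_dots a ha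
  have hcl := x.lt_partner_of_mem_dots c hc
  refine ⟨a, ha, c, hc, hac, fun e h1 h2 => ⟨?_, ?_⟩⟩
  · by_contra h3
    -- an arc around `a` that ends before `c` is dotted, and closer to `c`
    have h4 : x.partner e < a := by
      have := hcr a (x.partner e)
      rw [hinv] at this
      have h5 : x.partner e ≠ x.partner a := fun h => by
        have := congrArg x.partner h
        rw [hinv, hinv] at this
        exact (hal.trans h1).ne' this
      have h6 : x.partner e ≠ a := fun h => h1.ne (by rw [← h, hinv])
      grind
    have h5 : x.partner e ∈ x.dots := by
      by_contra h5
      refine hx a ha _ h5 h4 ?_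
      rw [hinv]
      exact hal.trans h1
    have h6 := hmin (x.partner e) c ⟨h5, hc, by rwa [hinv]⟩
    rw [hinv] at h6
    rw [Fin.lt_def] at h1 h2
    omega
  · by_contra h3
    -- an arc around `c` that starts after `a` is dotted, and closer to `a`
    have h4 : c < x.partner e := by
      refine lt_of_le_of_ne (not_lt.1 h3) fun h => ?_
      rw [h, hinv] at hcl
      exact h2.not_gt (h ▸ hcl)
    have h5 : e ∈ x.dots := by
      by_contra h5
      exact hx c hc e h5 h2 h4
    have h6 := hmin a e ⟨ha, h5, h1⟩
    rw [Fin.lt_def] at h1 h2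
    omega

/-- The Type II relation nests two dotted arcs that lie side by side: if there are no undotted arcs
around them, it has no correction terms. -/
theorem single_mem_of_standard {P : Submodule QLaurent (FreeRussell n k)}
    (hP : russellRelations n k ≤ P) (h : ∀ x, Standard x → Finsupp.single x 1 ∈ P)
    (x : DottedMatching n k) (hx : DotsOutermost x) : Finsupp.single x 1 ∈ P := by
  induction hN : ∑ i ∈ x.dots, (i : ℕ) using Nat.strong_induction_on generalizing x with
  | _ N ih =>
  subst hN
  by_cases hx' : ∀ a ∈ x.dots, ∀ b ∈ x.dots, a < b → b < x.partner a
  · exact h x ⟨hx', hx⟩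
  obtain ⟨a, ha, c, hc, hac, hgap⟩ := exists_adjacent_dotted hx hx'
  have hal := x.lt_partner_of_mem_dots a ha
  have hcl := x.lt_partner_of_mem_dots c hc
  have hinv := x.partner_partner
  obtain ⟨β, hβ⟩ := ArcMove.exists_nest x.toCrossinglessMatching hal hac hcl hgap
  set s := (x.dots.erase a).erase c with hs
  have hsx : ∀ j ∈ s, j ∈ x.dots := fun j hj =>
    Finset.mem_of_mem_erase (Finset.mem_of_mem_erase hj)
  have hdot : ∀ j ∈ s, j < x.partner j := fun j hj => x.lt_partner_of_mem_dots j (hsx j hj)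
  have hca : c ∈ x.dots.erase a := Finset.mem_erase.2 ⟨(hal.trans hac).ne', hc⟩
  have has : a ∉ s := fun h => Finset.notMem_erase a _ (Finset.mem_of_mem_erase h)
  have hcs : c ∉ s := Finset.notMem_erase c _
  have hbs : x.partner a ∉ s := fun h => by
    have := hdot _ h
    rw [hinv] at this
    exact this.not_gt hal
  have hds : x.partner c ∉ s := fun h => by
    have := hdot _ h
    rw [hinv] at this
    exact this.not_gt hcl
  have hxs : x.dots = insert a (insert c s) := by
    rw [hs, Finset.insert_erase hca, Finset.insert_erase ha]
  have hsβ : ∀ j ∈ s, β.partner j = x.partner j := fun j hj =>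
    (hβ.eq_elsewhere j (fun e => has (e ▸ hj)) (fun e => hbs (e ▸ hj)) (fun e => hcs (e ▸ hj))
      (fun e => hds (e ▸ hj))).symm
  have hab' : a ∉ insert (x.partner a) s := by simp [has, hal.ne]
  have hac' : a ∉ insert c s := by simp [has, (hal.trans hac).ne]
  obtain ⟨m', hm'⟩ : ∃ m' : DottedMatching n k, m'.IsDiagram β (insert a (insert (x.partner a) s)) := by
    refine exists_isDiagram β (fun j hj => ?_) ?_
    · rcases Finset.mem_insert.1 hj with rfl | hj
      · rw [hβ.right_ad]
        exact hal.trans (hac.trans hcl)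
      rcases Finset.mem_insert.1 hj with rfl | hj
      · rw [hβ.right_bc]
        exact hac
      · rw [hsβ j hj]
        exact hdot j hj
    · have h1 := x.card_dots
      rw [hxs, Finset.card_insert_of_notMem hac', Finset.card_insert_of_notMem hcs] at h1
      rw [Finset.card_insert_of_notMem hab', Finset.card_insert_of_notMem hbs, h1]
  have hempty : outerUndotted x.toCrossinglessMatching s a (x.partner c) = ∅ := by
    refine Finset.filter_eq_empty_iff.2 fun u _ => ?_
    rintro ⟨h1, h2, h3⟩
    refine hx a ha u (fun h4 => ?_) h1 (hal.trans (hac.trans (hcl.trans h2)))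
    rw [hxs, Finset.mem_insert, Finset.mem_insert] at h4
    rcases h4 with h4 | h4 | h4
    · exact h1.ne h4
    · exact (h4 ▸ h1).not_gt (hal.trans hac)
    · exact h3 h4
  have hrel := hP (Submodule.subset_span (Or.inr ⟨x.toCrossinglessMatching, β, a, _, c, _, s, x, m',
    fun _ => x, hβ, has, hbs, hcs, hds, ⟨rfl, hxs⟩, hm', by simp [hempty], rfl⟩))
  refine (Submodule.sub_mem_iff_left P ?_).1 hrel
  rw [hempty, Finset.sum_empty, smul_zero, add_zero]
  refine ih _ ?_ m' ?_ rfl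
  · rw [hm'.2, hxs, Finset.sum_insert hab', Finset.sum_insert hbs, Finset.sum_insert hac',
      Finset.sum_insert hcs]
    have := Fin.lt_def.1 hac
    omega
  · have hm : ∀ j, m'.partner j = β.partner j := fun j => by rw [hm'.1]
    intro j hj u hu huj
    rw [hm'.2, Finset.mem_insert, Finset.mem_insert] at hj hu
    rw [hm]
    simp only [not_or] at hu
    intro hju
    have hβc : β.partner c = x.partner a := by rw [← hβ.right_bc, β.partner_partner]
    have hβd : β.partner (x.partner c) = a := by rw [← hβ.right_ad, β.partner_partner]
    have hxu : u ≠ c → u ≠ x.partner c → x.partner u = β.partner u := fun h1 h2 =>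
      hβ.eq_elsewhere u hu.1 hu.2.1 h1 h2
    have hcr := x.crossingless a u
    have h1 := hx a ha u
    have h2 := hx j
    have h3 : u ∉ x.dots ↔ u ≠ a ∧ u ≠ c ∧ u ∉ s := by rw [hxs]; simp
    have h4 := hsx j
    clear * - hu huj hju hβc hβd hxu hcr h1 h2 h3 h4 hal hac hcl hj
    grind

/-- The Type I and Type II relations reduce every dotted matching to standard ones. -/
theorem span_mkQ_standard (n k : ℕ) : Submodule.span QLaurent
    (Set.range fun x : {x : DottedMatching n k // Standard x} =>
      (russellRelations n k).mkQ (Finsupp.single x.1 1)) = ⊤ := by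
  set W := Submodule.span QLaurent (Set.range fun x : {x : DottedMatching n k // Standard x} =>
      (russellRelations n k).mkQ (Finsupp.single x.1 1)) with hW
  have hP : russellRelations n k ≤ W.comap (russellRelations n k).mkQ := fun r hr => by
    rw [Submodule.mem_comap, Submodule.mkQ_apply, (Submodule.Quotient.mk_eq_zero _).2 hr]
    exact W.zero_mem
  have h : ∀ x, Finsupp.single x 1 ∈ W.comap (russellRelations n k).mkQ := fun x =>
    single_mem_of_dotsOutermost hP (single_mem_of_standard hP fun x hx =>
      Submodule.subset_span ⟨⟨x, hx⟩, rfl⟩) x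
  rw [eq_top_iff]
  rintro y -
  obtain ⟨y, rfl⟩ := (russellRelations n k).mkQ_surjective y
  induction y using Finsupp.induction_linear with
  | zero => simp
  | add f g hf hg => rw [map_add]; exact W.add_mem hf hg
  | single x r =>
    have := W.smul_mem r (h x)
    rwa [← map_smul, Finsupp.smul_single_one] at this

end Skein


/-! ### The isomorphism -/

namespace Skein

open scoped TensorProduct

variable {n k : ℕ}

/-- A linear map that sends a generating family to a linearly independent one is injective. -/
theorem injective_of_linearIndependent_comp {R M N ι : Type*} [CommRing R] [AddCommGroup M]
    [AddCommGroup N] [Module R M] [Module R N] (L : M →ₗ[R] N) (b : ι → M)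
    (hb : Submodule.span R (Set.range b) = ⊤) (hL : LinearIndependent R fun i => L (b i)) :
    Function.Injective L := by
  refine (injective_iff_map_eq_zero L).2 fun x hx => ?_
  have hx' : x ∈ Submodule.span R (Set.range b) := hb ▸ Submodule.mem_top
  obtain ⟨c, rfl⟩ := (Finsupp.mem_span_range_iff_exists_finsupp).1 hx'
  have h : c = 0 := linearIndependent_iff.1 hL c (by
    rw [Finsupp.linearCombination_apply]
    simpa [Finsupp.sum, map_sum] using hx)
  simp [h]

theorem expansionMap_single (x : DottedMatching n k) : expansionMap n k (Finsupp.single x 1) =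
    qHalfPow (-(x.nestedPairs : ℤ)) • klClass n k x.expand.draw := by
  rw [expansionMap, Finsupp.linearCombination_single, one_smul]

theorem span_expansionMap_standard (n k : ℕ) : Submodule.span HalfLaurent
    (Set.range fun x : {x : DottedMatching n k // Standard x} =>
      (klEncloseRange n k).mkQ (expansionMap n k (Finsupp.single x.1 1))) = ⊤ := by
  rw [eq_top_iff, ← span_standard_eq_top n k, Submodule.span_le]
  rintro y ⟨x, hx, rfl⟩
  have h := Submodule.smul_mem _ (qHalfPow (x.nestedPairs : ℤ)) (Submodule.subset_span
    (R := HalfLaurent) (Set.mem_range_self (f := fun x : {x : DottedMatching n k // Standard x} =>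
      (klEncloseRange n k).mkQ (expansionMap n k (Finsupp.single x.1 1))) ⟨x, hx⟩))
  dsimp only at h
  rwa [expansionMap_single, map_smul, smul_smul, qHalfPow_mul_neg, one_smul] at h

/-- The coordinates of the standard generators are linearly independent, and hence the coordinates
separate the points of `S^q_{n,k}`. -/
theorem evQuot_injective (n k : ℕ) : Function.Injective (evQuot n k) :=
  injective_of_linearIndependent_comp (evQuot n k) _ (span_expansionMap_standard n k)
    (linearIndependent_standard n k)

theorem mkQ_expansionMap_eq_zero {r : FreeRussell n k} (hr : r ∈ russellRelations n k) :
    (klEncloseRange n k).mkQ (expansionMap n k r) = 0 :=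
  evQuot_injective n k (by
    rw [map_zero]
    exact russellRelations_le_ker hr)

/-- The map `ψ_{n,k} : R^q_{n,k} → S^q_{n,k}` that the expansion map induces. -/
noncomputable def russellMap (n k : ℕ) : QuantumRussell n k →ₗ[QLaurent] KLQuotient n k :=
  (russellRelations n k).liftQ
    (((klEncloseRange n k).mkQ.restrictScalars QLaurent).comp (expansionMap n k))
    fun _ hr => mkQ_expansionMap_eq_zero hr

theorem russellMap_mkQ (x : FreeRussell n k) : russellMap n k ((russellRelations n k).mkQ x) =
    (klEncloseRange n k).mkQ (expansionMap n k x) := rfl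

theorem span_one_tmul_standard (n k : ℕ) : Submodule.span HalfLaurent
    (Set.range fun x : {x : DottedMatching n k // Standard x} =>
      (1 : HalfLaurent) ⊗ₜ[QLaurent] (russellRelations n k).mkQ (Finsupp.single x.1 1)) = ⊤ := by
  have h := Submodule.baseChange_span (R := QLaurent) (M := QuantumRussell n k) HalfLaurent (Set.range
    fun x : {x : DottedMatching n k // Standard x} =>
      (russellRelations n k).mkQ (Finsupp.single x.1 1))
  rw [span_mkQ_standard, Submodule.baseChange_top, ← Set.range_comp] at h
  exact h.symm

theorem liftBaseChange_russellMap_bijective (n k : ℕ) :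
    Function.Bijective ((russellMap n k).liftBaseChange HalfLaurent) := by
  have hone : ∀ x : FreeRussell n k, (russellMap n k).liftBaseChange HalfLaurent
      ((1 : HalfLaurent) ⊗ₜ[QLaurent] (russellRelations n k).mkQ x) =
      (klEncloseRange n k).mkQ (expansionMap n k x) := fun x => by
    rw [LinearMap.liftBaseChange_tmul, one_smul, russellMap_mkQ]
  constructor
  · refine Function.Injective.of_comp (f := evQuot n k) ?_
    refine injective_of_linearIndependent_comp
      ((evQuot n k).comp ((russellMap n k).liftBaseChange HalfLaurent)) _
      (span_one_tmul_standard n k) ?_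
    simp only [LinearMap.comp_apply, hone]
    exact linearIndependent_standard n k
  · refine LinearMap.range_eq_top.1 (top_le_iff.1 ?_)
    rw [← span_expansionMap_standard n k, Submodule.span_le]
    rintro _ ⟨x, rfl⟩
    exact ⟨_, hone _⟩

end Skein

theorem mainTheorem3 (n k : ℕ) (hk : k ≤ n) :
    (∀ r ∈ typeIRelations n k ∪ typeIIRelations n k,
      (klEncloseRange n k).mkQ (expansionMap n k r) = 0) ∧
    ∃ ψ : QuantumRussell n k →ₗ[QLaurent] KLQuotient n k,
      (∀ x : FreeRussell n k,
        ψ ((russellRelations n k).mkQ x) = (klEncloseRange n k).mkQ (expansionMap n k x)) ∧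
      Function.Bijective (ψ.liftBaseChange HalfLaurent) :=
  ⟨fun _ hr => Skein.mkQ_expansionMap_eq_zero (Submodule.subset_span hr), Skein.russellMap n k,
    Skein.russellMap_mkQ, Skein.liftBaseChange_russellMap_bijective n k⟩
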